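/- Let $X$ be a compact connected Riemann surface with canonical bundle $K_X$, and fix a square root $K_X^{1/2}$. Let ${}^LG$ be a connected simple complex algebraic group with a pinning (maximal torus $T$, Borel subgroup $B\supset T$ with unipotent radical $[B,B]$, simple root vectors) and the corresponding split real form, whose complex conjugation acts on ${}^LG(\mathbb C)$; let $\rho$ be the half-sum of its positive coroots, and $w_0$ the longest element of its Weyl group. Let $\chi$ be a holomorphic ${}^LG$-oper on $X$ in the component given by $K_X^{1/2}$: a holomorphic $B$-bundle whose associated $T=B/[B,B]$-bundle is identified with the one induced from $K_X^{1/2}$ by the cocharacter $2\rho$, together with a holomorphic connection on the induced ${}^LG$-bundle which, locally, is $\partial_z+A(z)$ with $A(z)$ in the sum of $\mathrm{Lie}(B)$ and the root spaces of the negative simple roots, all of its components in these root spaces being nowhere zero. For a dominant integral weight $\lambda$ of $T$, let $V_\lambda$ be the irreducible representation of ${}^LG$ of highest weight $\lambda$, let $(\mathcal V_\lambda,\nabla_{\chi,\lambda})$ be the associated holomorphic flat bundle on $X$, and let $s_\lambda\in\Gamma(X,K_X^{-\langle\lambda,\rho\rangle}\otimes\mathcal V_\lambda)$ be the canonical section,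 given by the line subbundle $K_X^{\langle\lambda,\rho\rangle}\hookrightarrow\mathcal V_\lambda$ of highest weight vectors. Let $\mathcal D_{X,-\langle\lambda,\rho\rangle}$ be the sheaf of holomorphic differential operators on $K_X^{-\langle\lambda,\rho\rangle}$, acting on $K_X^{-\langle\lambda,\rho\rangle}\otimes\mathcal V_\lambda$ through $\nabla_{\chi,\lambda}$, and let $I_{\lambda,\chi}\subset\mathcal D_{X,-\langle\lambda,\rho\rangle}$ be the left ideal sheaf annihilating $s_\lambda$. Let $\Omega_X=K_X\otimes\overline{K_X}$, with transition functions $|dz'/dz|^2$; its real powers are defined, and holomorphic (antiholomorphic) differential operators on $K_X^{-\langle\lambda,\rho\rangle}$ ($\overline{K}_X^{-\langle\lambda,\rho\rangle}$) act on smooth sections of $\Omega_X^{-\langle\lambda,\rho\rangle}$. Note that $\langle -w_0(\lambda),\rho\rangle=\langle\lambda,\rho\rangle$. Suppose that $\chi$ is real, that is, its monodromy representation $\pi_1(X,p)\to{}^LG(\mathbb C)$ is conjugate in ${}^LG(\mathbb C)$ to its complex conjugate, and that the monodromy representation of $(\mathcal V_\lambda,\nabla_{\chi,\lambda})$ is irreducible.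 Then there is a non-degenerate pairing of $C^\infty$ flat bundles $$h_{\chi,\lambda}:(\mathcal V_\lambda,\nabla_{\chi,\lambda})\otimes(\overline{\mathcal V}_{-w_0(\lambda)},\overline\nabla_{\chi,-w_0(\lambda)})\to(\mathcal C^\infty_X,d),$$ and for every such pairing $h_{\chi,\lambda}(s_\lambda,\overline{s_{-w_0(\lambda)}})$ is a non-zero smooth section of $\Omega_X^{-\langle\lambda,\rho\rangle}$ annihilated by the ideals $I_{\lambda,\chi}$ and $\overline{I_{-w_0(\lambda),\chi}}$, and every smooth section of $\Omega_X^{-\langle\lambda,\rho\rangle}$ annihilated by both ideals is a scalar multiple of it. -/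

import Mathlib

open scoped Manifold ContDiff Matrix

attribute [local instance 100] LieRing.ofAssociativeRing

noncomputable section

namespace RealOper

/-! ### The group -/

/-- Square complex matrices of size `N`. -/
abbrev Mat (N : ℕ) := Matrix (Fin N) (Fin N) ℂ

/-- The matrix exponential, as an invertible matrix. -/
def expGL {N : ℕ} (Y : Mat N) : GL (Fin N) ℂ := (Matrix.isUnit_exp Y).unit

/-- The connected subgroup of `GL_N(ℂ)` with Lie algebra `L`: the subgroup generated by the
exponentials of the elements of `L`. -/
def expGroup {N : ℕ} (L : Set (Mat N)) : Subgroup (GL (Fin N) ℂ) :=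
  Subgroup.closure (expGL '' L)

/-- A set of invertible matrices is Zariski closed in `GL_N(ℂ)`. -/
def IsZariskiClosed {N : ℕ} (S : Set (GL (Fin N) ℂ)) : Prop :=
  ∃ E : Set (MvPolynomial (Fin N × Fin N) ℂ), ∀ g : GL (Fin N) ℂ,
    g ∈ S ↔ ∀ p ∈ E, MvPolynomial.eval (fun ij => (g : Mat N) ij.1 ij.2) p = 0

/-- A pinned connected simple complex linear algebraic group `G ⊆ GL_N(ℂ)` of rank `r`, with its
split real structure.

`lie` is its Lie algebra, which is simple; `cartan` is a Cartan subalgebra, and `pin` consists of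
the simple coroots `h i`, the simple root vectors `e i`, the opposite simple root vectors `f i`
and the Cartan matrix `A` (with `⁅h j, e i⁆ = A i j • e i`).  The group itself is the connected
group `expGroup lie`, which is Zariski closed.  The embedding in `GL_N` is defined over `ℝ` for the
split real form given by the pinning: the matrices `e i` and `f i` have real entries, so that the
complex conjugation of `G` with respect to its split real form is entrywise conjugation. -/
structure SimpleGroup (N r : ℕ) where
  lie : LieSubalgebra ℂ (Mat N)
  simple : LieAlgebra.IsSimple ℂ lie
  cartan : LieSubalgebra ℂ lie
  pin : LieAlgebra.Basis (Fin r) cartan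
  zariskiClosed : IsZariskiClosed (expGroup (lie : Set (Mat N)) : Set (GL (Fin N) ℂ))
  real_e : ∀ i, ((pin.e i : lie) : Mat N).map (starRingEnd ℂ) = ((pin.e i : lie) : Mat N)
  real_f : ∀ i, ((pin.f i : lie) : Mat N).map (starRingEnd ℂ) = ((pin.f i : lie) : Mat N)

namespace SimpleGroup

variable {N r : ℕ} (G : SimpleGroup N r)

/-- The group of complex points of `G`. -/
def grp : Subgroup (GL (Fin N) ℂ) := expGroup (G.lie : Set (Mat N))

/-- The exponential map of `G`. -/
def exp (Y : G.lie) : G.grp :=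
  ⟨expGL (Y : Mat N), Subgroup.subset_closure ⟨(Y : Mat N), Y.2, rfl⟩⟩

/-- The matrix of an element of `G`. -/
def mat (g : G.grp) : Mat N := ((g : GL (Fin N) ℂ) : Mat N)

/-- The nilpotent subalgebra generated by the simple root vectors. -/
def nPlus : LieSubalgebra ℂ G.lie := LieSubalgebra.lieSpan ℂ G.lie (Set.range G.pin.e)

/-- The opposite nilpotent subalgebra. -/
def nMinus : LieSubalgebra ℂ G.lie := LieSubalgebra.lieSpan ℂ G.lie (Set.range G.pin.f)

/-- The Borel subalgebra, as a subspace. -/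
def borel : Submodule ℂ G.lie := G.cartan.toSubmodule ⊔ G.nPlus.toSubmodule

/-- The unipotent radical `[B, B]` of the Borel subgroup. -/
def unipotent : Subgroup G.grp := Subgroup.closure (G.exp '' (G.nPlus : Set G.lie))

/-- The coefficients `c` of `ρ = ∑ c j • h j`, the element of the Cartan subalgebra on which every
simple root takes the value `1`.  It is the half-sum of the positive coroots of `G`, that is, of
the positive roots of the Langlands dual group. -/
def rhoCoeff : Fin r → ℝ := (G.pin.A.map (Int.cast : ℤ → ℝ))⁻¹ *ᵥ (fun _ => 1)

/-- The element `2ρ` of the Cartan subalgebra. -/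
def twoRho : G.lie := ∑ j, ((2 * G.rhoCoeff j : ℝ) : ℂ) • G.pin.h j

/-- The cocharacter `2ρ : ℂˣ → T`, `z ↦ z ^ (2ρ)`; it does not depend on the branch of the logarithm
since `2ρ` is an integral combination of coroots. -/
def twoRhoCochar (z : ℂ) : G.grp := G.exp (Complex.log z • G.twoRho)

/-- The number `⟨λ, ρ⟩`, where the weight `λ` is given by its values on the simple coroots. -/
def rhoPairing (lam : Fin r → ℕ) : ℝ := ∑ j, G.rhoCoeff j * lam j

/-- `mu = -w₀(lam)`, where `w₀` is the longest element of the Weyl group: there is `n ∈ G` which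
normalizes the maximal torus, conjugates the Borel subgroup to the opposite one, and satisfies
`mu(Y) = - lam(n⁻¹ Y n)` for `Y` in the Cartan subalgebra.  Weights are given by their values on
the simple coroots. -/
def IsNegLongest (lam mu : Fin r → ℕ) : Prop :=
  ∃ (n : G.grp) (w : Matrix (Fin r) (Fin r) ℂ),
    (∀ i, G.mat n⁻¹ * (G.pin.h i : Mat N) * G.mat n = ∑ j, w i j • (G.pin.h j : Mat N)) ∧
    (∀ i, ∃ Y ∈ G.nMinus, G.mat n⁻¹ * (G.pin.e i : Mat N) * G.mat n = (Y : Mat N)) ∧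
    (∀ i, (mu i : ℂ) = - ∑ j, w i j * lam j)

end SimpleGroup

/-! ### Representations -/

/-- A nonzero space `ℂ^d` has no proper nonzero subspace stable under a set of matrices. -/
def IrreducibleUnder {d : ℕ} (S : Set (Mat d)) : Prop :=
  0 < d ∧ ∀ E : Submodule ℂ (Fin d → ℂ),
    (∀ M ∈ S, ∀ v ∈ E, M *ᵥ v ∈ E) → E = ⊥ ∨ E = ⊤

variable {N r : ℕ}

/-- The differential of a representation `G → GL_d(ℂ)`. -/
def differential {G : SimpleGroup N r} {d : ℕ} (φ : G.grp →* GL (Fin d) ℂ) (Y : G.lie) : Mat d :=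
  Matrix.of fun i j => deriv (fun t : ℂ => (φ (G.exp (t • Y)) : Mat d) i j) 0

/-- The irreducible algebraic representation `V_λ` of `G` with highest weight `λ`, on `ℂ^d`,
together with a highest weight vector.  The weight `λ` is given by its values on the simple coroots.
(`G` is contained in `SL_N`, so its regular functions are the polynomials in the matrix entries.) -/
structure HighestWeightRep (G : SimpleGroup N r) (d : ℕ) (lam : Fin r → ℕ) where
  rep : G.grp →* GL (Fin d) ℂ
  algebraic : ∀ i j, ∃ p : MvPolynomial (Fin N × Fin N) ℂ, ∀ g : G.grp,
    (rep g : Mat d) i j = MvPolynomial.eval (fun kl => G.mat g kl.1 kl.2) p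
  irreducible : IrreducibleUnder (Set.range fun g => (rep g : Mat d))
  vec : Fin d → ℂ
  vec_ne_zero : vec ≠ 0
  e_vec : ∀ i, differential rep (G.pin.e i) *ᵥ vec = 0
  h_vec : ∀ i, differential rep (G.pin.h i) *ᵥ vec = (lam i : ℂ) • vec

/-! ### Riemann surfaces with a square root of the canonical bundle -/

/-- `dz_ψ / dz_φ` at `x`, for two local coordinates `z_φ`, `z_ψ` near `x`. -/
def jac {X : Type*} [TopologicalSpace X] (φ ψ : OpenPartialHomeomorph X ℂ) (x : X) : ℂ :=
  deriv (fun z => ψ (φ.symm z)) (φ x)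

/-- `f` is holomorphic in the coordinate `φ` on the part of `U` in the domain of `φ`. -/
def HolOn {X : Type*} [TopologicalSpace X] (φ : OpenPartialHomeomorph X ℂ) (U : Set X)
    (f : X → ℂ) : Prop :=
  DifferentiableOn ℂ (fun z => f (φ.symm z)) (φ.target ∩ φ.symm ⁻¹' U)

/-- A cover of a Riemann surface `X` by holomorphic coordinate charts, with a square root
`K_X^{1/2}` of the canonical bundle given on it by its transition functions: a section is
a family of functions `f a` on the charts with `f a = k a b * f b`, and `(k a b)² = dz_b / dz_a`. -/
structure SpinAtlas (X : Type*) [TopologicalSpace X] [ChartedSpace ℂ X] (J : Type*) where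
  chart : J → OpenPartialHomeomorph X ℂ
  chart_mem : ∀ a, chart a ∈ IsManifold.maximalAtlas 𝓘(ℂ) ω X
  cover : ∀ x, ∃ a, x ∈ (chart a).source
  k : J → J → X → ℂ
  k_hol : ∀ a b, HolOn (chart a) (chart b).source (k a b)
  k_sq : ∀ a b, ∀ x ∈ (chart a).source ∩ (chart b).source,
    k a b x ^ 2 = jac (chart a) (chart b) x
  k_cocycle : ∀ a b c, ∀ x ∈ (chart a).source ∩ (chart b).source ∩ (chart c).source,
    k a b x * k b c x = k a c x

variable {X : Type*} [TopologicalSpace X] [ChartedSpace ℂ X] {J : Type*}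

/-! ### Opers -/

/-- A `G`-oper on `X`, in the component determined by the square root of the canonical bundle.

The holomorphic `B`-bundle is given by transition functions `g a b` (points of an associated bundle
satisfy `y a = g a b • y b`).  The induced bundle for the torus `B / [B, B]` is the one obtained
from `K_X^{1/2}` by the cocharacter `2ρ`, and the local trivializations are chosen compatibly with
this: `g a b` is `2ρ(k a b)` times an element of the unipotent radical.  The connection on the
induced `G`-bundle is `∂ + conn a` in the coordinate of the chart `a`; the oper condition says that
`conn a` lies in the sum of the Borel subalgebra and the root spaces of the negative simple roots,
and that its components in these root spaces vanish nowhere. -/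
structure Oper (G : SimpleGroup N r) (S : SpinAtlas X J) where
  g : J → J → X → G.grp
  g_hol : ∀ a b i j, HolOn (S.chart a) (S.chart b).source (fun x => G.mat (g a b x) i j)
  g_cocycle : ∀ a b c,
    ∀ x ∈ (S.chart a).source ∩ (S.chart b).source ∩ (S.chart c).source,
      g a b x * g b c x = g a c x
  g_borel : ∀ a b, ∀ x ∈ (S.chart a).source ∩ (S.chart b).source,
    ∃ u ∈ G.unipotent, g a b x = G.twoRhoCochar (S.k a b x) * u
  conn : J → ℂ → G.lie
  conn_hol : ∀ a i j,
    DifferentiableOn ℂ (fun z => (conn a z : Mat N) i j) (S.chart a).target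
  conn_gauge : ∀ a b, ∀ x ∈ (S.chart a).source ∩ (S.chart b).source,
    (Matrix.of fun i j => deriv (fun z => G.mat (g a b ((S.chart a).symm z)) i j) (S.chart a x)) =
      jac (S.chart a) (S.chart b) x • (G.mat (g a b x) * (conn b (S.chart b x) : Mat N)) -
        (conn a (S.chart a x) : Mat N) * G.mat (g a b x)
  oper : ∀ a, ∀ z ∈ (S.chart a).target, ∃ c : Fin r → ℂ,
    (∀ i, c i ≠ 0) ∧ conn a z - ∑ i, c i • G.pin.f i ∈ G.borel

namespace Oper

variable {G : SimpleGroup N r} {S : SpinAtlas X J} (χ : Oper G S)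

/-! ### Monodromy -/

/-- `F` is a flat section of the `G`-bundle over the subset `U` of the coordinate domain of the
chart `a`. -/
def IsFlatFrame (a : J) (U : Set ℂ) (F : ℂ → G.grp) : Prop :=
  ∀ z ∈ U, ∀ i j,
    HasDerivAt (fun t => G.mat (F t) i j) (-((χ.conn a z : Mat N) * G.mat (F z)) i j) z

/-- `y` is a parallel section of the `G`-bundle along the path `γ`, where `y t a` is its value at
`γ t` in the trivialization over the chart `a`. -/
def IsParallel {p q : X} (γ : Path p q) (y : unitInterval → J → G.grp) : Prop :=
  (∀ t a b, γ t ∈ (S.chart a).source ∩ (S.chart b).source → y t a = χ.g a b (γ t) * y t b) ∧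
  ∀ t₀, ∃ a, γ t₀ ∈ (S.chart a).source ∧
    ∃ U : Set ℂ, IsOpen U ∧ U ⊆ (S.chart a).target ∧ S.chart a (γ t₀) ∈ U ∧
      ∃ F : ℂ → G.grp, χ.IsFlatFrame a U F ∧
        ∀ᶠ t in nhds t₀, y t a = F (S.chart a (γ t))

/-- The monodromy of the oper along the loop `γ` at `p` is `m`, in the trivialization at `p`
over the chart `a`. -/
def IsMonodromy {p : X} (a : J) (γ : Path p p) (m : G.grp) : Prop :=
  ∃ y, χ.IsParallel γ y ∧ y 0 a = 1 ∧ y 1 a = m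

/-- The oper is real: its monodromy representation `π₁(X, p) → G` is isomorphic to its complex
conjugate. -/
def IsReal (p : X) : Prop :=
  ∃ a, p ∈ (S.chart a).source ∧ ∃ c : G.grp, ∀ (γ : Path p p) (m : G.grp),
    χ.IsMonodromy a γ m →
      (G.mat m).map (starRingEnd ℂ) = G.mat (c * m * c⁻¹)

variable {d d' : ℕ} {lam mu : Fin r → ℕ}

/-- The monodromy representation, based at `p`, of the flat vector bundle associated with the oper
and with the representation `V` is irreducible. -/
def IrreducibleMonodromy (V : HighestWeightRep G d lam) (p : X) : Prop :=
  ∃ a, p ∈ (S.chart a).source ∧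
    IrreducibleUnder {M : Mat d | ∃ (γ : Path p p) (m : G.grp),
      χ.IsMonodromy a γ m ∧ M = (V.rep m : Mat d)}

/-! ### The flat bundle and its canonical section -/

/-- The connection matrix of the flat bundle associated with `V`. -/
def connV (V : HighestWeightRep G d lam) (a : J) (z : ℂ) : Mat d :=
  differential V.rep (χ.conn a z)

/-- The covariant derivative along the coordinate vector field of the chart `a`. It acts on sections
of the bundle associated with `V`, and also on sections of its twist by `K_X^{-⟨λ,ρ⟩}`, trivialized
by the power of `dz`. -/
def nabla (V : HighestWeightRep G d lam) (a : J) (s : ℂ → Fin d → ℂ) : ℂ → Fin d → ℂ :=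
  fun z => deriv s z + χ.connV V a z *ᵥ s z

/-- The canonical section `s_λ` of `K_X^{-⟨λ,ρ⟩} ⊗ V_λ`, in the trivialization over a chart. The
highest weight line is stable under `B`, and `B` acts on it by `λ`, so that it defines a line
subbundle with transition functions `(k a b)^{2⟨λ,ρ⟩}`, which is `K_X^{⟨λ,ρ⟩}`. -/
def canonicalSection (V : HighestWeightRep G d lam) : ℂ → Fin d → ℂ := fun _ => V.vec

end Oper

/-! ### Differential operators -/

/-- `∂/∂z` on smooth functions. -/
def dz (f : ℂ → ℂ) (z : ℂ) : ℂ :=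
  (fderiv ℝ f z 1 - Complex.I * fderiv ℝ f z Complex.I) / 2

/-- `∂/∂z̄` on smooth functions. -/
def dzbar (f : ℂ → ℂ) (z : ℂ) : ℂ :=
  (fderiv ℝ f z 1 + Complex.I * fderiv ℝ f z Complex.I) / 2

/-- A holomorphic differential operator `∑ coeff n ∂ⁿ`, with `n ≤ order`, on an open subset `U`
of a coordinate domain.  The powers of the canonical bundle are trivialized by those of `dz`, so
these are the sections over `U` of the sheaf of differential operators on `K_X^{-⟨λ,ρ⟩}`. -/
structure DiffOp (U : Set ℂ) where
  order : ℕ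
  coeff : ℕ → ℂ → ℂ
  hol : ∀ n, DifferentiableOn ℂ (coeff n) U

/-- The action of a differential operator when `∂` acts by `D`. -/
def DiffOp.act {U : Set ℂ} {E : Type*} [AddCommGroup E] [Module ℂ E] (P : DiffOp U)
    (D : (ℂ → E) → (ℂ → E)) (s : ℂ → E) (z : ℂ) : E :=
  ∑ n ∈ Finset.range (P.order + 1), P.coeff n z • (D^[n] s) z

/-- The action of the complex conjugate operator when `∂̄` acts by `D`. -/
def DiffOp.actConj {U : Set ℂ} (P : DiffOp U)
    (D : (ℂ → ℂ) → (ℂ → ℂ)) (s : ℂ → ℂ) (z : ℂ) : ℂ :=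
  ∑ n ∈ Finset.range (P.order + 1), (starRingEnd ℂ) (P.coeff n z) * (D^[n] s) z

namespace Oper

variable {G : SimpleGroup N r} {S : SpinAtlas X J} (χ : Oper G S)
variable {d d' : ℕ} {lam mu : Fin r → ℕ}

/-- The sections over `U` of the ideal sheaf `I_{λ,χ}`, the left annihilator of the canonical
section, for an open subset `U` of the coordinate domain of the chart `a`. -/
def annIdeal (V : HighestWeightRep G d lam) (a : J) (U : Set ℂ) : Set (DiffOp U) :=
  {P | ∀ z ∈ U, P.act (χ.nabla V a) (canonicalSection V) z = 0}

/-- `Ψ` is annihilated by the ideal sheaf `I_{λ,χ}`. -/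
def AnnihilatedBy (V : HighestWeightRep G d lam) (Ψ : J → ℂ → ℂ) : Prop :=
  ∀ a, ∀ U : Set ℂ, IsOpen U → U ⊆ (S.chart a).target →
    ∀ P ∈ χ.annIdeal V a U, ∀ z ∈ U, P.act dz (Ψ a) z = 0

/-- `Ψ` is annihilated by the complex conjugate of the ideal sheaf `I_{μ,χ}`. -/
def AnnihilatedByConj (W : HighestWeightRep G d mu) (Ψ : J → ℂ → ℂ) : Prop :=
  ∀ a, ∀ U : Set ℂ, IsOpen U → U ⊆ (S.chart a).target →
    ∀ P ∈ χ.annIdeal W a U, ∀ z ∈ U, P.actConj dzbar (Ψ a) z = 0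

/-! ### Flat pairings -/

/-- `h` is a non-degenerate pairing of smooth flat bundles between the bundle of `V` and the complex
conjugate of the bundle of `W`, with values in the trivial flat line bundle; `h a z` is the pairing
of the fibres at the point with coordinate `z` in the chart `a`. -/
structure IsFlatPairing (V : HighestWeightRep G d lam) (W : HighestWeightRep G d' mu)
    (h : J → ℂ → ((Fin d → ℂ) →ₗ[ℂ] (Fin d' → ℂ) →ₗ⋆[ℂ] ℂ)) : Prop where
  smooth : ∀ a v w, ContDiffOn ℝ ∞ (fun z => h a z v w) (S.chart a).target
  compat : ∀ a b, ∀ x ∈ (S.chart a).source ∩ (S.chart b).source, ∀ v w,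
    h a (S.chart a x) ((V.rep (χ.g a b x) : Mat d) *ᵥ v) ((W.rep (χ.g a b x) : Mat d') *ᵥ w) =
      h b (S.chart b x) v w
  flat : ∀ a, ∀ z ∈ (S.chart a).target, ∀ v w,
    dz (fun t => h a t v w) z = h a z (χ.connV V a z *ᵥ v) w
  flat_conj : ∀ a, ∀ z ∈ (S.chart a).target, ∀ v w,
    dzbar (fun t => h a t v w) z = h a z v (χ.connV W a z *ᵥ w)
  nondegenerate : ∀ a, ∀ z ∈ (S.chart a).target, (h a z).Nondegenerate

/-- The section `h(s_λ, conj s_μ)`, for a pairing `h` as above. -/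
def pairedSection (V : HighestWeightRep G d lam) (W : HighestWeightRep G d' mu)
    (h : J → ℂ → ((Fin d → ℂ) →ₗ[ℂ] (Fin d' → ℂ) →ₗ⋆[ℂ] ℂ)) (a : J) (z : ℂ) : ℂ :=
  h a z (canonicalSection V z) (canonicalSection W z)

end Oper

/-- The family of functions `Ψ a` on the charts is a smooth section of `Ω_X^s`, where
`Ω_X = |K_X|²` is the line bundle with transition functions `|dz_b / dz_a|²`. -/
structure IsOmegaSection (S : SpinAtlas X J) (s : ℝ) (Ψ : J → ℂ → ℂ) : Prop where
  smooth : ∀ a, ContDiffOn ℝ ∞ (Ψ a) (S.chart a).target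
  compat : ∀ a b, ∀ x ∈ (S.chart a).source ∩ (S.chart b).source,
    Ψ a (S.chart a x) =
      (((‖jac (S.chart a) (S.chart b) x‖ ^ 2) ^ s : ℝ) : ℂ) * Ψ b (S.chart b x)

end RealOper

end

noncomputable section

namespace RealOper

open Filter Topology

/-! ### Entrywise derivatives of matrix-valued functions -/

/-- The matrix-valued function `M` of a complex variable has entrywise derivative `M'` at `z`. -/
def HasMatDerivAt {m n : ℕ} (M : ℂ → Matrix (Fin m) (Fin n) ℂ) (M' : Matrix (Fin m) (Fin n) ℂ)
    (z : ℂ) : Prop :=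
  ∀ i j, HasDerivAt (fun t => M t i j) (M' i j) z

namespace HasMatDerivAt

variable {l m n : ℕ} {z : ℂ}

theorem const (C : Matrix (Fin m) (Fin n) ℂ) : HasMatDerivAt (fun _ => C) 0 z :=
  fun _ _ => hasDerivAt_const _ _

theorem mul {M : ℂ → Matrix (Fin l) (Fin m) ℂ} {M' : Matrix (Fin l) (Fin m) ℂ}
    {K : ℂ → Matrix (Fin m) (Fin n) ℂ} {K' : Matrix (Fin m) (Fin n) ℂ}
    (hM : HasMatDerivAt M M' z) (hK : HasMatDerivAt K K' z) :
    HasMatDerivAt (fun t => M t * K t) (M' * K z + M z * K') z := by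
  intro i j
  simp only [Matrix.mul_apply, Matrix.add_apply, ← Finset.sum_add_distrib]
  exact HasDerivAt.fun_sum fun k _ => (hM i k).mul (hK k j)

theorem mulVec {M : ℂ → Matrix (Fin m) (Fin n) ℂ} {M' : Matrix (Fin m) (Fin n) ℂ}
    {u : ℂ → Fin n → ℂ} {u' : Fin n → ℂ} (hM : HasMatDerivAt M M' z) (hu : HasDerivAt u u' z) :
    HasDerivAt (fun t => M t *ᵥ u t) (M' *ᵥ u z + M z *ᵥ u') z := by
  rw [hasDerivAt_pi] at hu ⊢
  intro i
  simp only [Matrix.mulVec, dotProduct, Pi.add_apply, ← Finset.sum_add_distrib]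
  exact HasDerivAt.fun_sum fun k _ => (hM i k).mul (hu k)

theorem congr_of_eventuallyEq {M K : ℂ → Matrix (Fin m) (Fin n) ℂ} {M' : Matrix (Fin m) (Fin n) ℂ}
    (hM : HasMatDerivAt M M' z) (h : K =ᶠ[𝓝 z] M) : HasMatDerivAt K M' z :=
  fun i j => (hM i j).congr_of_eventuallyEq (h.mono fun t ht => by simp [ht])

theorem unique {M : ℂ → Matrix (Fin m) (Fin n) ℂ} {M' M'' : Matrix (Fin m) (Fin n) ℂ}
    (h : HasMatDerivAt M M' z) (h' : HasMatDerivAt M M'' z) : M' = M'' :=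
  Matrix.ext fun i j => (h i j).unique (h' i j)

theorem comp {M : ℂ → Matrix (Fin m) (Fin n) ℂ} {M' : Matrix (Fin m) (Fin n) ℂ} {τ : ℂ → ℂ}
    {τ' : ℂ} (hM : HasMatDerivAt M M' (τ z)) (hτ : HasDerivAt τ τ' z) :
    HasMatDerivAt (fun t => M (τ t)) (τ' • M') z := by
  intro i j
  have := HasDerivAt.comp z (hM i j) hτ
  simpa [Function.comp_def, mul_comm] using this

theorem differentiableAt_det {M : ℂ → Mat n} (hM : ∀ i j, DifferentiableAt ℂ (fun t => M t i j) z) :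
    DifferentiableAt ℂ (fun t => (M t).det) z := by
  simp only [Matrix.det_apply]
  refine DifferentiableAt.fun_sum fun σ _ => ?_
  refine DifferentiableAt.const_smul ?_ _
  exact DifferentiableAt.fun_finsetProd fun i _ => hM _ _

theorem differentiableAt_inv {M : ℂ → Mat n} (hM : ∀ i j, DifferentiableAt ℂ (fun t => M t i j) z)
    (hdet : (M z).det ≠ 0) (i j : Fin n) : DifferentiableAt ℂ (fun t => (M t)⁻¹ i j) z := by
  have hadj : DifferentiableAt ℂ (fun t => (M t).adjugate i j) z := by
    simp only [Matrix.adjugate_apply]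
    refine differentiableAt_det fun k l => ?_
    by_cases h : k = j
    · subst h; simp
    · simpa [Matrix.updateRow_ne h] using hM k l
  have : (fun t => (M t)⁻¹ i j) = fun t => ((M t).det)⁻¹ * (M t).adjugate i j := by
    funext t
    simp [Matrix.inv_def, Ring.inverse_eq_inv']
  rw [this]
  exact ((differentiableAt_det hM).inv hdet).mul hadj

theorem inv {M : ℂ → Mat n} {M' : Mat n} (hM : HasMatDerivAt M M' z)
    (hdet : ∀ᶠ t in 𝓝 z, (M t).det ≠ 0) :
    HasMatDerivAt (fun t => (M t)⁻¹) (-((M z)⁻¹ * M' * (M z)⁻¹)) z := by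
  have hz : IsUnit (M z).det := isUnit_iff_ne_zero.2 hdet.self_of_nhds
  have hd : HasMatDerivAt (fun t => (M t)⁻¹)
      (Matrix.of fun i j => deriv (fun t => (M t)⁻¹ i j) z) z := fun i j =>
    (differentiableAt_inv (fun i j => (hM i j).differentiableAt) hdet.self_of_nhds i j).hasDerivAt
  have h1 := hM.mul hd
  have h2 : HasMatDerivAt (fun t => M t * (M t)⁻¹) 0 z := by
    refine (const (1 : Mat n)).congr_of_eventuallyEq ?_
    filter_upwards [hdet] with t ht
    exact Matrix.mul_nonsing_inv _ (isUnit_iff_ne_zero.2 ht)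
  have h3 := h1.unique h2
  have h4 : (Matrix.of fun i j => deriv (fun t => (M t)⁻¹ i j) z) = -((M z)⁻¹ * M' * (M z)⁻¹) := by
    have := congrArg ((M z)⁻¹ * ·) h3
    simp only [mul_add, mul_zero, ← mul_assoc, Matrix.nonsing_inv_mul _ hz, one_mul] at this
    exact eq_neg_of_add_eq_zero_right this
  rwa [h4] at hd

end HasMatDerivAt

section

open scoped Matrix.Norms.Operator

theorem hasMatDerivAt_exp {n : ℕ} (Y : Mat n) (z : ℂ) :
    HasMatDerivAt (fun t : ℂ => NormedSpace.exp (t • Y)) (Y * NormedSpace.exp (z • Y)) z := by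
  have h := hasDerivAt_exp_smul_const' Y z
  intro i j
  exact hasDerivAt_pi.1 (hasDerivAt_pi.1 h i) j

end

/-- The derivative of the value of a polynomial at a point which moves with the parameter. -/
theorem hasDerivAt_eval {σ : Type*} [Fintype σ] (p : MvPolynomial σ ℂ) {x : ℂ → σ → ℂ}
    {x' : σ → ℂ} {z : ℂ} (hx : ∀ i, HasDerivAt (fun t => x t i) (x' i) z) :
    HasDerivAt (fun t => MvPolynomial.eval (x t) p)
      (∑ i, x' i * MvPolynomial.eval (x z) (MvPolynomial.pderiv i p)) z := by
  classical
  induction p using MvPolynomial.induction_on with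
  | C a => simpa using hasDerivAt_const z a
  | add p q hp hq =>
    simp only [map_add, mul_add, Finset.sum_add_distrib]
    exact hp.add hq
  | mul_X p k hp =>
    simp only [map_mul, MvPolynomial.eval_X, MvPolynomial.pderiv_mul, map_add,
      MvPolynomial.pderiv_X]
    convert! hp.mul (hx k) using 1
    simp only [mul_add, Finset.sum_add_distrib, Finset.sum_mul]
    congr 1
    · exact Finset.sum_congr rfl fun i _ => by ring
    · rw [Finset.sum_eq_single k]
      · simp; ring
      · intro b _ hb; simp [hb.symm]
      · simp

/-! ### Linear differential equations in a complex variable -/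

/-- A holomorphic linear differential equation has a solution near each point. -/
theorem exists_linear_ode_solution {E : Type*} [NormedAddCommGroup E] [NormedSpace ℂ E]
    [CompleteSpace E] {L : ℂ → E →L[ℂ] E} {U : Set ℂ} (hU : IsOpen U)
    (hL : DifferentiableOn ℂ L U) {z₀ : ℂ} (hz₀ : z₀ ∈ U) :
    ∃ ε > 0, Metric.ball z₀ ε ⊆ U ∧ ∀ u₀ : E, ∃ u : ℂ → E, u z₀ = u₀ ∧
      ∀ z ∈ Metric.ball z₀ ε, HasDerivAt u (L z (u z)) z := by
  have hcont : ContinuousAt L z₀ := (hL.differentiableAt (hU.mem_nhds hz₀)).continuousAt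
  set C : ℝ := ‖L z₀‖ + 1 with hC
  have hCpos : 0 < C := by positivity
  have hb : ∀ᶠ z in 𝓝 z₀, ‖L z‖ < C := hcont.norm.eventually_lt_const (by simp [hC])
  obtain ⟨δ, hδ, hball⟩ := Metric.eventually_nhds_iff_ball.1 (hb.and (hU.mem_nhds hz₀))
  set ε : ℝ := min δ (1 / (2 * C)) with hε
  have hεpos : 0 < ε := by positivity
  have hsub : Metric.ball z₀ ε ⊆ Metric.ball z₀ δ := Metric.ball_subset_ball (min_le_left _ _)
  have hLb : ∀ z ∈ Metric.ball z₀ ε, ‖L z‖ ≤ C := fun z hz => (hball z (hsub hz)).1.le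
  have hεU : Metric.ball z₀ ε ⊆ U := fun z hz => (hball z (hsub hz)).2
  have hCε : C * ε ≤ 1 / 2 := by
    calc C * ε ≤ C * (1 / (2 * C)) := by gcongr; exact min_le_right _ _
      _ = 1 / 2 := by field_simp
  refine ⟨ε, hεpos, hεU, fun u₀ => ?_⟩
  have hz₀ε : z₀ ∈ Metric.ball z₀ ε := Metric.mem_ball_self hεpos
  have step : ∀ f : ℂ → E, DifferentiableOn ℂ f (Metric.ball z₀ ε) →
      ∃ g : ℂ → E, g z₀ = 0 ∧ ∀ z ∈ Metric.ball z₀ ε, HasDerivAt g (L z (f z)) z := by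
    intro f hf
    exact (((hL.mono hεU).clm_apply hf).isExactOn_ball).with_val_at z₀ 0
  choose! P hP0 hP using step
  let f : ℕ → ℂ → E := fun n => Nat.rec (fun _ => u₀) (fun _ g => P g) n
  have hf0 : f 0 = fun _ => u₀ := rfl
  have hfs : ∀ n, f (n + 1) = P (f n) := fun n => rfl
  have hfd : ∀ n, DifferentiableOn ℂ (f n) (Metric.ball z₀ ε) := by
    intro n
    induction n with
    | zero => rw [hf0]; exact differentiableOn_const _
    | succ n ih =>
      intro z hz
      exact (hP (f n) ih z hz).differentiableAt.differentiableWithinAt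
  have hfderiv : ∀ n, ∀ z ∈ Metric.ball z₀ ε, HasDerivAt (f (n + 1)) (L z (f n z)) z :=
    fun n z hz => hP (f n) (hfd n) z hz
  have hfz : ∀ n, f (n + 1) z₀ = 0 := fun n => hP0 (f n) (hfd n)
  have hbound : ∀ n, ∀ z ∈ Metric.ball z₀ ε, ‖f n z‖ ≤ (1 / 2) ^ n * ‖u₀‖ := by
    intro n
    induction n with
    | zero => intro z _; simp [hf0]
    | succ n ih =>
      intro z hz
      have hder : ∀ w ∈ Metric.ball z₀ ε, ‖L w (f n w)‖ ≤ C * ((1 / 2) ^ n * ‖u₀‖) := fun w hw =>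
        ((L w).le_opNorm _).trans (mul_le_mul (hLb w hw) (ih w hw) (norm_nonneg _) hCpos.le)
      have := (convex_ball z₀ ε).norm_image_sub_le_of_norm_hasDerivWithin_le
        (fun w hw => (hfderiv n w hw).hasDerivWithinAt) hder hz₀ε hz
      rw [hfz, sub_zero] at this
      refine this.trans ?_
      have hzε : ‖z - z₀‖ ≤ ε := by
        have := Metric.mem_ball.1 hz
        rw [dist_eq_norm] at this; exact this.le
      calc C * ((1 / 2) ^ n * ‖u₀‖) * ‖z - z₀‖ ≤ C * ((1 / 2) ^ n * ‖u₀‖) * ε := by gcongr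
        _ = (C * ε) * ((1 / 2) ^ n * ‖u₀‖) := by ring
        _ ≤ (1 / 2) * ((1 / 2) ^ n * ‖u₀‖) := by gcongr
        _ = (1 / 2) ^ (n + 1) * ‖u₀‖ := by ring
  have hsum : Summable fun n : ℕ => (1 / 2 : ℝ) ^ n * ‖u₀‖ :=
    (summable_geometric_of_lt_one (by norm_num) (by norm_num)).mul_right _
  have hsumf : ∀ z ∈ Metric.ball z₀ ε, Summable fun n => f n z := fun z hz =>
    Summable.of_norm_bounded hsum fun n => hbound n z hz
  refine ⟨fun z => ∑' n, f n z, ?_, fun z hz => ?_⟩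
  · refine tsum_eq_single 0 fun n hn => ?_
    obtain ⟨m, rfl⟩ := Nat.exists_eq_succ_of_ne_zero hn
    exact hfz m
  · have hder : HasDerivAt (fun w => ∑' n, f (n + 1) w) (∑' n, L z (f n z)) z := by
      refine hasDerivAt_tsum_of_isPreconnected (u := fun n => C * ((1 / 2 : ℝ) ^ n * ‖u₀‖))
        (hsum.mul_left C) Metric.isOpen_ball (convex_ball z₀ ε).isPreconnected
        (fun n w hw => hfderiv n w hw) (fun n w hw => ?_) hz₀ε ?_ hz
      · exact ((L w).le_opNorm _).trans
          (mul_le_mul (hLb w hw) (hbound n w hw) (norm_nonneg _) hCpos.le)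
      · simp only [hfz]; exact summable_zero
    rw [← (L z).map_tsum (hsumf z hz)] at hder
    refine (hder.const_add u₀).congr_of_eventuallyEq ?_
    filter_upwards [Metric.isOpen_ball.mem_nhds hz] with w hw
    rw [(hsumf w hw).tsum_eq_zero_add, hf0]

/-! ### The operators `∂/∂z` and `∂/∂z̄` -/

section Wirtinger

variable {f g : ℂ → ℂ} {z : ℂ}

theorem dz_congr (h : f =ᶠ[𝓝 z] g) : dz f z = dz g z := by
  simp only [dz, h.fderiv_eq]

theorem dzbar_congr (h : f =ᶠ[𝓝 z] g) : dzbar f z = dzbar g z := by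
  simp only [dzbar, h.fderiv_eq]

theorem dz_add (hf : DifferentiableAt ℝ f z) (hg : DifferentiableAt ℝ g z) :
    dz (fun t => f t + g t) z = dz f z + dz g z := by
  simp only [dz, fderiv_fun_add hf hg, add_apply]; ring

theorem dz_mul (hf : DifferentiableAt ℝ f z) (hg : DifferentiableAt ℝ g z) :
    dz (fun t => f t * g t) z = dz f z * g z + f z * dz g z := by
  simp only [dz, fderiv_fun_mul hf hg, add_apply, smul_apply,
    smul_eq_mul]; ring

theorem dz_const (c : ℂ) : dz (fun _ => c) z = 0 := by
  simp [dz]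

theorem dz_sum {ι : Type*} (s : Finset ι) {F : ι → ℂ → ℂ}
    (hF : ∀ i ∈ s, DifferentiableAt ℝ (F i) z) :
    dz (fun t => ∑ i ∈ s, F i t) z = ∑ i ∈ s, dz (F i) z := by
  classical
  induction s using Finset.induction_on with
  | empty => simp [dz_const]
  | insert a s ha ih =>
    simp only [Finset.sum_insert ha]
    rw [dz_add (hF a (by simp)) (DifferentiableAt.fun_sum fun i hi => hF i (by simp [hi])),
      ih fun i hi => hF i (by simp [hi])]

theorem conj_dz_conj (f : ℂ → ℂ) (z : ℂ) :
    dzbar f z = (starRingEnd ℂ) (dz (fun t => (starRingEnd ℂ) (f t)) z) := by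
  have h : fderiv ℝ (fun t => (starRingEnd ℂ) (f t)) z =
      (Complex.conjCLE : ℂ →L[ℝ] ℂ).comp (fderiv ℝ f z) := by
    have := Complex.conjCLE.comp_fderiv (f := f) (x := z)
    simpa [Function.comp_def] using this
  have h2 : (starRingEnd ℂ) 2 = 2 := map_ofNat _ 2
  simp [dz, dzbar, h, h2]

theorem differentiableAt_conj (hf : DifferentiableAt ℝ f z) :
    DifferentiableAt ℝ (fun t => (starRingEnd ℂ) (f t)) z :=
  (Complex.conjCLE.differentiableAt (x := f z)).comp z hf

theorem dzbar_mul (hf : DifferentiableAt ℝ f z) (hg : DifferentiableAt ℝ g z) :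
    dzbar (fun t => f t * g t) z = dzbar f z * g z + f z * dzbar g z := by
  simp only [dzbar, fderiv_fun_mul hf hg, add_apply,
    smul_apply, smul_eq_mul]; ring

theorem dzbar_sum {ι : Type*} (s : Finset ι) {F : ι → ℂ → ℂ}
    (hF : ∀ i ∈ s, DifferentiableAt ℝ (F i) z) :
    dzbar (fun t => ∑ i ∈ s, F i t) z = ∑ i ∈ s, dzbar (F i) z := by
  simp only [conj_dz_conj, map_sum]
  rw [dz_sum s fun i hi => differentiableAt_conj (hF i hi), map_sum]

theorem dz_of_hasDerivAt {f' : ℂ} (h : HasDerivAt f f' z) : dz f z = f' := by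
  have : fderiv ℝ f z = (ContinuousLinearMap.toSpanSingleton ℂ f').restrictScalars ℝ :=
    (h.hasFDerivAt.restrictScalars ℝ).fderiv
  simp only [dz, this]
  simp
  linear_combination (-f' / 2) * Complex.I_sq

theorem dzbar_of_hasDerivAt {f' : ℂ} (h : HasDerivAt f f' z) : dzbar f z = 0 := by
  have : fderiv ℝ f z = (ContinuousLinearMap.toSpanSingleton ℂ f').restrictScalars ℝ :=
    (h.hasFDerivAt.restrictScalars ℝ).fderiv
  simp only [dzbar, this]
  simp
  linear_combination f' * Complex.I_sq

theorem dzbar_conj_of_hasDerivAt {f' : ℂ} (h : HasDerivAt f f' z) :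
    dzbar (fun t => (starRingEnd ℂ) (f t)) z = (starRingEnd ℂ) f' := by
  simp [conj_dz_conj, dz_of_hasDerivAt h]

theorem dz_conj_of_hasDerivAt {f' : ℂ} (h : HasDerivAt f f' z) :
    dz (fun t => (starRingEnd ℂ) (f t)) z = 0 := by
  have := dzbar_of_hasDerivAt h
  rw [conj_dz_conj] at this
  simpa using this

theorem fderiv_eq_zero_of_dz_of_dzbar (h : dz f z = 0) (h' : dzbar f z = 0) :
    fderiv ℝ f z = 0 := by
  simp only [dz, dzbar] at h h'
  have h1 : fderiv ℝ f z 1 = 0 := by linear_combination h + h'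
  have h2 : fderiv ℝ f z Complex.I = 0 := by
    linear_combination Complex.I * (h - h') + fderiv ℝ f z Complex.I * Complex.I_sq
  ext w
  have hw : w = w.re • (1 : ℂ) + w.im • Complex.I := by simp
  rw [hw, map_add, map_smul, map_smul, h1, h2]
  simp

theorem contDiffOn_dz {U : Set ℂ} (hU : IsOpen U) (hf : ContDiffOn ℝ ∞ f U) :
    ContDiffOn ℝ ∞ (dz f) U := by
  have h := hf.fderiv_of_isOpen hU (m := ∞) (by simp)
  have h1 : ContDiffOn ℝ ∞ (fun t => fderiv ℝ f t 1) U := h.clm_apply contDiffOn_const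
  have h2 : ContDiffOn ℝ ∞ (fun t => fderiv ℝ f t Complex.I) U := h.clm_apply contDiffOn_const
  exact (h1.sub (contDiffOn_const.mul h2)).div_const 2

theorem contDiffOn_dzbar {U : Set ℂ} (hU : IsOpen U) (hf : ContDiffOn ℝ ∞ f U) :
    ContDiffOn ℝ ∞ (dzbar f) U := by
  have h := hf.fderiv_of_isOpen hU (m := ∞) (by simp)
  have h1 : ContDiffOn ℝ ∞ (fun t => fderiv ℝ f t 1) U := h.clm_apply contDiffOn_const
  have h2 : ContDiffOn ℝ ∞ (fun t => fderiv ℝ f t Complex.I) U := h.clm_apply contDiffOn_const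
  exact (h1.add (contDiffOn_const.mul h2)).div_const 2

theorem dz_dzbar_comm {U : Set ℂ} (hU : IsOpen U) (hf : ContDiffOn ℝ ∞ f U) (hz : z ∈ U) :
    dz (dzbar f) z = dzbar (dz f) z := by
  have hfz : ContDiffAt ℝ ∞ f z := hf.contDiffAt (hU.mem_nhds hz)
  have hd : DifferentiableAt ℝ (fderiv ℝ f) z :=
    ((hf.fderiv_of_isOpen hU (m := ∞) (by simp)).contDiffAt (hU.mem_nhds hz)).differentiableAt
      (by simp)
  have hap : ∀ w v : ℂ, fderiv ℝ (fun t => fderiv ℝ f t v) z w = fderiv ℝ (fderiv ℝ f) z w v := by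
    intro w v
    rw [fderiv_clm_apply hd (differentiableAt_const v)]
    simp
  have hdv : ∀ v : ℂ, DifferentiableAt ℝ (fun t => fderiv ℝ f t v) z := fun v =>
    hd.clm_apply (differentiableAt_const v)
  have hsymm : fderiv ℝ (fderiv ℝ f) z 1 Complex.I = fderiv ℝ (fderiv ℝ f) z Complex.I 1 :=
    (hfz.isSymmSndFDerivAt (by simpa using WithTop.coe_le_coe.2 (le_top (a := (2 : ℕ∞))))).eq _ _
  have e1 : ∀ w, fderiv ℝ (dzbar f) z w =
      (fderiv ℝ (fderiv ℝ f) z w 1 + Complex.I * fderiv ℝ (fderiv ℝ f) z w Complex.I) / 2 := by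
    intro w
    have := ((hdv 1).hasFDerivAt.add ((hdv Complex.I).hasFDerivAt.const_mul Complex.I)).mul_const
      (2⁻¹ : ℂ)
    have e : fderiv ℝ (dzbar f) z = _ := HasFDerivAt.fderiv (f := dzbar f) (by
      convert! this using 1)
    rw [e]
    simp [hap]; ring
  have e2 : ∀ w, fderiv ℝ (dz f) z w =
      (fderiv ℝ (fderiv ℝ f) z w 1 - Complex.I * fderiv ℝ (fderiv ℝ f) z w Complex.I) / 2 := by
    intro w
    have := ((hdv 1).hasFDerivAt.sub ((hdv Complex.I).hasFDerivAt.const_mul Complex.I)).mul_const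
      (2⁻¹ : ℂ)
    have e : fderiv ℝ (dz f) z = _ := HasFDerivAt.fderiv (f := dz f) (by
      convert! this using 1)
    rw [e]
    simp [hap]; ring
  rw [dz, dzbar, e1, e1, e2, e2, hsymm]
  ring

end Wirtinger

end RealOper

end

noncomputable section

namespace RealOper

open Filter Topology

/-! ### Algebraic representations and their differentials -/

theorem exp_mulVec_of_mulVec_eq_smul {d : ℕ} {D : Mat d} {v : Fin d → ℂ} {c : ℂ}
    (h : D *ᵥ v = c • v) : NormedSpace.exp D *ᵥ v = Complex.exp c • v := by
  have hder : ∀ t : ℂ, HasDerivAt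
      (fun t : ℂ => NormedSpace.exp (t • D) *ᵥ (Complex.exp (-(t * c)) • v)) 0 t := by
    intro t
    have he : HasDerivAt (fun t : ℂ => Complex.exp (-(t * c)) • v)
        ((Complex.exp (-(t * c)) * (-c)) • v) t := by
      have := (((hasDerivAt_id t).mul_const c).neg).cexp
      simp only [id, one_mul] at this
      exact this.smul_const v
    have hc : Commute D (NormedSpace.exp (t • D)) := ((Commute.refl D).smul_right t).exp_right
    convert! (hasMatDerivAt_exp D t).mulVec he using 1
    rw [hc.eq, ← Matrix.mulVec_mulVec, Matrix.mulVec_smul, h]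
    simp [Matrix.mulVec_smul, Matrix.mulVec_neg, smul_smul]
  have := is_const_of_deriv_eq_zero (fun t => (hder t).differentiableAt)
    (fun t => (hder t).deriv) 1 0
  simp only [one_smul, one_mul, zero_smul, NormedSpace.exp_zero, zero_mul,
    neg_zero, Complex.exp_zero, Matrix.one_mulVec, Matrix.mulVec_smul] at this
  have h2 := congrArg (Complex.exp c • ·) this
  simpa [smul_smul, ← Complex.exp_add] using h2

/-- The matrices which map a given subspace to itself. -/
def stabilizerAlgebra {d : ℕ} (E : Submodule ℂ (Fin d → ℂ)) : Subalgebra ℂ (Mat d) where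
  carrier := {M | ∀ v ∈ E, M *ᵥ v ∈ E}
  mul_mem' {A B} hA hB v hv := by rw [← Matrix.mulVec_mulVec]; exact hA _ (hB v hv)
  add_mem' {A B} hA hB v hv := by rw [Matrix.add_mulVec]; exact E.add_mem (hA v hv) (hB v hv)
  algebraMap_mem' c v hv := by
    rw [Algebra.algebraMap_eq_smul_one, Matrix.smul_mulVec, Matrix.one_mulVec]
    exact E.smul_mem c hv

theorem exp_mulVec_mem {d : ℕ} {D : Mat d} {E : Submodule ℂ (Fin d → ℂ)}
    (h : ∀ v ∈ E, D *ᵥ v ∈ E) : ∀ v ∈ E, NormedSpace.exp D *ᵥ v ∈ E := by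
  have hcl : IsClosed (stabilizerAlgebra E : Set (Mat d)) := by
    have : (stabilizerAlgebra E : Set (Mat d)) = ⋂ v ∈ E, {M | M *ᵥ v ∈ E} := by
      ext M; simp [stabilizerAlgebra]
    rw [this]
    refine isClosed_biInter fun v _ => ?_
    exact (Submodule.closed_of_finiteDimensional E).preimage
      (Continuous.matrix_mulVec continuous_id continuous_const)
  exact NormedSpace.exp_mem (s := stabilizerAlgebra E) hcl h

theorem map_conj_exp {d : ℕ} (D : Mat d) :
    (NormedSpace.exp D).map (starRingEnd ℂ) = NormedSpace.exp (D.map (starRingEnd ℂ)) := by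
  have : ∀ M : Mat d, M.map (starRingEnd ℂ) = Mᴴᵀ := fun M => rfl
  rw [this, this, ← Matrix.exp_conjTranspose, ← Matrix.exp_transpose]

namespace SimpleGroup

variable {N r : ℕ} (G : SimpleGroup N r)

@[simp] theorem mat_mul (g g' : G.grp) : G.mat (g * g') = G.mat g * G.mat g' := rfl

@[simp] theorem mat_one : G.mat 1 = 1 := rfl

theorem mat_exp (Y : G.lie) : G.mat (G.exp Y) = NormedSpace.exp (Y : Mat N) := rfl

theorem mat_injective : Function.Injective G.mat := fun _ _ h => Subtype.ext (Units.ext h)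

theorem mat_inv (g : G.grp) : G.mat g⁻¹ = (G.mat g)⁻¹ :=
  Matrix.coe_units_inv _

theorem mat_inv_mul (g : G.grp) : G.mat g⁻¹ * G.mat g = 1 := by rw [← mat_mul]; simp

theorem mat_mul_inv (g : G.grp) : G.mat g * G.mat g⁻¹ = 1 := by rw [← mat_mul]; simp

theorem det_mat_ne_zero (g : G.grp) : (G.mat g).det ≠ 0 :=
  ((Matrix.isUnit_iff_isUnit_det _).1 (Units.isUnit (g : GL (Fin N) ℂ))).ne_zero

theorem hasMatDerivAt_mat_exp (Y : G.lie) (z : ℂ) :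
    HasMatDerivAt (fun t : ℂ => G.mat (G.exp (t • Y))) ((Y : Mat N) * G.mat (G.exp (z • Y))) z := by
  simpa [mat_exp] using hasMatDerivAt_exp (Y : Mat N) z

@[simp] theorem exp_zero : G.exp 0 = 1 := by
  apply G.mat_injective
  simp [mat_exp, NormedSpace.exp_zero]

theorem exp_neg (Y : G.lie) : G.exp (-Y) = (G.exp Y)⁻¹ := by
  apply G.mat_injective
  rw [G.mat_inv, G.mat_exp, G.mat_exp, ← Matrix.exp_neg]
  simp

/-- The group is generated by the exponentials of its Lie algebra. -/
theorem grp_induction {p : G.grp → Prop} (hexp : ∀ Y, p (G.exp Y)) (hone : p 1)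
    (hmul : ∀ g g', p g → p g' → p (g * g')) (hinv : ∀ g, p g → p g⁻¹) (g : G.grp) : p g := by
  obtain ⟨g, hg⟩ := g
  have hg' : g ∈ Subgroup.closure (expGL '' (G.lie : Set (Mat N))) := hg
  induction hg' using Subgroup.closure_induction with
  | mem x hx =>
    obtain ⟨Y, hY, rfl⟩ := hx
    exact hexp ⟨Y, hY⟩
  | one => exact hone
  | mul x y hx hy h1 h2 => exact hmul ⟨x, hx⟩ ⟨y, hy⟩ (h1 hx) (h2 hy)
  | inv x hx h => exact hinv ⟨x, hx⟩ (h hx)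

/-- The Lie algebra is generated by the simple root vectors and their opposites. -/
theorem lie_induction {p : G.lie → Prop} (he : ∀ i, p (G.pin.e i)) (hf : ∀ i, p (G.pin.f i))
    (hzero : p 0) (hadd : ∀ Y Z, p Y → p Z → p (Y + Z)) (hsmul : ∀ (c : ℂ) Y, p Y → p (c • Y))
    (hlie : ∀ Y Z, p Y → p Z → p ⁅Y, Z⁆) (Y : G.lie) : p Y := by
  have hY : Y ∈ LieSubalgebra.lieSpan ℂ G.lie (Set.range G.pin.e ∪ Set.range G.pin.f) := by
    rw [G.pin.span_ef]; trivial
  induction hY using LieSubalgebra.lieSpan_induction with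
  | mem x hx =>
    rcases hx with ⟨i, rfl⟩ | ⟨i, rfl⟩
    exacts [he i, hf i]
  | zero => exact hzero
  | add u v _ _ hu hv => exact hadd u v hu hv
  | smul t u _ hu => exact hsmul t u hu
  | lie u v _ _ hu hv => exact hlie u v hu hv

end SimpleGroup

variable {N r : ℕ} {G : SimpleGroup N r} {d : ℕ}

/-- The matrix coefficients of the representation are polynomials in the matrix entries. -/
def IsAlgebraicRep (φ : G.grp →* GL (Fin d) ℂ) : Prop :=
  ∀ i j, ∃ p : MvPolynomial (Fin N × Fin N) ℂ, ∀ g : G.grp,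
    (φ g : Mat d) i j = MvPolynomial.eval (fun kl => G.mat g kl.1 kl.2) p

theorem rep_mul (φ : G.grp →* GL (Fin d) ℂ) (g g' : G.grp) :
    (φ (g * g') : Mat d) = (φ g : Mat d) * (φ g' : Mat d) := by simp

theorem rep_inv_mul (φ : G.grp →* GL (Fin d) ℂ) (g : G.grp) :
    (φ g⁻¹ : Mat d) * (φ g : Mat d) = 1 := by rw [← rep_mul]; simp

theorem rep_mul_inv (φ : G.grp →* GL (Fin d) ℂ) (g : G.grp) :
    (φ g : Mat d) * (φ g⁻¹ : Mat d) = 1 := by rw [← rep_mul]; simp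

theorem rep_inv (φ : G.grp →* GL (Fin d) ℂ) (g : G.grp) :
    (φ g⁻¹ : Mat d) = (φ g : Mat d)⁻¹ := by
  rw [map_inv]; exact Matrix.coe_units_inv _

theorem det_rep_ne_zero (φ : G.grp →* GL (Fin d) ℂ) (g : G.grp) : (φ g : Mat d).det ≠ 0 :=
  ((Matrix.isUnit_iff_isUnit_det _).1 (Units.isUnit (φ g))).ne_zero

namespace IsAlgebraicRep

variable {φ : G.grp →* GL (Fin d) ℂ}

/-- The derivative at `g` of an algebraic representation, extended to all matrices by means of the
polynomials which give the matrix coefficients. -/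
def diffAt (hφ : IsAlgebraicRep φ) (g : G.grp) : Mat N →ₗ[ℂ] Mat d where
  toFun Y := Matrix.of fun i j => ∑ kl : Fin N × Fin N,
    Y kl.1 kl.2 * MvPolynomial.eval (fun kl => G.mat g kl.1 kl.2)
      (MvPolynomial.pderiv kl (hφ i j).choose)
  map_add' Y Z := by
    ext i j; simp [add_mul, Finset.sum_add_distrib]
  map_smul' c Y := by
    ext i j; simp [Finset.mul_sum, mul_assoc]

theorem hasMatDerivAt_diffAt (hφ : IsAlgebraicRep φ) {F : ℂ → G.grp} {M' : Mat N} {z : ℂ}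
    (hF : HasMatDerivAt (fun t => G.mat (F t)) M' z) :
    HasMatDerivAt (fun t => (φ (F t) : Mat d)) (hφ.diffAt (F z) M') z := by
  intro i j
  have := hasDerivAt_eval (hφ i j).choose (x := fun t kl => G.mat (F t) kl.1 kl.2)
    (x' := fun kl => M' kl.1 kl.2) (z := z) (fun kl => hF kl.1 kl.2)
  exact this.congr_of_eventuallyEq (Eventually.of_forall fun t => (hφ i j).choose_spec (F t))

theorem differential_eq (hφ : IsAlgebraicRep φ) (Y : G.lie) :
    differential φ Y = hφ.diffAt 1 (Y : Mat N) := by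
  have h := hφ.hasMatDerivAt_diffAt (G.hasMatDerivAt_mat_exp Y 0)
  ext i j
  simpa [differential] using (h i j).deriv

theorem diffAt_mul (hφ : IsAlgebraicRep φ) (Y : G.lie) (g : G.grp) :
    hφ.diffAt g ((Y : Mat N) * G.mat g) = differential φ Y * (φ g : Mat d) := by
  have h0 := G.hasMatDerivAt_mat_exp Y 0
  have h1 := h0.mul (HasMatDerivAt.const (z := 0) (G.mat g))
  have h2 := hφ.hasMatDerivAt_diffAt (F := fun t => G.exp (t • Y) * g) (M' := (Y : Mat N) * G.mat g)
    (z := 0) (by simpa using h1)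
  have h3 := (hφ.hasMatDerivAt_diffAt h0).mul (HasMatDerivAt.const (z := 0) (φ g : Mat d))
  simp only [← rep_mul] at h3
  have := h2.unique h3
  simpa [differential_eq hφ] using this

/-- The image in a representation of a solution of `F' = Y F`. -/
theorem hasMatDerivAt (hφ : IsAlgebraicRep φ) {F : ℂ → G.grp} {z : ℂ} {Y : G.lie}
    (hF : HasMatDerivAt (fun t => G.mat (F t)) ((Y : Mat N) * G.mat (F z)) z) :
    HasMatDerivAt (fun t => (φ (F t) : Mat d)) (differential φ Y * (φ (F z) : Mat d)) z := by
  rw [← hφ.diffAt_mul]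
  exact hφ.hasMatDerivAt_diffAt hF

theorem hasMatDerivAt_exp (hφ : IsAlgebraicRep φ) (Y : G.lie) (z : ℂ) :
    HasMatDerivAt (fun t : ℂ => (φ (G.exp (t • Y)) : Mat d))
      (differential φ Y * (φ (G.exp (z • Y)) : Mat d)) z :=
  hφ.hasMatDerivAt (G.hasMatDerivAt_mat_exp Y z)

theorem diffAt_conj (hφ : IsAlgebraicRep φ) (Y : G.lie) (g : G.grp) :
    hφ.diffAt 1 (G.mat g * (Y : Mat N) * G.mat g⁻¹) =
      (φ g : Mat d) * differential φ Y * (φ g⁻¹ : Mat d) := by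
  have h0 := G.hasMatDerivAt_mat_exp Y 0
  have h1 := ((HasMatDerivAt.const (z := 0) (G.mat g)).mul h0).mul
    (HasMatDerivAt.const (z := 0) (G.mat g⁻¹))
  have h2 := hφ.hasMatDerivAt_diffAt (F := fun t => g * G.exp (t • Y) * g⁻¹)
    (M' := G.mat g * (Y : Mat N) * G.mat g⁻¹) (z := 0) (by simpa using h1)
  have h3 := ((HasMatDerivAt.const (z := 0) (φ g : Mat d)).mul (hφ.hasMatDerivAt_exp Y 0)).mul
    (HasMatDerivAt.const (z := 0) (φ g⁻¹ : Mat d))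
  simp only [← rep_mul] at h3
  have := h2.unique h3
  simpa using this

theorem differential_add (hφ : IsAlgebraicRep φ) (Y Z : G.lie) :
    differential φ (Y + Z) = differential φ Y + differential φ Z := by
  simp [hφ.differential_eq]

theorem differential_smul (hφ : IsAlgebraicRep φ) (c : ℂ) (Y : G.lie) :
    differential φ (c • Y) = c • differential φ Y := by
  simp [hφ.differential_eq]

theorem differential_zero (hφ : IsAlgebraicRep φ) : differential φ (0 : G.lie) = 0 := by
  simp [hφ.differential_eq]

theorem differential_sum (hφ : IsAlgebraicRep φ) {ι : Type*} (s : Finset ι) (Y : ι → G.lie) :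
    differential φ (∑ i ∈ s, Y i) = ∑ i ∈ s, differential φ (Y i) := by
  simp [hφ.differential_eq]

/-- A linear map applied to a differentiable matrix-valued function. -/
theorem _root_.RealOper.HasMatDerivAt.linearMap {M : ℂ → Mat N} {M' : Mat N} {z : ℂ}
    (hM : HasMatDerivAt M M' z) (D : Mat N →ₗ[ℂ] Mat d) :
    HasMatDerivAt (fun t => D (M t)) (D M') z := by
  intro i j
  have key : ∀ K : Mat N, D K i j = ∑ k, ∑ l, K k l * D (Matrix.single k l 1) i j := by
    intro K
    conv_lhs => rw [Matrix.matrix_eq_sum_single K]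
    simp only [map_sum, Matrix.sum_apply]
    refine Finset.sum_congr rfl fun k _ => Finset.sum_congr rfl fun l _ => ?_
    have : Matrix.single k l (K k l) = K k l • Matrix.single k l (1 : ℂ) := by
      simp [Matrix.smul_single]
    rw [this, map_smul]; simp
  rw [key M', funext fun t => key (M t)]
  exact HasDerivAt.fun_sum fun k _ => HasDerivAt.fun_sum fun l _ => (hM k l).mul_const _

theorem differential_lie (hφ : IsAlgebraicRep φ) (Y Z : G.lie) :
    differential φ ⁅Y, Z⁆ =
      differential φ Y * differential φ Z - differential φ Z * differential φ Y := by
  have hneg : HasDerivAt (fun t : ℂ => -t) (-1) 0 := (hasDerivAt_id 0).neg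
  have hinv : ∀ t : ℂ, (G.exp (t • Y))⁻¹ = G.exp ((-t) • Y) := by
    intro t
    rw [neg_smul, G.exp_neg]
  have h1 : HasMatDerivAt (fun t : ℂ => G.mat (G.exp ((-t) • Y))) (-(Y : Mat N)) 0 := by
    have := (by simpa using G.hasMatDerivAt_mat_exp Y 0 :
      HasMatDerivAt (fun t : ℂ => G.mat (G.exp (t • Y))) (Y : Mat N) 0)
    have := HasMatDerivAt.comp (z := 0) (τ := fun t => -t) (by simpa using this) hneg
    simpa using this
  have h2 : HasMatDerivAt (fun t : ℂ => (φ (G.exp ((-t) • Y)) : Mat d)) (-differential φ Y) 0 := by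
    have := (by simpa using hφ.hasMatDerivAt_exp Y 0 :
      HasMatDerivAt (fun t : ℂ => (φ (G.exp (t • Y)) : Mat d)) (differential φ Y) 0)
    have := HasMatDerivAt.comp (z := 0) (τ := fun t => -t) (by simpa using this) hneg
    simpa using this
  have h3 := (((G.hasMatDerivAt_mat_exp Y 0).mul
    (HasMatDerivAt.const (z := 0) (Z : Mat N))).mul h1).linearMap (hφ.diffAt 1)
  have h4 := ((hφ.hasMatDerivAt_exp Y 0).mul
    (HasMatDerivAt.const (z := 0) (differential φ Z))).mul h2
  have h5 : (fun t : ℂ => hφ.diffAt 1 (G.mat (G.exp (t • Y)) * (Z : Mat N) *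
      G.mat (G.exp ((-t) • Y)))) = fun t : ℂ => (φ (G.exp (t • Y)) : Mat d) * differential φ Z *
      (φ (G.exp ((-t) • Y)) : Mat d) := by
    funext t
    rw [← hinv, hφ.diffAt_conj]
  rw [h5] at h3
  have := h3.unique h4
  simp only [zero_smul, SimpleGroup.exp_zero, SimpleGroup.mat_one, map_one, Units.val_one, mul_one,
    one_mul, mul_zero, add_zero, neg_zero, mul_neg, ← sub_eq_add_neg] at this
  rw [hφ.differential_eq]
  rw [← this]
  rfl

theorem exp_eq (hφ : IsAlgebraicRep φ) (Y : G.lie) :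
    (φ (G.exp Y) : Mat d) = NormedSpace.exp (differential φ Y) := by
  set D := differential φ Y with hD
  have hder : ∀ t : ℂ, HasMatDerivAt
      (fun t : ℂ => NormedSpace.exp (t • (-D)) * (φ (G.exp (t • Y)) : Mat d)) 0 t := by
    intro t
    convert! (RealOper.hasMatDerivAt_exp (-D) t).mul (hφ.hasMatDerivAt_exp Y t) using 1
    have hc : Commute D (NormedSpace.exp (t • (-D))) :=
      (((Commute.refl D).neg_right).smul_right t).exp_right
    rw [← hD, ← mul_assoc, ← hc.eq, neg_mul, neg_mul, neg_add_cancel]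
  have hc : NormedSpace.exp (-D) * (φ (G.exp Y) : Mat d) = 1 := by
    ext i j
    have := is_const_of_deriv_eq_zero (fun t => (hder t i j).differentiableAt)
      (fun t => (hder t i j).deriv) 1 0
    simpa [NormedSpace.exp_zero] using this
  rw [Matrix.exp_neg] at hc
  have hu := (Matrix.isUnit_iff_isUnit_det _).1 (Matrix.isUnit_exp D)
  have := congrArg (NormedSpace.exp D * ·) hc
  simpa [← mul_assoc, Matrix.mul_nonsing_inv _ hu] using this

/-- If `Y` acts on a vector by the scalar `c`, then `exp Y` acts on it by `exp c`. -/
theorem exp_mulVec (hφ : IsAlgebraicRep φ) {Y : G.lie} {v : Fin d → ℂ} {c : ℂ}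
    (h : differential φ Y *ᵥ v = c • v) :
    (φ (G.exp Y) : Mat d) *ᵥ v = Complex.exp c • v := by
  rw [hφ.exp_eq, exp_mulVec_of_mulVec_eq_smul h]

/-- A subspace stable under the Lie algebra is stable under the group. -/
theorem stable_of_differential (hφ : IsAlgebraicRep φ) {E : Submodule ℂ (Fin d → ℂ)}
    (hE : ∀ Y, ∀ v ∈ E, differential φ Y *ᵥ v ∈ E) (g : G.grp) :
    ∀ v ∈ E, (φ g : Mat d) *ᵥ v ∈ E := by
  have hexp : ∀ Y, ∀ v ∈ E, (φ (G.exp Y) : Mat d) *ᵥ v ∈ E := fun Y => by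
    rw [hφ.exp_eq]; exact exp_mulVec_mem (hE Y)
  suffices h : (∀ v ∈ E, (φ g : Mat d) *ᵥ v ∈ E) ∧ ∀ v ∈ E, (φ g⁻¹ : Mat d) *ᵥ v ∈ E from h.1
  induction g using G.grp_induction with
  | hexp Y => exact ⟨hexp Y, by rw [← G.exp_neg]; exact hexp (-Y)⟩
  | hone => simp
  | hmul g g' h h' =>
    refine ⟨fun v hv => ?_, fun v hv => ?_⟩
    · rw [rep_mul, ← Matrix.mulVec_mulVec]
      exact h.1 _ (h'.1 v hv)
    · rw [mul_inv_rev, rep_mul, ← Matrix.mulVec_mulVec]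
      exact h'.2 _ (h.2 v hv)
  | hinv g h => exact ⟨h.2, by simpa using h.1⟩

/-- A representation irreducible under the group is irreducible under the Chevalley generators. -/
theorem irreducible_generators (hφ : IsAlgebraicRep φ)
    (hirr : IrreducibleUnder (Set.range fun g => (φ g : Mat d))) {E : Submodule ℂ (Fin d → ℂ)}
    (he : ∀ i, ∀ v ∈ E, differential φ (G.pin.e i) *ᵥ v ∈ E)
    (hf : ∀ i, ∀ v ∈ E, differential φ (G.pin.f i) *ᵥ v ∈ E) : E = ⊥ ∨ E = ⊤ := by
  refine hirr.2 E ?_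
  rintro _ ⟨g, rfl⟩
  refine hφ.stable_of_differential (fun Y => ?_) g
  induction Y using G.lie_induction with
  | he i => exact he i
  | hf i => exact hf i
  | hzero => intro v _; simp [hφ.differential_zero]
  | hadd Y Z hY hZ =>
    intro v hv
    rw [hφ.differential_add, Matrix.add_mulVec]
    exact E.add_mem (hY v hv) (hZ v hv)
  | hsmul c Y hY =>
    intro v hv
    rw [hφ.differential_smul, Matrix.smul_mulVec]
    exact E.smul_mem c (hY v hv)
  | hlie Y Z hY hZ =>
    intro v hv
    rw [hφ.differential_lie, Matrix.sub_mulVec, ← Matrix.mulVec_mulVec, ← Matrix.mulVec_mulVec]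
    exact E.sub_mem (hY _ (hZ v hv)) (hZ _ (hY v hv))

end IsAlgebraicRep

end RealOper

end

noncomputable section

namespace RealOper

/-! ### Highest weight modules -/

/-- Operators satisfying the commutation relations of the lowering operators of a Chevalley basis
with the other generators. -/
structure IsChevalley {r : ℕ} {M : Type*} [AddCommGroup M] [Module ℂ M]
    (A : Matrix (Fin r) (Fin r) ℤ) (E F H : Fin r → Module.End ℂ M) : Prop where
  h_f : ∀ i j x, H j (F i x) = F i (H j x) - (A i j : ℂ) • F i x
  e_f : ∀ i j x, E i (F j x) = F j (E i x) + if i = j then H i x else 0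

/-- A nonzero vector of weight `lam` killed by the raising operators. -/
structure IsHighestWeight {r : ℕ} {M : Type*} [AddCommGroup M] [Module ℂ M]
    (E H : Fin r → Module.End ℂ M) (lam : Fin r → ℂ) (v : M) : Prop where
  ne_zero : v ≠ 0
  e : ∀ i, E i v = 0
  h : ∀ i, H i v = lam i • v

/-- There is no proper nonzero subspace stable under the raising and lowering operators. -/
def IsIrreducibleFor {r : ℕ} {M : Type*} [AddCommGroup M] [Module ℂ M]
    (E F : Fin r → Module.End ℂ M) : Prop :=
  ∀ K : Submodule ℂ M, (∀ i, ∀ x ∈ K, E i x ∈ K) → (∀ i, ∀ x ∈ K, F i x ∈ K) → K = ⊥ ∨ K = ⊤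

/-- The result of applying a sequence of lowering operators to a vector. -/
def lowerWord {r : ℕ} {M : Type*} [AddCommGroup M] [Module ℂ M] (F : Fin r → Module.End ℂ M)
    (v : M) : List (Fin r) → M
  | [] => v
  | i :: l => F i (lowerWord F v l)

/-- The span of the vectors obtained from `v` by at least one lowering operator. -/
def lowerSpan {r : ℕ} {M : Type*} [AddCommGroup M] [Module ℂ M] (F : Fin r → Module.End ℂ M)
    (v : M) : Submodule ℂ M :=
  Submodule.span ℂ (lowerWord F v '' {l | l ≠ []})

section

variable {r : ℕ} {A : Matrix (Fin r) (Fin r) ℤ}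
  {M : Type*} [AddCommGroup M] [Module ℂ M] {E F H : Fin r → Module.End ℂ M}
  {M' : Type*} [AddCommGroup M'] [Module ℂ M'] {E' F' H' : Fin r → Module.End ℂ M'}
  {lam : Fin r → ℂ} {v : M} {v' : M'} {c : Fin r → ℂ}

theorem IsChevalley.h_lowerWord (hC : IsChevalley A E F H) (hv : IsHighestWeight E H lam v)
    (j : Fin r) (l : List (Fin r)) :
    ∃ a : ℂ, H j (lowerWord F v l) = a • lowerWord F v l := by
  induction l with
  | nil => exact ⟨lam j, hv.h j⟩
  | cons i l ih =>
    obtain ⟨a, ha⟩ := ih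
    refine ⟨a - A i j, ?_⟩
    simp only [lowerWord]
    rw [hC.h_f, ha, map_smul, sub_smul]

/-- The grading operator acts on words in the lowering operators by the length. -/
theorem IsChevalley.grading_lowerWord (hC : IsChevalley A E F H)
    (hv : IsHighestWeight E H lam v) (hc : ∀ i, ∑ j, (A i j : ℂ) * c j = 1) (l : List (Fin r)) :
    (∑ j, c j • H j) (lowerWord F v l) =
      ((∑ j, c j * lam j) - (l.length : ℂ)) • lowerWord F v l := by
  induction l with
  | nil =>
    simp only [lowerWord, LinearMap.sum_apply, LinearMap.smul_apply, hv.h, smul_smul,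
      Finset.sum_smul, List.length_nil, Nat.cast_zero, sub_zero]
  | cons i l ih =>
    have : ∀ x, (∑ j, c j • H j) (F i x) = F i ((∑ j, c j • H j) x) - F i x := by
      intro x
      simp only [LinearMap.sum_apply, LinearMap.smul_apply, hC.h_f, smul_sub, smul_smul,
        Finset.sum_sub_distrib, ← Finset.sum_smul, map_sum, map_smul]
      congr 1
      rw [Finset.sum_congr rfl fun j _ => mul_comm (c j) (A i j : ℂ), hc, one_smul]
    simp only [lowerWord, this, ih, map_smul, List.length_cons, Nat.cast_add, Nat.cast_one]
    rw [← sub_sub, sub_smul _ (1 : ℂ), one_smul]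

theorem IsChevalley.e_lowerWord_mem (hC : IsChevalley A E F H) (hv : IsHighestWeight E H lam v)
    (i : Fin r) (l : List (Fin r)) :
    E i (lowerWord F v l) ∈ Submodule.span ℂ (Set.range (lowerWord F v)) := by
  have hF : ∀ j, ∀ x ∈ Submodule.span ℂ (Set.range (lowerWord F v)),
      F j x ∈ Submodule.span ℂ (Set.range (lowerWord F v)) := by
    intro j x hx
    induction hx using Submodule.span_induction with
    | mem x hx =>
      obtain ⟨l, rfl⟩ := hx
      exact Submodule.subset_span ⟨j :: l, rfl⟩
    | zero => simp
    | add x y _ _ hx hy => rw [map_add]; exact Submodule.add_mem _ hx hy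
    | smul a x _ hx => rw [map_smul]; exact Submodule.smul_mem _ a hx
  induction l with
  | nil => simp [lowerWord, hv.e]
  | cons j l ih =>
    simp only [lowerWord]
    rw [hC.e_f]
    refine Submodule.add_mem _ (hF j _ ih) ?_
    split_ifs
    · obtain ⟨a, ha⟩ := hC.h_lowerWord hv i l
      rw [ha]
      exact Submodule.smul_mem _ _ (Submodule.subset_span ⟨l, rfl⟩)
    · exact Submodule.zero_mem _

theorem map_mem_span_range {ι : Type*} {w : ι → M} {T : Module.End ℂ M}
    (h : ∀ l, T (w l) ∈ Submodule.span ℂ (Set.range w)) :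
    ∀ x ∈ Submodule.span ℂ (Set.range w), T x ∈ Submodule.span ℂ (Set.range w) := by
  intro x hx
  induction hx using Submodule.span_induction with
  | mem x hx =>
    obtain ⟨l, rfl⟩ := hx
    exact h l
  | zero => simp
  | add x y _ _ hx hy => rw [map_add]; exact Submodule.add_mem _ hx hy
  | smul a x _ hx => rw [map_smul]; exact Submodule.smul_mem _ a hx

theorem f_lowerWord_mem (i : Fin r) (l : List (Fin r)) :
    F i (lowerWord F v l) ∈ Submodule.span ℂ (Set.range (lowerWord F v)) :=
  Submodule.subset_span ⟨i :: l, rfl⟩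

theorem IsChevalley.span_lowerWord (hC : IsChevalley A E F H) (hv : IsHighestWeight E H lam v)
    (hirr : IsIrreducibleFor E F) : Submodule.span ℂ (Set.range (lowerWord F v)) = ⊤ := by
  refine (hirr _ (fun i => map_mem_span_range (hC.e_lowerWord_mem hv i))
    (fun i => map_mem_span_range (f_lowerWord_mem i))).resolve_left fun h => ?_
  have : v ∈ Submodule.span ℂ (Set.range (lowerWord F v)) := Submodule.subset_span ⟨[], rfl⟩
  rw [h, Submodule.mem_bot] at this
  exact hv.ne_zero this

/-- The span of proper words contains no nonzero vector of the top degree. -/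
theorem IsChevalley.eq_zero_of_mem_lowerSpan (hC : IsChevalley A E F H)
    (hv : IsHighestWeight E H lam v) (hc : ∀ i, ∑ j, (A i j : ℂ) * c j = 1) {x : M}
    (hx : x ∈ lowerSpan F v) (hR : (∑ j, c j • H j) x = (∑ j, c j * lam j) • x) : x = 0 := by
  set R : Module.End ℂ M := ∑ j, c j • H j
  set Λ : ℂ := ∑ j, c j * lam j
  have h1 : x ∈ ⨆ μ, ⨆ (_ : μ ≠ Λ), R.eigenspace μ := by
    refine (Submodule.span_le.2 ?_ : lowerSpan F v ≤ _) hx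
    rintro _ ⟨l, hl, rfl⟩
    have hne : Λ - (l.length : ℂ) ≠ Λ := by
      have : l.length ≠ 0 := by simpa using hl
      simpa using this
    refine Submodule.mem_iSup_of_mem (Λ - (l.length : ℂ)) (Submodule.mem_iSup_of_mem hne ?_)
    exact Module.End.mem_eigenspace_iff.2 (hC.grading_lowerWord hv hc l)
  have h2 : x ∈ R.eigenspace Λ := Module.End.mem_eigenspace_iff.2 hR
  exact Submodule.disjoint_def.1 (R.eigenspaces_iSupIndep Λ) x h2 h1

theorem exists_eq_smul_add_of_mem_span {x : M}
    (hx : x ∈ Submodule.span ℂ (Set.range (lowerWord F v))) :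
    ∃ a : ℂ, ∃ y ∈ lowerSpan F v, x = a • v + y := by
  induction hx using Submodule.span_induction with
  | mem x hx =>
    obtain ⟨l, rfl⟩ := hx
    by_cases hl : l = []
    · subst hl
      exact ⟨1, 0, Submodule.zero_mem _, by simp [lowerWord]⟩
    · exact ⟨0, _, Submodule.subset_span ⟨l, hl, rfl⟩, by simp⟩
  | zero => exact ⟨0, 0, Submodule.zero_mem _, by simp⟩
  | add x y _ _ hx hy =>
    obtain ⟨a, x', hx', rfl⟩ := hx
    obtain ⟨b, y', hy', rfl⟩ := hy
    exact ⟨a + b, _, Submodule.add_mem _ hx' hy', by rw [add_smul]; abel⟩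
  | smul t x _ hx =>
    obtain ⟨a, x', hx', rfl⟩ := hx
    exact ⟨t * a, _, Submodule.smul_mem _ t hx', by rw [smul_add, smul_smul]⟩

theorem IsChevalley.grading_highestWeight (hv : IsHighestWeight E H lam v) :
    (∑ j, c j • H j) v = (∑ j, c j * lam j) • v := by
  simp only [LinearMap.sum_apply, LinearMap.smul_apply, hv.h, smul_smul, Finset.sum_smul]

/-- In a cyclic highest weight module, the top degree part is spanned by the generator. -/
theorem IsChevalley.exists_eq_smul (hC : IsChevalley A E F H) (hv : IsHighestWeight E H lam v)
    (hc : ∀ i, ∑ j, (A i j : ℂ) * c j = 1) {x : M}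
    (hx : x ∈ Submodule.span ℂ (Set.range (lowerWord F v)))
    (hR : (∑ j, c j • H j) x = (∑ j, c j * lam j) • x) : ∃ a : ℂ, x = a • v := by
  obtain ⟨a, y, hy, rfl⟩ := exists_eq_smul_add_of_mem_span hx
  refine ⟨a, ?_⟩
  rw [map_add, map_smul, IsChevalley.grading_highestWeight hv, smul_add, smul_comm,
    add_right_inj] at hR
  rw [hC.eq_zero_of_mem_lowerSpan hv hc hy hR, add_zero]

/-- The functional which takes the coefficient of the highest weight vector. -/
theorem IsChevalley.exists_top_functional (hC : IsChevalley A E F H)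
    (hv : IsHighestWeight E H lam v) (hc : ∀ i, ∑ j, (A i j : ℂ) * c j = 1)
    (hirr : IsIrreducibleFor E F) :
    ∃ ℓ : M →ₗ[ℂ] ℂ, ℓ v ≠ 0 ∧ (∀ i x, ℓ (F i x) = 0) ∧ ∀ i x, ℓ (H i x) = lam i * ℓ x := by
  have hvn : v ∉ lowerSpan F v := fun h =>
    hv.ne_zero (hC.eq_zero_of_mem_lowerSpan hv hc h (IsChevalley.grading_highestWeight hv))
  obtain ⟨ℓ, hℓv, hℓ⟩ := Submodule.exists_dual_map_eq_bot_of_notMem hvn inferInstance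
  have hℓ0 : ∀ x ∈ lowerSpan F v, ℓ x = 0 := by
    intro x hx
    have := Submodule.mem_map_of_mem (f := ℓ) hx
    rwa [hℓ, Submodule.mem_bot] at this
  have hspan := hC.span_lowerWord hv hirr
  refine ⟨ℓ, hℓv, fun i x => ?_, fun i x => ?_⟩
  · have : ℓ ∘ₗ F i = 0 := LinearMap.ext_on_range hspan fun l => by
      exact hℓ0 _ (Submodule.subset_span ⟨i :: l, List.cons_ne_nil i l, rfl⟩)
    exact LinearMap.congr_fun this x
  · have : ℓ ∘ₗ H i = lam i • ℓ := LinearMap.ext_on_range hspan fun l => by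
      by_cases hl : l = []
      · subst hl; simp [lowerWord, hv.h]
      · obtain ⟨a, ha⟩ := hC.h_lowerWord hv i l
        have := hℓ0 _ (Submodule.subset_span ⟨l, hl, rfl⟩)
        simp [ha, this]
    exact LinearMap.congr_fun this x

theorem IsChevalley.prod (hC : IsChevalley A E F H) (hC' : IsChevalley A E' F' H') :
    IsChevalley A (fun i => (E i).prodMap (E' i)) (fun i => (F i).prodMap (F' i))
      (fun i => (H i).prodMap (H' i)) where
  h_f i j x := Prod.ext (hC.h_f i j x.1) (hC'.h_f i j x.2)
  e_f i j x := by
    refine Prod.ext ?_ ?_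
    · have := hC.e_f i j x.1
      split_ifs at this ⊢ <;> simpa using this
    · have := hC'.e_f i j x.2
      split_ifs at this ⊢ <;> simpa using this

theorem lowerWord_prod (l : List (Fin r)) :
    lowerWord (fun i => (F i).prodMap (F' i)) (v, v') l = (lowerWord F v l, lowerWord F' v' l) := by
  induction l with
  | nil => rfl
  | cons i l ih => simp [lowerWord, ih]

/-- An irreducible module is determined by its highest weight. -/
theorem IsChevalley.exists_equiv (hC : IsChevalley A E F H) (hC' : IsChevalley A E' F' H')
    (hv : IsHighestWeight E H lam v) (hv' : IsHighestWeight E' H' lam v')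
    (hc : ∀ i, ∑ j, (A i j : ℂ) * c j = 1) (hirr : IsIrreducibleFor E F)
    (hirr' : IsIrreducibleFor E' F') :
    ∃ T : M' ≃ₗ[ℂ] M, (∀ i x, T (E' i x) = E i (T x)) ∧ ∀ i x, T (F' i x) = F i (T x) := by
  have hP := hC.prod hC'
  set EE : Fin r → Module.End ℂ (M × M') := fun i => (E i).prodMap (E' i) with hEE
  set FF : Fin r → Module.End ℂ (M × M') := fun i => (F i).prodMap (F' i) with hFF
  set HH : Fin r → Module.End ℂ (M × M') := fun i => (H i).prodMap (H' i) with hHH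
  have hvv : IsHighestWeight EE HH lam (v, v') :=
    ⟨fun h => hv.ne_zero (congrArg Prod.fst h), fun i => Prod.ext (hv.e i) (hv'.e i),
      fun i => Prod.ext (hv.h i) (hv'.h i)⟩
  set S := Submodule.span ℂ (Set.range (lowerWord FF (v, v'))) with hS
  have hSE : ∀ i, ∀ x ∈ S, EE i x ∈ S := fun i => map_mem_span_range (hP.e_lowerWord_mem hvv i)
  have hSF : ∀ i, ∀ x ∈ S, FF i x ∈ S := fun i => map_mem_span_range (f_lowerWord_mem i)
  have hRfst : ∀ x, (∑ j, c j • HH j) x = ((∑ j, c j • H j) x.1, (∑ j, c j • H' j) x.2) := by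
    intro x
    simp [hHH, LinearMap.sum_apply, Prod.ext_iff, Prod.fst_sum, Prod.snd_sum]
  have hker2 : ∀ y, ((0 : M), y) ∈ S → y = 0 := by
    have : S.comap (LinearMap.inr ℂ M M') = ⊥ := by
      refine (hirr' _ (fun i y hy => ?_) (fun i y hy => ?_)).resolve_right fun h => ?_
      · have := hSE i _ hy
        simpa [hEE] using this
      · have := hSF i _ hy
        simpa [hFF] using this
      · have hmem : ((0 : M), v') ∈ S := by
          have : v' ∈ S.comap (LinearMap.inr ℂ M M') := by rw [h]; trivial
          simpa using this
        obtain ⟨a, ha⟩ := hP.exists_eq_smul hvv hc hmem (by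
          rw [hRfst, IsChevalley.grading_highestWeight hv']; simp)
        have h1 : a • v = 0 := (congrArg Prod.fst ha).symm
        have ha0 : a = 0 := (smul_eq_zero.1 h1).resolve_right hv.ne_zero
        have h2 : v' = a • v' := congrArg Prod.snd ha
        rw [ha0, zero_smul] at h2
        exact hv'.ne_zero h2
    intro y hy
    have : y ∈ S.comap (LinearMap.inr ℂ M M') := hy
    simpa [‹S.comap (LinearMap.inr ℂ M M') = ⊥›] using this
  have hker1 : ∀ x, (x, (0 : M')) ∈ S → x = 0 := by
    have : S.comap (LinearMap.inl ℂ M M') = ⊥ := by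
      refine (hirr _ (fun i y hy => ?_) (fun i y hy => ?_)).resolve_right fun h => ?_
      · have := hSE i _ hy
        simpa [hEE] using this
      · have := hSF i _ hy
        simpa [hFF] using this
      · have hmem : (v, (0 : M')) ∈ S := by
          have : v ∈ S.comap (LinearMap.inl ℂ M M') := by rw [h]; trivial
          simpa using this
        obtain ⟨a, ha⟩ := hP.exists_eq_smul hvv hc hmem (by
          rw [hRfst, IsChevalley.grading_highestWeight hv]; simp)
        have h1 : a • v' = 0 := (congrArg Prod.snd ha).symm
        have ha0 : a = 0 := (smul_eq_zero.1 h1).resolve_right hv'.ne_zero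
        have h2 : v = a • v := congrArg Prod.fst ha
        rw [ha0, zero_smul] at h2
        exact hv.ne_zero h2
    intro x hx
    have : x ∈ S.comap (LinearMap.inl ℂ M M') := hx
    simpa [‹S.comap (LinearMap.inl ℂ M M') = ⊥›] using this
  have hb1 : Function.Bijective ((LinearMap.fst ℂ M M').domRestrict S) := by
    constructor
    · rw [← LinearMap.ker_eq_bot, LinearMap.ker_eq_bot']
      rintro ⟨⟨x, y⟩, hxy⟩ h
      have hx : x = 0 := h
      subst hx
      have := hker2 y hxy
      subst this
      rfl
    · rw [← LinearMap.range_eq_top, LinearMap.range_domRestrict, hS, Submodule.map_span,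
        ← Set.range_comp]
      convert! hC.span_lowerWord hv hirr using 3
      funext l
      simp [hFF, lowerWord_prod]
  have hb2 : Function.Bijective ((LinearMap.snd ℂ M M').domRestrict S) := by
    constructor
    · rw [← LinearMap.ker_eq_bot, LinearMap.ker_eq_bot']
      rintro ⟨⟨x, y⟩, hxy⟩ h
      have hy : y = 0 := h
      subst hy
      have := hker1 x hxy
      subst this
      rfl
    · rw [← LinearMap.range_eq_top, LinearMap.range_domRestrict, hS, Submodule.map_span,
        ← Set.range_comp]
      convert! hC'.span_lowerWord hv' hirr' using 3
      funext l
      simp [hFF, lowerWord_prod]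
  let e1 := LinearEquiv.ofBijective _ hb1
  let e2 := LinearEquiv.ofBijective _ hb2
  have he : ∀ s : S, (e2.symm.trans e1) (s : M × M').2 = (s : M × M').1 := by
    intro s
    have : (s : M × M').2 = e2 s := rfl
    rw [this, LinearEquiv.trans_apply, LinearEquiv.symm_apply_apply]
    rfl
  refine ⟨e2.symm.trans e1, fun i y => ?_, fun i y => ?_⟩
  · obtain ⟨s, rfl⟩ := hb2.2 y
    exact (he ⟨_, hSE i _ s.2⟩).trans (congrArg (E i) (he s).symm)
  · obtain ⟨s, rfl⟩ := hb2.2 y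
    exact (he ⟨_, hSF i _ s.2⟩).trans (congrArg (F i) (he s).symm)

theorem IsChevalley.dual (hC : IsChevalley A E F H) :
    IsChevalley A (fun i => -(E i).dualMap) (fun i => -(F i).dualMap)
      (fun i => -(H i).dualMap) where
  h_f i j ℓ := by
    ext x
    simp [hC.h_f]
  e_f i j ℓ := by
    ext x
    have := hC.e_f i j x
    split_ifs at this ⊢ <;> simp [this]

theorem IsIrreducibleFor.dual [FiniteDimensional ℂ M] (hirr : IsIrreducibleFor E F) :
    IsIrreducibleFor (fun i => -(E i).dualMap) (fun i => -(F i).dualMap) := by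
  intro K hE hF
  have key : ∀ T : Module.End ℂ M, (∀ ℓ ∈ K, (-T.dualMap) ℓ ∈ K) →
      ∀ x ∈ K.dualCoannihilator, T x ∈ K.dualCoannihilator := by
    intro T hT x hx
    rw [Submodule.mem_dualCoannihilator] at hx ⊢
    intro ℓ hℓ
    have := hx _ (hT ℓ hℓ)
    simpa using this
  have hK : K.dualCoannihilator.dualAnnihilator = K := Subspace.dualCoannihilator_dualAnnihilator_eq
  rcases hirr K.dualCoannihilator (fun i => key _ (hE i)) (fun i => key _ (hF i)) with h | h
  · right; rw [← hK, h]; simp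
  · left; rw [← hK, h]; simp

/-- The highest weight of a finite-dimensional module occurs, up to sign, as the lowest degree for
the grading by the half-sum of the positive coroots. -/
theorem IsChevalley.exists_lowest [FiniteDimensional ℂ M] (hC : IsChevalley A E F H)
    (hv : IsHighestWeight E H lam v) (hc : ∀ i, ∑ j, (A i j : ℂ) * c j = 1) :
    ∃ u : M, u ≠ 0 ∧ (∑ j, c j • H j) u = -(∑ j, c j * lam j) • u := by
  set R : Module.End ℂ M := ∑ j, c j • H j with hR
  set Λ : ℂ := ∑ j, c j * lam j with hΛ
  set e : Module.End ℂ M := ∑ i, E i with he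
  set f : Module.End ℂ M := ∑ i, (2 * c i) • F i with hf
  have hRv : R v = Λ • v := IsChevalley.grading_highestWeight hv
  have hRf : ∀ x, R (f x) = f (R x) - f x := by
    intro x
    have : ∀ i, R (F i x) = F i (R x) - F i x := by
      intro i
      simp only [hR, LinearMap.sum_apply, LinearMap.smul_apply, hC.h_f, smul_sub, smul_smul,
        Finset.sum_sub_distrib, ← Finset.sum_smul, map_sum, map_smul]
      congr 1
      rw [Finset.sum_congr rfl fun j _ => mul_comm (c j) (A i j : ℂ), hc, one_smul]
    simp only [hf, LinearMap.sum_apply, LinearMap.smul_apply, map_sum, map_smul, this, smul_sub,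
      Finset.sum_sub_distrib]
  have hef : ∀ x, e (f x) = f (e x) + (2 : ℂ) • R x := by
    intro x
    simp only [he, hf, hR, LinearMap.sum_apply, LinearMap.smul_apply, map_sum, map_smul, hC.e_f,
      smul_add, Finset.sum_add_distrib, Finset.smul_sum, smul_smul]
    congr 1
    · rw [Finset.sum_comm]
    · simp
  have hev : e v = 0 := by simp [he, LinearMap.sum_apply, hv.e]
  have hRn : ∀ n : ℕ, R ((f ^ n) v) = (Λ - n) • (f ^ n) v := by
    intro n
    induction n with
    | zero => simpa using hRv
    | succ n ih =>
      rw [pow_succ', Module.End.mul_apply, hRf, ih, map_smul, Nat.cast_add, Nat.cast_one, ← sub_sub,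
        sub_smul _ (1 : ℂ), one_smul]
  have hen : ∀ n : ℕ, e ((f ^ (n + 1)) v) = ((n + 1) * (2 * Λ - n) : ℂ) • (f ^ n) v := by
    intro n
    induction n with
    | zero => simp [hef, hev, hRv, smul_smul]
    | succ n ih =>
      rw [pow_succ', Module.End.mul_apply, hef, ih, map_smul, hRn, smul_smul, ← Module.End.mul_apply,
        ← pow_succ', ← add_smul]
      congr 1
      push_cast
      ring
  have hex : ∃ n : ℕ, (f ^ n) v = 0 := by
    by_contra! contra
    have hs : (Set.range fun n : ℕ => Λ - n).Infinite := by
      rw [Set.infinite_range_iff (fun n m h => by simpa using h)]; infer_instance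
    exact hs (R.eigenvectors_linearIndependent (Set.range fun n : ℕ => Λ - n)
      (fun s => (f ^ (Classical.choose s.2)) v)
      (fun s => by
        refine ⟨Module.End.mem_eigenspace_iff.2 ?_, contra _⟩
        rw [hRn]
        exact congrArg (· • _) (Classical.choose_spec s.2))).finite
  obtain ⟨n, hn₁, hn₂⟩ := Nat.exists_not_and_succ_of_not_zero_of_exists
    (p := fun n => (f ^ n) v = 0) (by simpa using hv.ne_zero) hex
  refine ⟨(f ^ n) v, hn₁, ?_⟩
  have h := hen n
  rw [hn₂, map_zero, eq_comm, smul_eq_zero] at h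
  have h2 := (mul_eq_zero.1 (h.resolve_right hn₁)).resolve_left (Nat.cast_add_one_ne_zero n)
  rw [hRn]
  congr 1
  linear_combination h2

/-- Two irreducible modules with an invariant non-degenerate pairing have highest weights of the
same degree. -/
theorem IsChevalley.degree_eq [FiniteDimensional ℂ M] [FiniteDimensional ℂ M']
    (hC : IsChevalley A E F H) (hC' : IsChevalley A E' F' H') {mu : Fin r → ℂ}
    (hv : IsHighestWeight E H lam v) (hv' : IsHighestWeight E' H' mu v')
    (hc : ∀ i, ∑ j, (A i j : ℂ) * c j = 1) (hirr : IsIrreducibleFor E F)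
    (hirr' : IsIrreducibleFor E' F') (B : M →ₗ[ℂ] M' →ₗ[ℂ] ℂ)
    (hBH : ∀ i x y, B (H i x) y = -B x (H' i y))
    (hB : ∀ x, (∀ y, B x y = 0) → x = 0) (hB' : ∀ y, (∀ x, B x y = 0) → y = 0) :
    ∑ j, c j * lam j = ∑ j, c j * mu j := by
  have hBR : ∀ x y, B ((∑ j, c j • H j) x) y = -B x ((∑ j, c j • H' j) y) := by
    intro x y
    simp [LinearMap.sum_apply, hBH]
  obtain ⟨u, hu, hRu⟩ := hC.exists_lowest hv hc
  obtain ⟨u', hu', hRu'⟩ := hC'.exists_lowest hv' hc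
  obtain ⟨k, hk⟩ : ∃ k : ℕ, (∑ j, c j * mu j) = (∑ j, c j * lam j) + k := by
    by_contra! hcon
    refine hu (hB u fun y => ?_)
    have : B u = 0 := LinearMap.ext_on_range (hC'.span_lowerWord hv' hirr') fun l => by
      have h1 := hBR u (lowerWord F' v' l)
      rw [hRu, hC'.grading_lowerWord hv' hc, map_smul, map_smul, LinearMap.smul_apply] at h1
      have h2 : ((∑ j, c j * mu j) - (∑ j, c j * lam j) - l.length) * B u (lowerWord F' v' l) = 0 := by
        simp only [smul_eq_mul] at h1
        linear_combination h1
      refine (mul_eq_zero.1 h2).resolve_left fun h3 => hcon l.length ?_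
      linear_combination h3
    rw [this]; rfl
  obtain ⟨k', hk'⟩ : ∃ k : ℕ, (∑ j, c j * lam j) = (∑ j, c j * mu j) + k := by
    by_contra! hcon
    refine hu' (hB' u' fun x => ?_)
    have : B.flip u' = 0 := LinearMap.ext_on_range (hC.span_lowerWord hv hirr) fun l => by
      have h1 := hBR (lowerWord F v l) u'
      rw [hRu', hC.grading_lowerWord hv hc, map_smul, map_smul, LinearMap.smul_apply] at h1
      have h2 : ((∑ j, c j * lam j) - (∑ j, c j * mu j) - l.length) * B (lowerWord F v l) u' = 0 := by
        simp only [smul_eq_mul] at h1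
        linear_combination h1
      refine (mul_eq_zero.1 h2).resolve_left fun h3 => hcon l.length ?_
      linear_combination h3
    exact LinearMap.congr_fun this x
  have hkk : ((k + k' : ℕ) : ℂ) = 0 := by push_cast; linear_combination -hk - hk'
  have : k' = 0 := by have := Nat.cast_eq_zero.1 hkk; omega
  rw [hk', this]; simp

end

end RealOper

end

noncomputable section

namespace RealOper

variable {N r : ℕ} {G : SimpleGroup N r} {d d' : ℕ} {lam mu : Fin r → ℕ}

/-! ### Duality between the representations of highest weights `λ` and `-w₀(λ)` -/

theorem isChevalley_of_mat {A : Matrix (Fin r) (Fin r) ℤ} {E F H : Fin r → Mat d}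
    (hf : ∀ i j, H j * F i - F i * H j = -(A i j : ℂ) • F i)
    (ef : ∀ i j, E i * F j - F j * E i = if i = j then H i else 0) :
    IsChevalley A (fun i => (E i).mulVecLin) (fun i => (F i).mulVecLin)
      (fun i => (H i).mulVecLin) where
  h_f i j x := by
    have := congrArg (· *ᵥ x) (hf i j)
    simp only [Matrix.sub_mulVec, ← Matrix.mulVec_mulVec, Matrix.smul_mulVec] at this
    simp only [Matrix.mulVecLin_apply]
    rw [sub_eq_iff_eq_add] at this
    rw [this, neg_smul]; abel
  e_f i j x := by
    have := congrArg (· *ᵥ x) (ef i j)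
    simp only [Matrix.sub_mulVec, ← Matrix.mulVec_mulVec] at this
    simp only [Matrix.mulVecLin_apply]
    rw [sub_eq_iff_eq_add] at this
    rw [this]
    split_ifs <;> simp [add_comm]

namespace SimpleGroup

theorem sum_mul_rhoCoeff (i : Fin r) : ∑ j, (G.pin.A i j : ℂ) * (G.rhoCoeff j : ℂ) = 1 := by
  have hdet : IsUnit (G.pin.A.map (Int.cast : ℤ → ℝ)).det := by
    have h := G.pin.nondegen.det_ne_zero
    have h2 : (G.pin.A.map (Int.cast : ℤ → ℝ)).det = ((G.pin.A.det : ℤ) : ℝ) :=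
      ((Int.castRingHom ℝ).map_det G.pin.A).symm
    rw [h2, isUnit_iff_ne_zero]
    exact_mod_cast h
  have h : (G.pin.A.map (Int.cast : ℤ → ℝ)) *ᵥ G.rhoCoeff = fun _ => 1 := by
    rw [rhoCoeff, Matrix.mulVec_mulVec, Matrix.mul_nonsing_inv _ hdet, Matrix.one_mulVec]
  have := congrFun h i
  simp only [Matrix.mulVec, dotProduct, Matrix.map_apply] at this
  have := congrArg (fun t : ℝ => (t : ℂ)) this
  push_cast at this
  exact this

theorem lie_e_f (i j : Fin r) :
    ⁅G.pin.e i, G.pin.f j⁆ = if i = j then G.pin.h i else 0 := by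
  split_ifs with h
  · subst h; exact (G.pin.sl2 i).lie_e_f
  · exact G.pin.lie_e_f_ne i j h

theorem real_h (i : Fin r) :
    ((G.pin.h i : G.lie) : Mat N).map (starRingEnd ℂ) = ((G.pin.h i : G.lie) : Mat N) := by
  have h : ((G.pin.h i : G.lie) : Mat N) = (G.pin.e i : Mat N) * (G.pin.f i : Mat N) -
      (G.pin.f i : Mat N) * (G.pin.e i : Mat N) := by
    rw [← (G.pin.sl2 i).lie_e_f]; rfl
  rw [h, Matrix.map_sub _ (map_sub _), Matrix.map_mul, Matrix.map_mul, G.real_e, G.real_f]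

end SimpleGroup

namespace HighestWeightRep

variable (V : HighestWeightRep G d lam)

theorem isAlgebraicRep : IsAlgebraicRep V.rep := V.algebraic

theorem lie_h_f (i j : Fin r) :
    differential V.rep (G.pin.h j) * differential V.rep (G.pin.f i) -
      differential V.rep (G.pin.f i) * differential V.rep (G.pin.h j) =
      -(G.pin.A i j : ℂ) • differential V.rep (G.pin.f i) := by
  rw [← V.isAlgebraicRep.differential_lie, G.pin.lie_h_f, ← V.isAlgebraicRep.differential_smul]
  congr 1
  rw [← Int.cast_smul_eq_zsmul ℂ]
  simp

theorem lie_e_f (i j : Fin r) :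
    differential V.rep (G.pin.e i) * differential V.rep (G.pin.f j) -
      differential V.rep (G.pin.f j) * differential V.rep (G.pin.e i) =
      if i = j then differential V.rep (G.pin.h i) else 0 := by
  rw [← V.isAlgebraicRep.differential_lie, G.lie_e_f]
  split_ifs
  · rfl
  · exact V.isAlgebraicRep.differential_zero

theorem isChevalley : IsChevalley G.pin.A (fun i => (differential V.rep (G.pin.e i)).mulVecLin)
    (fun i => (differential V.rep (G.pin.f i)).mulVecLin)
    (fun i => (differential V.rep (G.pin.h i)).mulVecLin) :=
  isChevalley_of_mat V.lie_h_f V.lie_e_f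

theorem isHighestWeight : IsHighestWeight (fun i => (differential V.rep (G.pin.e i)).mulVecLin)
    (fun i => (differential V.rep (G.pin.h i)).mulVecLin) (fun i => (lam i : ℂ)) V.vec :=
  ⟨V.vec_ne_zero, V.e_vec, V.h_vec⟩

theorem isIrreducibleFor : IsIrreducibleFor
    (fun i => (differential V.rep (G.pin.e i)).mulVecLin)
    (fun i => (differential V.rep (G.pin.f i)).mulVecLin) := fun _ hE hF =>
  V.isAlgebraicRep.irreducible_generators V.irreducible hE hF

/-- The complex conjugate of the action of a Lie algebra element. -/
abbrev conjDiff (Y : G.lie) : Mat d := (differential V.rep Y).map (starRingEnd ℂ)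

theorem conj_mulVec (M : Mat d) (v : Fin d → ℂ) :
    M.map (starRingEnd ℂ) *ᵥ star v = star (M *ᵥ v) := by
  ext i
  simp [Matrix.mulVec, dotProduct]

theorem isChevalley_conj : IsChevalley G.pin.A (fun i => (V.conjDiff (G.pin.e i)).mulVecLin)
    (fun i => (V.conjDiff (G.pin.f i)).mulVecLin) (fun i => (V.conjDiff (G.pin.h i)).mulVecLin) := by
  refine isChevalley_of_mat (fun i j => ?_) (fun i j => ?_)
  · have := congrArg (fun M : Mat d => M.map (starRingEnd ℂ)) (V.lie_h_f i j)
    simp only [Matrix.map_sub _ (map_sub (starRingEnd ℂ)), Matrix.map_mul] at this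
    rw [this]
    ext k l
    simp
  · have := congrArg (fun M : Mat d => M.map (starRingEnd ℂ)) (V.lie_e_f i j)
    simp only [Matrix.map_sub _ (map_sub (starRingEnd ℂ)), Matrix.map_mul] at this
    rw [this]
    split_ifs
    · rfl
    · ext k l; simp

theorem isHighestWeight_conj : IsHighestWeight (fun i => (V.conjDiff (G.pin.e i)).mulVecLin)
    (fun i => (V.conjDiff (G.pin.h i)).mulVecLin) (fun i => (lam i : ℂ)) (star V.vec) := by
  refine ⟨by simpa using V.vec_ne_zero, fun i => ?_, fun i => ?_⟩
  · rw [Matrix.mulVecLin_apply, conj_mulVec, V.e_vec, star_zero]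
  · rw [Matrix.mulVecLin_apply, conj_mulVec, V.h_vec]
    ext k; simp

theorem isIrreducibleFor_conj : IsIrreducibleFor
    (fun i => (V.conjDiff (G.pin.e i)).mulVecLin) (fun i => (V.conjDiff (G.pin.f i)).mulVecLin) := by
  intro K hE hF
  let K' : Submodule ℂ (Fin d → ℂ) :=
    { carrier := {x | star x ∈ K}
      add_mem' := fun {a b} ha hb => by simpa using K.add_mem ha hb
      zero_mem' := by simp
      smul_mem' := fun c x hx => by
        simpa using K.smul_mem (star c) hx }
  have hmem : ∀ x, x ∈ K' ↔ star x ∈ K := fun x => Iff.rfl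
  have key : ∀ (M : Mat d), (∀ x ∈ K, (M.map (starRingEnd ℂ)).mulVecLin x ∈ K) →
      ∀ x ∈ K', M.mulVecLin x ∈ K' := by
    intro M hM x hx
    have := hM _ hx
    rwa [Matrix.mulVecLin_apply, conj_mulVec] at this
  rcases V.isIrreducibleFor K' (fun i => key _ (hE i)) (fun i => key _ (hF i)) with h | h
  · left
    refine (Submodule.eq_bot_iff _).2 fun x hx => ?_
    have : star x ∈ K' := by rw [hmem, star_star]; exact hx
    rw [h, Submodule.mem_bot] at this
    simpa using this
  · right
    refine (Submodule.eq_top_iff').2 fun x => ?_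
    have : star x ∈ K' := by rw [h]; trivial
    rwa [hmem, star_star] at this

/-- A Lie subalgebra element of the negative part acts with values in the span of the images of
the lowering operators. -/
theorem functional_nMinus {ℓ : (Fin d → ℂ) →ₗ[ℂ] ℂ}
    (hℓ : ∀ i x, ℓ (differential V.rep (G.pin.f i) *ᵥ x) = 0) {Y : G.lie} (hY : Y ∈ G.nMinus) :
    ∀ x, ℓ (differential V.rep Y *ᵥ x) = 0 := by
  induction hY using LieSubalgebra.lieSpan_induction with
  | mem x hx => obtain ⟨i, rfl⟩ := hx; exact hℓ i
  | zero => simp [V.isAlgebraicRep.differential_zero]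
  | add u w _ _ hu hw =>
    intro x; rw [V.isAlgebraicRep.differential_add, Matrix.add_mulVec, map_add, hu, hw, add_zero]
  | smul t u _ hu =>
    intro x; rw [V.isAlgebraicRep.differential_smul, Matrix.smul_mulVec, map_smul, hu, smul_zero]
  | lie u w _ _ hu hw =>
    intro x
    rw [V.isAlgebraicRep.differential_lie, Matrix.sub_mulVec, ← Matrix.mulVec_mulVec,
      ← Matrix.mulVec_mulVec, map_sub, hu, hw, sub_zero]

/-- The dual of the representation of highest weight `λ` has highest weight `-w₀(λ)`. -/
theorem exists_dual_highestWeight (hmu : G.IsNegLongest lam mu) :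
    ∃ ℓ : Module.Dual ℂ (Fin d → ℂ), IsHighestWeight
      (fun i => -((differential V.rep (G.pin.e i)).mulVecLin).dualMap)
      (fun i => -((differential V.rep (G.pin.h i)).mulVecLin).dualMap)
      (fun i => (mu i : ℂ)) ℓ := by
  obtain ⟨n, w, hw, he, hm⟩ := hmu
  obtain ⟨ℓ, hℓv, hℓf, hℓh⟩ := V.isChevalley.exists_top_functional V.isHighestWeight
    (c := fun j => (G.rhoCoeff j : ℂ)) G.sum_mul_rhoCoeff V.isIrreducibleFor
  have hconj : ∀ (Y : G.lie) (x : Fin d → ℂ), (V.rep n⁻¹ : Mat d) *ᵥ (differential V.rep Y *ᵥ x) =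
      V.isAlgebraicRep.diffAt 1 (G.mat n⁻¹ * (Y : Mat N) * G.mat n) *ᵥ
        ((V.rep n⁻¹ : Mat d) *ᵥ x) := by
    intro Y x
    have := V.isAlgebraicRep.diffAt_conj Y n⁻¹
    rw [inv_inv] at this
    rw [this, Matrix.mulVec_mulVec, Matrix.mulVec_mulVec, mul_assoc, rep_mul_inv, mul_one]
  refine ⟨ℓ ∘ₗ (V.rep n⁻¹ : Mat d).mulVecLin, ?_, fun i => ?_, fun i => ?_⟩
  · intro h
    have := LinearMap.congr_fun h ((V.rep n : Mat d) *ᵥ V.vec)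
    simp only [LinearMap.comp_apply, Matrix.mulVecLin_apply, Matrix.mulVec_mulVec,
      rep_inv_mul, Matrix.one_mulVec] at this
    exact hℓv this
  · obtain ⟨Y, hY, hYe⟩ := he i
    suffices h : ∀ x, ℓ ((V.rep n⁻¹ : Mat d) *ᵥ (differential V.rep (G.pin.e i) *ᵥ x)) = 0 from
      LinearMap.ext fun x => neg_eq_zero.2 (h x)
    intro x
    rw [hconj, hYe, ← V.isAlgebraicRep.differential_eq]
    exact V.functional_nMinus hℓf hY _
  · suffices h : ∀ x, ℓ ((V.rep n⁻¹ : Mat d) *ᵥ (differential V.rep (G.pin.h i) *ᵥ x)) =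
        - (mu i : ℂ) * ℓ ((V.rep n⁻¹ : Mat d) *ᵥ x) by
      refine LinearMap.ext fun x => ?_
      change -(ℓ ((V.rep n⁻¹ : Mat d) *ᵥ (differential V.rep (G.pin.h i) *ᵥ x))) =
        (mu i : ℂ) * ℓ ((V.rep n⁻¹ : Mat d) *ᵥ x)
      rw [h]; ring
    intro x
    rw [hconj, hw, map_sum, hm]
    simp only [map_smul, ← V.isAlgebraicRep.differential_eq, Matrix.sum_mulVec, map_sum,
      Matrix.smul_mulVec, neg_neg, Finset.sum_mul]
    refine Finset.sum_congr rfl fun j _ => ?_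
    have := hℓh j ((V.rep n⁻¹ : Mat d) *ᵥ x)
    rw [Matrix.mulVecLin_apply] at this
    rw [this, smul_eq_mul]; ring

end HighestWeightRep

theorem HasMatDerivAt.transpose {m n : ℕ} {M : ℂ → Matrix (Fin m) (Fin n) ℂ}
    {M' : Matrix (Fin m) (Fin n) ℂ} {z : ℂ} (h : HasMatDerivAt M M' z) :
    HasMatDerivAt (fun t => (M t)ᵀ) M'ᵀ z := fun i j => h j i

/-- A pairing invariant under the operators `C` and `D` is invariant under their exponentials. -/
theorem exp_transpose_mul_mul_exp {C : Mat d'} {D : Mat d} {Q : Matrix (Fin d') (Fin d) ℂ}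
    (h : Cᵀ * Q = -(Q * D)) : (NormedSpace.exp C)ᵀ * Q * NormedSpace.exp D = Q := by
  have hder : ∀ t : ℂ, HasMatDerivAt
      (fun t : ℂ => (NormedSpace.exp (t • C))ᵀ * Q * NormedSpace.exp (t • D)) 0 t := by
    intro t
    convert! (((hasMatDerivAt_exp C t).transpose).mul (HasMatDerivAt.const Q)).mul
      (hasMatDerivAt_exp D t) using 1
    rw [Matrix.transpose_mul, Matrix.mul_zero, add_zero]
    simp only [Matrix.mul_assoc]
    rw [← Matrix.mul_assoc Cᵀ, h]
    simp [Matrix.mul_assoc]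
  ext i j
  have := is_const_of_deriv_eq_zero (fun t => (hder t i j).differentiableAt)
      (fun t => (hder t i j).deriv) 1 0
  simpa [NormedSpace.exp_zero] using this

/-- The matrix of an invariant pairing between `V_λ` and the complex conjugate of `V_{-w₀(λ)}`,
invariant with respect to the split real structure. -/
structure IsDualityMatrix (V : HighestWeightRep G d lam) (W : HighestWeightRep G d' mu)
    (Q : Matrix (Fin d') (Fin d) ℂ) : Prop where
  e : ∀ i, (W.conjDiff (G.pin.e i))ᵀ * Q = -(Q * differential V.rep (G.pin.e i))
  f : ∀ i, (W.conjDiff (G.pin.f i))ᵀ * Q = -(Q * differential V.rep (G.pin.f i))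
  left : ∀ x, Q *ᵥ x = 0 → x = 0
  right : ∀ y, y ᵥ* Q = 0 → y = 0

theorem exists_isDualityMatrix (V : HighestWeightRep G d lam) (W : HighestWeightRep G d' mu)
    (hmu : G.IsNegLongest lam mu) : ∃ Q, IsDualityMatrix V W Q := by
  obtain ⟨ℓ, hℓ⟩ := V.exists_dual_highestWeight hmu
  obtain ⟨T, hTE, hTF⟩ := V.isChevalley.dual.exists_equiv W.isChevalley_conj hℓ
    W.isHighestWeight_conj (c := fun j => (G.rhoCoeff j : ℂ)) G.sum_mul_rhoCoeff
    V.isIrreducibleFor.dual W.isIrreducibleFor_conj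
  let Q : Matrix (Fin d') (Fin d) ℂ := Matrix.of fun i j => T (Pi.single i 1) (Pi.single j 1)
  have hQ : ∀ y x, T y x = y ⬝ᵥ (Q *ᵥ x) := by
    intro y x
    conv_lhs => rw [pi_eq_sum_univ' y, pi_eq_sum_univ' x]
    simp only [map_sum, map_smul, LinearMap.sum_apply, LinearMap.smul_apply, smul_eq_mul,
      Matrix.mulVec, dotProduct, Q, Matrix.of_apply, Finset.mul_sum]
    rw [Finset.sum_comm]
    exact Finset.sum_congr rfl fun i _ => Finset.sum_congr rfl fun j _ => by ring
  have hext : ∀ {K K' : Matrix (Fin d') (Fin d) ℂ}, (∀ y x, y ⬝ᵥ (K *ᵥ x) = y ⬝ᵥ (K' *ᵥ x)) →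
      K = K' := by
    intro K K' h
    ext i j
    simpa using h (Pi.single i 1) (Pi.single j 1)
  have hrel : ∀ (C : Mat d') (D : Mat d), (∀ y, T (C *ᵥ y) = -(D.mulVecLin.dualMap) (T y)) →
      Cᵀ * Q = -(Q * D) := by
    intro C D h
    refine hext fun y x => ?_
    have h1 := LinearMap.congr_fun (h y) x
    simp only [LinearMap.neg_apply, LinearMap.dualMap_apply, Matrix.mulVecLin_apply, hQ] at h1
    rw [Matrix.neg_mulVec, dotProduct_neg, ← Matrix.mulVec_mulVec, ← Matrix.mulVec_mulVec, ← h1,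
      Matrix.mulVec_transpose, dotProduct_comm, ← Matrix.dotProduct_mulVec, dotProduct_comm]
  refine ⟨Q, fun i => hrel _ _ fun y => ?_, fun i => hrel _ _ fun y => ?_, fun x hx => ?_,
    fun y hy => ?_⟩
  · exact hTE i y
  · exact hTF i y
  · ext i
    obtain ⟨y, hy⟩ := T.surjective (LinearMap.proj i)
    have := hQ y x
    rw [hy, hx] at this
    simpa using this
  · have : T y = 0 := by
      refine LinearMap.ext fun x => ?_
      rw [hQ, Matrix.dotProduct_mulVec, hy]; simp
    simpa using this

namespace IsDualityMatrix

variable {V : HighestWeightRep G d lam} {W : HighestWeightRep G d' mu}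
  {Q : Matrix (Fin d') (Fin d) ℂ}

theorem lie (hQ : IsDualityMatrix V W Q) (Y : G.lie) :
    ∃ Y' : G.lie, (Y' : Mat N) = (Y : Mat N).map (starRingEnd ℂ) ∧
      (W.conjDiff Y)ᵀ * Q = -(Q * differential V.rep Y') := by
  induction Y using G.lie_induction with
  | he i => exact ⟨G.pin.e i, (G.real_e i).symm, hQ.e i⟩
  | hf i => exact ⟨G.pin.f i, (G.real_f i).symm, hQ.f i⟩
  | hzero =>
    refine ⟨0, by ext; simp, ?_⟩
    have : W.conjDiff (0 : G.lie) = 0 := by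
      ext; simp [HighestWeightRep.conjDiff, W.isAlgebraicRep.differential_zero]
    rw [this, V.isAlgebraicRep.differential_zero]; simp
  | hadd Y Z hY hZ =>
    obtain ⟨Y', hY', h1⟩ := hY
    obtain ⟨Z', hZ', h2⟩ := hZ
    refine ⟨Y' + Z', by ext; simp [hY', hZ'], ?_⟩
    have : W.conjDiff (Y + Z) = W.conjDiff Y + W.conjDiff Z := by
      ext; simp [HighestWeightRep.conjDiff, W.isAlgebraicRep.differential_add]
    rw [this, V.isAlgebraicRep.differential_add, Matrix.transpose_add, Matrix.add_mul, h1, h2,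
      Matrix.mul_add, neg_add]
  | hsmul c Y hY =>
    obtain ⟨Y', hY', h1⟩ := hY
    refine ⟨(starRingEnd ℂ) c • Y', by ext; simp [hY'], ?_⟩
    have : W.conjDiff (c • Y) = (starRingEnd ℂ) c • W.conjDiff Y := by
      ext; simp [HighestWeightRep.conjDiff, W.isAlgebraicRep.differential_smul]
    rw [this, V.isAlgebraicRep.differential_smul, Matrix.transpose_smul, Matrix.smul_mul, h1,
      Matrix.mul_smul, smul_neg]
  | hlie Y Z hY hZ =>
    obtain ⟨Y', hY', h1⟩ := hY
    obtain ⟨Z', hZ', h2⟩ := hZ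
    refine ⟨⁅Y', Z'⁆, ?_, ?_⟩
    · change (Y' : Mat N) * (Z' : Mat N) - (Z' : Mat N) * (Y' : Mat N) =
        ((Y : Mat N) * (Z : Mat N) - (Z : Mat N) * (Y : Mat N)).map (starRingEnd ℂ)
      rw [Matrix.map_sub _ (map_sub _), Matrix.map_mul, Matrix.map_mul, hY', hZ']
    have : W.conjDiff ⁅Y, Z⁆ = W.conjDiff Y * W.conjDiff Z - W.conjDiff Z * W.conjDiff Y := by
      simp only [HighestWeightRep.conjDiff, W.isAlgebraicRep.differential_lie]
      rw [Matrix.map_sub _ (map_sub _), Matrix.map_mul, Matrix.map_mul]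
    rw [this, V.isAlgebraicRep.differential_lie, Matrix.transpose_sub, Matrix.transpose_mul,
      Matrix.transpose_mul, Matrix.sub_mul, Matrix.mul_assoc, Matrix.mul_assoc, h1, h2,
      Matrix.mul_neg, Matrix.mul_neg, ← Matrix.mul_assoc, ← Matrix.mul_assoc, h1, h2,
      Matrix.mul_sub, Matrix.neg_mul, Matrix.neg_mul, Matrix.mul_assoc, Matrix.mul_assoc]
    abel

theorem grp (hQ : IsDualityMatrix V W Q) (g : G.grp) :
    ∃ g' : G.grp, G.mat g' = (G.mat g).map (starRingEnd ℂ) ∧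
      ((W.rep g : Mat d').map (starRingEnd ℂ))ᵀ * Q * (V.rep g' : Mat d) = Q := by
  induction g using G.grp_induction with
  | hexp Y =>
    obtain ⟨Y', hY', h⟩ := hQ.lie Y
    refine ⟨G.exp Y', ?_, ?_⟩
    · rw [G.mat_exp, G.mat_exp, map_conj_exp, hY']
    · rw [W.isAlgebraicRep.exp_eq, V.isAlgebraicRep.exp_eq, map_conj_exp]
      exact exp_transpose_mul_mul_exp h
  | hone => exact ⟨1, by ext i j; simp [Matrix.one_apply, apply_ite], by simp⟩
  | hmul g k hg hk =>
    obtain ⟨g', hg', h1⟩ := hg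
    obtain ⟨k', hk', h2⟩ := hk
    refine ⟨g' * k', by rw [G.mat_mul, G.mat_mul, Matrix.map_mul, hg', hk'], ?_⟩
    rw [rep_mul, rep_mul, Matrix.map_mul, Matrix.transpose_mul]
    calc _ = ((W.rep k : Mat d').map (starRingEnd ℂ))ᵀ *
          (((W.rep g : Mat d').map (starRingEnd ℂ))ᵀ * Q * (V.rep g' : Mat d)) *
            (V.rep k' : Mat d) := by simp only [Matrix.mul_assoc]
      _ = Q := by rw [h1, h2]
  | hinv g hg =>
    obtain ⟨g', hg', h1⟩ := hg
    have hone : ∀ n : ℕ, (1 : Mat n).map (starRingEnd ℂ) = 1 := fun n =>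
      Matrix.map_one _ (map_zero _) (map_one _)
    refine ⟨g'⁻¹, ?_, ?_⟩
    · have h2 : G.mat g' * (G.mat g⁻¹).map (starRingEnd ℂ) = 1 := by
        rw [hg', ← Matrix.map_mul, G.mat_mul_inv, hone]
      calc G.mat g'⁻¹ = G.mat g'⁻¹ * (G.mat g' * (G.mat g⁻¹).map (starRingEnd ℂ)) := by
            rw [h2, mul_one]
        _ = _ := by rw [← mul_assoc, G.mat_inv_mul, one_mul]
    · have h2 : ((W.rep g⁻¹ : Mat d').map (starRingEnd ℂ))ᵀ *
          ((W.rep g : Mat d').map (starRingEnd ℂ))ᵀ = 1 := by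
        rw [← Matrix.transpose_mul, ← Matrix.map_mul, rep_mul_inv, hone, Matrix.transpose_one]
      conv_lhs => rw [← h1]
      calc _ = (((W.rep g⁻¹ : Mat d').map (starRingEnd ℂ))ᵀ *
          ((W.rep g : Mat d').map (starRingEnd ℂ))ᵀ) * Q *
            ((V.rep g' : Mat d) * (V.rep g'⁻¹ : Mat d)) := by simp only [Matrix.mul_assoc]
        _ = Q := by rw [h2, rep_mul_inv, Matrix.mul_one, Matrix.one_mul]

theorem rhoPairing_eq (hQ : IsDualityMatrix V W Q) : G.rhoPairing lam = G.rhoPairing mu := by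
  have hh : ∀ i, (W.conjDiff (G.pin.h i))ᵀ * Q = -(Q * differential V.rep (G.pin.h i)) := by
    intro i
    obtain ⟨Y', hY', h⟩ := hQ.lie (G.pin.h i)
    have : Y' = G.pin.h i := Subtype.ext (hY'.trans (G.real_h i))
    rwa [this] at h
  have hB : ∀ x y, Matrix.toLinearMap₂' ℂ Qᵀ x y = y ⬝ᵥ (Q *ᵥ x) := by
    intro x y
    rw [Matrix.toLinearMap₂'_apply', Matrix.mulVec_transpose, dotProduct_comm,
      ← Matrix.dotProduct_mulVec]
  have := V.isChevalley.degree_eq W.isChevalley_conj V.isHighestWeight W.isHighestWeight_conj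
    (c := fun j => (G.rhoCoeff j : ℂ)) G.sum_mul_rhoCoeff V.isIrreducibleFor W.isIrreducibleFor_conj
    (Matrix.toLinearMap₂' ℂ Qᵀ) ?_ ?_ ?_
  · simp only [SimpleGroup.rhoPairing]
    exact_mod_cast this
  · intro i x y
    simp only [hB, Matrix.mulVecLin_apply]
    have := congrArg (fun K => y ⬝ᵥ (K *ᵥ x)) (hh i)
    simp only [Matrix.neg_mulVec, dotProduct_neg, ← Matrix.mulVec_mulVec] at this
    rw [Matrix.mulVec_transpose, dotProduct_comm, ← Matrix.dotProduct_mulVec, dotProduct_comm] at this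
    rw [this, neg_neg]
  · intro x hx
    refine hQ.left x (dotProduct_eq_zero _ fun y => ?_)
    rw [dotProduct_comm, ← hB, hx]
  · intro y hy
    refine hQ.right y (dotProduct_eq_zero _ fun x => ?_)
    rw [← Matrix.dotProduct_mulVec, ← hB, hy]

end IsDualityMatrix

end RealOper

end

noncomputable section

namespace RealOper

open Filter Topology

variable {N r : ℕ} {G : SimpleGroup N r}

/-! ### Differential equations in the group -/

/-- A holomorphic function on a disc all of whose derivatives vanish at the centre is zero. -/
theorem eq_zero_of_iteratedDeriv {f : ℂ → ℂ} {z₀ : ℂ} {ε : ℝ}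
    (hf : DifferentiableOn ℂ f (Metric.ball z₀ ε)) (h : ∀ n, iteratedDeriv n f z₀ = 0) :
    ∀ z ∈ Metric.ball z₀ ε, f z = 0 := by
  intro z hz
  rw [← Complex.taylorSeries_eq_on_ball' hz hf]
  simp [h]

theorem linearMap_mat_apply {E : Type*} [AddCommGroup E] [Module ℂ E] (D : Mat N →ₗ[ℂ] E)
    (K : Mat N) : D K = ∑ k, ∑ l, K k l • D (Matrix.single k l 1) := by
  conv_lhs => rw [Matrix.matrix_eq_sum_single K]
  simp only [map_sum]
  refine Finset.sum_congr rfl fun k _ => Finset.sum_congr rfl fun l _ => ?_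
  rw [← map_smul, Matrix.smul_single, smul_eq_mul, mul_one]

theorem differentiableOn_linearMap_mat {E : Type*} [NormedAddCommGroup E] [NormedSpace ℂ E]
    (D : Mat N →ₗ[ℂ] E) {A : ℂ → Mat N} {U : Set ℂ}
    (hA : ∀ i j, DifferentiableOn ℂ (fun z => A z i j) U) :
    DifferentiableOn ℂ (fun z => D (A z)) U := by
  rw [funext fun z => linearMap_mat_apply D (A z)]
  exact DifferentiableOn.fun_sum fun k _ => DifferentiableOn.fun_sum fun l _ =>
    (hA k l).smul_const _

/-- A holomorphic linear matrix differential equation has a local fundamental solution. -/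
theorem exists_mat_solution {A : ℂ → Mat N} {U : Set ℂ} (hU : IsOpen U)
    (hA : ∀ i j, DifferentiableOn ℂ (fun z => A z i j) U) {z₀ : ℂ} (hz₀ : z₀ ∈ U) :
    ∃ ε > 0, Metric.ball z₀ ε ⊆ U ∧ ∃ M : ℂ → Mat N, M z₀ = 1 ∧
      (∀ z ∈ Metric.ball z₀ ε, HasMatDerivAt M (A z * M z) z) ∧
      ∀ z ∈ Metric.ball z₀ ε, (M z).det ≠ 0 := by
  let D : Mat N →ₗ[ℂ] ((Fin N → ℂ) →L[ℂ] (Fin N → ℂ)) :=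
    (LinearMap.toContinuousLinearMap : _ ≃ₗ[ℂ] ((Fin N → ℂ) →L[ℂ] (Fin N → ℂ))).toLinearMap ∘ₗ
      (Matrix.toLin' : Mat N ≃ₗ[ℂ] _).toLinearMap
  have hD : ∀ K u, D K u = K *ᵥ u := fun K u => by simp [D]
  obtain ⟨ε, hε, hεU, hsol⟩ := exists_linear_ode_solution hU
    (differentiableOn_linearMap_mat D hA) hz₀
  choose u hu0 hu using fun j : Fin N => hsol (Pi.single j 1)
  let M : ℂ → Mat N := fun z => Matrix.of fun i j => u j z i
  have hM : ∀ z ∈ Metric.ball z₀ ε, HasMatDerivAt M (A z * M z) z := by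
    intro z hz i j
    have := hasDerivAt_pi.1 (hu j z hz) i
    rw [hD] at this
    exact this
  have hM0 : M z₀ = 1 := by
    ext i j
    simp [M, hu0, Matrix.one_apply, Pi.single_apply]
  have hdet : ∀ᶠ z in 𝓝 z₀, (M z).det ≠ 0 := by
    have hc : ContinuousAt (fun z => (M z).det) z₀ :=
      (HasMatDerivAt.differentiableAt_det fun i j =>
        (hM z₀ (Metric.mem_ball_self hε) i j).differentiableAt).continuousAt
    exact hc.eventually_ne (by simp [hM0])
  obtain ⟨δ, hδ, hball⟩ := Metric.eventually_nhds_iff_ball.1 hdet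
  refine ⟨min ε δ, by positivity, (Metric.ball_subset_ball (min_le_left _ _)).trans hεU, M, hM0,
    fun z hz => hM z (Metric.ball_subset_ball (min_le_left _ _) hz),
    fun z hz => hball z (Metric.ball_subset_ball (min_le_right _ _) hz)⟩

/-- The derivative of a polynomial in the matrix entries along the vector field `g ↦ Y g`. -/
def polyLie (Y : Mat N) (p : MvPolynomial (Fin N × Fin N) ℂ) : MvPolynomial (Fin N × Fin N) ℂ :=
  ∑ kl : Fin N × Fin N, (∑ m, MvPolynomial.C (Y kl.1 m) * MvPolynomial.X (m, kl.2)) *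
    MvPolynomial.pderiv kl p

/-- The value of a polynomial in the matrix entries. -/
def polyEval (M : Mat N) (p : MvPolynomial (Fin N × Fin N) ℂ) : ℂ :=
  MvPolynomial.eval (fun kl => M kl.1 kl.2) p

theorem polyEval_polyLie (Y M : Mat N) (p : MvPolynomial (Fin N × Fin N) ℂ) :
    polyEval M (polyLie Y p) = ∑ kl : Fin N × Fin N, (Y * M) kl.1 kl.2 *
      polyEval M (MvPolynomial.pderiv kl p) := by
  simp [polyEval, polyLie, Matrix.mul_apply, map_sum]

theorem polyEval_polyLie_sum {ι : Type*} [Fintype ι] (b : ι → ℂ) (Y : ι → Mat N) (M : Mat N)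
    (p : MvPolynomial (Fin N × Fin N) ℂ) :
    polyEval M (polyLie (∑ l, b l • Y l) p) = ∑ l, b l * polyEval M (polyLie (Y l) p) := by
  simp only [polyEval_polyLie, Finset.sum_mul, Matrix.sum_apply, Finset.mul_sum]
  rw [Finset.sum_comm]
  refine Finset.sum_congr rfl fun l _ => Finset.sum_congr rfl fun kl _ => ?_
  simp [mul_assoc]

theorem hasDerivAt_polyEval {M : ℂ → Mat N} {Y : Mat N} {z : ℂ}
    (hM : HasMatDerivAt M (Y * M z) z) (p : MvPolynomial (Fin N × Fin N) ℂ) :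
    HasDerivAt (fun t => polyEval (M t) p) (polyEval (M z) (polyLie Y p)) z := by
  rw [polyEval_polyLie]
  exact hasDerivAt_eval p fun kl => hM kl.1 kl.2

/-- The polynomials which vanish on the group. -/
def vanishing (G : SimpleGroup N r) : Set (MvPolynomial (Fin N × Fin N) ℂ) :=
  {p | ∀ g : G.grp, polyEval (G.mat g) p = 0}

theorem polyLie_mem_vanishing (Y : G.lie) {p : MvPolynomial (Fin N × Fin N) ℂ}
    (hp : p ∈ vanishing G) : polyLie (Y : Mat N) p ∈ vanishing G := by
  intro g
  have h1 : HasMatDerivAt (fun t : ℂ => G.mat (G.exp (t • Y) * g))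
      ((Y : Mat N) * G.mat (G.exp ((0 : ℂ) • Y) * g)) 0 := by
    have := (G.hasMatDerivAt_mat_exp Y 0).mul (HasMatDerivAt.const (z := 0) (G.mat g))
    simpa using this
  have h2 := hasDerivAt_polyEval h1 p
  have h3 : (fun t : ℂ => polyEval (G.mat (G.exp (t • Y) * g)) p) = fun _ => 0 :=
    funext fun t => hp _
  rw [h3] at h2
  simpa using h2.unique (hasDerivAt_const (0 : ℂ) (0 : ℂ))

/-- A solution of a linear differential equation with coefficients in the Lie algebra stays on the
zero set of the polynomials which vanish on the group. -/
theorem polyEval_eq_zero_of_solution {Y : ℂ → G.lie} {M : ℂ → Mat N} {z₀ : ℂ} {ε : ℝ}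
    (hε : 0 < ε) (hY : ∀ i j, DifferentiableOn ℂ (fun z => (Y z : Mat N) i j) (Metric.ball z₀ ε))
    (hM : ∀ z ∈ Metric.ball z₀ ε, HasMatDerivAt M ((Y z : Mat N) * M z) z) (hM0 : M z₀ = 1)
    {p : MvPolynomial (Fin N × Fin N) ℂ} (hp : p ∈ vanishing G) :
    ∀ z ∈ Metric.ball z₀ ε, polyEval (M z) p = 0 := by
  set B := Metric.ball z₀ ε with hB
  have hBo : IsOpen B := Metric.isOpen_ball
  let bas := Module.finBasis ℂ G.lie
  have hcoord : ∀ l, ∃ ψ : Mat N →ₗ[ℂ] ℂ, ∀ Z : G.lie, ψ (Z : Mat N) = bas.repr Z l := by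
    intro l
    obtain ⟨ψ, hψ⟩ := LinearMap.exists_extend (p := G.lie.toSubmodule) (bas.coord l)
    exact ⟨ψ, fun Z => LinearMap.congr_fun hψ Z⟩
  choose ψ hψ using hcoord
  have hYsum : ∀ z, (Y z : Mat N) = ∑ l, ψ l (Y z : Mat N) • (bas l : Mat N) := by
    intro z
    have := congrArg (fun Z : G.lie => (Z : Mat N)) (bas.sum_repr (Y z))
    simp only [hψ]
    refine this.symm.trans ?_
    exact map_sum G.lie.toSubmodule.subtype _ _
  let gens : Set (ℂ → ℂ) := {φ | ∃ a : ℂ → ℂ, ∃ q ∈ vanishing G, DifferentiableOn ℂ a B ∧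
    φ = fun z => a z * polyEval (M z) q}
  have hone : ∀ q ∈ vanishing G, polyEval (M z₀) q = 0 := fun q hq => by
    rw [hM0, ← G.mat_one]; exact hq 1
  have key : ∀ φ ∈ AddSubmonoid.closure gens, φ z₀ = 0 ∧ DifferentiableOn ℂ φ B ∧
      ∃ φ' ∈ AddSubmonoid.closure gens, ∀ z ∈ B, HasDerivAt φ (φ' z) z := by
    intro φ hφ
    induction hφ using AddSubmonoid.closure_induction with
    | mem φ hφ =>
      obtain ⟨a, q, hq, ha, rfl⟩ := hφ
      have hder : ∀ z ∈ B, HasDerivAt (fun z => a z * polyEval (M z) q)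
          (deriv a z * polyEval (M z) q + ∑ l, (a z * ψ l (Y z : Mat N)) *
            polyEval (M z) (polyLie (bas l : Mat N) q)) z := by
        intro z hz
        have h1 := ((ha.differentiableAt (hBo.mem_nhds hz)).hasDerivAt).mul
          (hasDerivAt_polyEval (hM z hz) q)
        convert! h1 using 2
        rw [hYsum z, polyEval_polyLie_sum, Finset.mul_sum]
        refine Finset.sum_congr rfl fun l _ => ?_
        rw [← hYsum z]; ring
      refine ⟨by simp [hone q hq], fun z hz => (hder z hz).differentiableAt.differentiableWithinAt,
        (fun z => deriv a z * polyEval (M z) q) + ∑ l, (fun z => (a z * ψ l (Y z : Mat N)) *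
            polyEval (M z) (polyLie (bas l : Mat N) q)), ?_, fun z hz => ?_⟩
      · refine add_mem (AddSubmonoid.subset_closure ⟨deriv a, q, hq, ha.deriv hBo, rfl⟩)
          (sum_mem fun l _ => AddSubmonoid.subset_closure
            ⟨_, _, polyLie_mem_vanishing (bas l) hq, ?_, rfl⟩)
        exact ha.mul (differentiableOn_linearMap_mat (ψ l) hY)
      · simpa using hder z hz
    | zero =>
      exact ⟨rfl, differentiableOn_const 0, 0, zero_mem _, fun z _ => hasDerivAt_const z (0 : ℂ)⟩
    | add φ₁ φ₂ _ _ h1 h2 =>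
      obtain ⟨h1, h1', ψ1, hψ1, hd1⟩ := h1
      obtain ⟨h2, h2', ψ2, hψ2, hd2⟩ := h2
      exact ⟨by simp [h1, h2], h1'.add h2', ψ1 + ψ2, add_mem hψ1 hψ2,
        fun z hz => (hd1 z hz).add (hd2 z hz)⟩
  have hiter : ∀ n, ∀ φ ∈ AddSubmonoid.closure gens,
      ∃ φ' ∈ AddSubmonoid.closure gens, ∀ z ∈ B, iteratedDeriv n φ z = φ' z := by
    intro n
    induction n with
    | zero => exact fun φ hφ => ⟨φ, hφ, fun z _ => by simp⟩
    | succ n ih =>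
      intro φ hφ
      obtain ⟨φ', hφ', h⟩ := ih φ hφ
      obtain ⟨-, -, φ'', hφ'', h'⟩ := key φ' hφ'
      refine ⟨φ'', hφ'', fun z hz => ?_⟩
      rw [iteratedDeriv_succ, ← (h' z hz).deriv]
      exact EventuallyEq.deriv_eq (by filter_upwards [hBo.mem_nhds hz] with w hw using h w hw)
  have hmem : (fun z => polyEval (M z) p) ∈ AddSubmonoid.closure gens :=
    AddSubmonoid.subset_closure ⟨fun _ => 1, p, hp, differentiableOn_const _, by simp⟩
  refine eq_zero_of_iteratedDeriv (key _ hmem).2.1 fun n => ?_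
  obtain ⟨φ', hφ', h⟩ := hiter n _ hmem
  rw [h z₀ (Metric.mem_ball_self hε), (key φ' hφ').1]

/-- A holomorphic linear differential equation with coefficients in the Lie algebra has a local
solution in the group. -/
theorem exists_grp_solution {Y : ℂ → G.lie} {U : Set ℂ} (hU : IsOpen U)
    (hY : ∀ i j, DifferentiableOn ℂ (fun z => (Y z : Mat N) i j) U) {z₀ : ℂ} (hz₀ : z₀ ∈ U) :
    ∃ ε > 0, Metric.ball z₀ ε ⊆ U ∧ ∃ F : ℂ → G.grp, F z₀ = 1 ∧
      ∀ z ∈ Metric.ball z₀ ε, HasMatDerivAt (fun t => G.mat (F t)) ((Y z : Mat N) * G.mat (F z)) z := by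
  obtain ⟨ε, hε, hεU, M, hM0, hM, hdet⟩ := exists_mat_solution (A := fun z => (Y z : Mat N)) hU hY hz₀
  obtain ⟨E, hE⟩ := G.zariskiClosed
  have hEv : E ⊆ vanishing G := fun p hp g => (hE (g : GL (Fin N) ℂ)).1 g.2 p hp
  have hmem : ∀ z, ∃ g : G.grp, z ∈ Metric.ball z₀ ε → G.mat g = M z := by
    intro z
    by_cases hz : z ∈ Metric.ball z₀ ε
    · have hu : IsUnit (M z) := (Matrix.isUnit_iff_isUnit_det _).2 (isUnit_iff_ne_zero.2 (hdet z hz))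
      have : hu.unit ∈ G.grp := (hE hu.unit).2 fun p hp =>
        polyEval_eq_zero_of_solution hε (fun i j => (hY i j).mono hεU) hM hM0 (hEv hp) z hz
      exact ⟨⟨hu.unit, this⟩, fun _ => rfl⟩
    · exact ⟨1, fun h => absurd h hz⟩
  choose F hF using hmem
  refine ⟨ε, hε, hεU, F, ?_, fun z hz => ?_⟩
  · apply G.mat_injective
    rw [hF z₀ (Metric.mem_ball_self hε), hM0, G.mat_one]
  · rw [hF z hz]
    refine (hM z hz).congr_of_eventuallyEq ?_
    filter_upwards [Metric.isOpen_ball.mem_nhds hz] with w hw using hF w hw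

end RealOper

end

noncomputable section

namespace RealOper

open Filter Topology

variable {N r : ℕ} {G : SimpleGroup N r} {X : Type*} [TopologicalSpace X] [ChartedSpace ℂ X]
  {J : Type*} {S : SpinAtlas X J}

/-! ### Coordinate changes -/

namespace SpinAtlas

theorem hasDerivAt_transition [IsManifold 𝓘(ℂ) ω X] (S : SpinAtlas X J) {a b : J} {x : X}
    (ha : x ∈ (S.chart a).source) (hb : x ∈ (S.chart b).source) :
    HasDerivAt (fun z => S.chart b ((S.chart a).symm z)) (jac (S.chart a) (S.chart b) x)
      (S.chart a x) := by
  have h1 : ContMDiffAt 𝓘(ℂ) 𝓘(ℂ) ω (S.chart a).symm (S.chart a x) :=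
    (contMDiffOn_symm_of_mem_maximalAtlas (S.chart_mem a)).contMDiffAt
      ((S.chart a).open_target.mem_nhds ((S.chart a).map_source ha))
  have h2 : ContMDiffAt 𝓘(ℂ) 𝓘(ℂ) ω (S.chart b) ((S.chart a).symm (S.chart a x)) := by
    rw [(S.chart a).left_inv ha]
    exact (contMDiffOn_of_mem_maximalAtlas (S.chart_mem b)).contMDiffAt
      ((S.chart b).open_source.mem_nhds hb)
  have h3 := h2.comp _ h1
  rw [contMDiffAt_iff_contDiffAt] at h3
  exact (h3.differentiableAt (by simp)).hasDerivAt

/-- The part of the coordinate domain of the chart `a` whose points lie in the chart `b`. -/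
def overlap (S : SpinAtlas X J) (a b : J) : Set ℂ :=
  (S.chart a).target ∩ (S.chart a).symm ⁻¹' (S.chart b).source

theorem isOpen_overlap (S : SpinAtlas X J) (a b : J) : IsOpen (S.overlap a b) :=
  (S.chart a).symm.isOpen_inter_preimage (S.chart b).open_source

theorem mem_overlap (S : SpinAtlas X J) {a b : J} {x : X}
    (ha : x ∈ (S.chart a).source) (hb : x ∈ (S.chart b).source) : S.chart a x ∈ S.overlap a b :=
  ⟨(S.chart a).map_source ha, by simpa [(S.chart a).left_inv ha] using hb⟩

theorem jac_self (S : SpinAtlas X J) {a : J} {x : X} (ha : x ∈ (S.chart a).source) :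
    jac (S.chart a) (S.chart a) x = 1 := by
  have : (fun z => S.chart a ((S.chart a).symm z)) =ᶠ[𝓝 (S.chart a x)] id := by
    filter_upwards [(S.chart a).open_target.mem_nhds ((S.chart a).map_source ha)] with z hz
    exact (S.chart a).right_inv hz
  rw [jac, this.deriv_eq, deriv_id]

theorem k_ne_zero (S : SpinAtlas X J) {a b : J} {x : X}
    (ha : x ∈ (S.chart a).source) (hb : x ∈ (S.chart b).source) : S.k a b x ≠ 0 := by
  intro h
  have h1 := S.k_cocycle a b a x ⟨⟨ha, hb⟩, ha⟩
  have h2 := S.k_sq a a x ⟨ha, ha⟩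
  rw [← h1, h, S.jac_self ha] at h2
  simp at h2

end SpinAtlas

namespace Oper

variable (χ : Oper G S)

theorem g_self {a : J} {x : X} (ha : x ∈ (S.chart a).source) : χ.g a a x = 1 := by
  have := χ.g_cocycle a a a x ⟨⟨ha, ha⟩, ha⟩
  simpa using this

theorem g_inv {a b : J} {x : X} (ha : x ∈ (S.chart a).source) (hb : x ∈ (S.chart b).source) :
    χ.g b a x * χ.g a b x = 1 := by
  rw [χ.g_cocycle b a b x ⟨⟨hb, ha⟩, hb⟩, χ.g_self hb]

/-! ### Flat frames -/

variable {χ}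

theorem IsFlatFrame.hasMatDerivAt {a : J} {U : Set ℂ} {F : ℂ → G.grp} (hF : χ.IsFlatFrame a U F)
    {z : ℂ} (hz : z ∈ U) : HasMatDerivAt (fun t => G.mat (F t))
      (((-χ.conn a z : G.lie) : Mat N) * G.mat (F z)) z := by
  intro i j
  have := hF z hz i j
  simpa using this

theorem isFlatFrame_of_hasMatDerivAt {a : J} {U : Set ℂ} {F : ℂ → G.grp}
    (hF : ∀ z ∈ U, HasMatDerivAt (fun t => G.mat (F t))
      (((-χ.conn a z : G.lie) : Mat N) * G.mat (F z)) z) : χ.IsFlatFrame a U F := by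
  intro z hz i j
  have := hF z hz i j
  simpa using this

theorem IsFlatFrame.mono {a : J} {U U' : Set ℂ} {F : ℂ → G.grp} (hF : χ.IsFlatFrame a U F)
    (h : U' ⊆ U) : χ.IsFlatFrame a U' F := fun z hz => hF z (h hz)

theorem IsFlatFrame.mul_right {a : J} {U : Set ℂ} {F : ℂ → G.grp} (hF : χ.IsFlatFrame a U F)
    (k : G.grp) : χ.IsFlatFrame a U (fun z => F z * k) := by
  refine isFlatFrame_of_hasMatDerivAt fun z hz => ?_
  have := (hF.hasMatDerivAt hz).mul (HasMatDerivAt.const (z := z) (G.mat k))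
  simpa [mul_assoc] using this

variable (χ) in
theorem exists_flatFrame {a : J} {z₀ : ℂ} (hz₀ : z₀ ∈ (S.chart a).target) (k : G.grp) :
    ∃ ε > 0, Metric.ball z₀ ε ⊆ (S.chart a).target ∧ ∃ F : ℂ → G.grp, F z₀ = k ∧
      χ.IsFlatFrame a (Metric.ball z₀ ε) F := by
  obtain ⟨ε, hε, hsub, F, hF0, hF⟩ := exists_grp_solution (Y := fun z => -χ.conn a z)
    (S.chart a).open_target (fun i j => by simpa using (χ.conn_hol a i j).neg) hz₀
  exact ⟨ε, hε, hsub, fun z => F z * k, by simp [hF0],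
    (isFlatFrame_of_hasMatDerivAt hF).mul_right k⟩

theorem IsFlatFrame.eventuallyEq {a : J} {U U' : Set ℂ} {F F' : ℂ → G.grp}
    (hF : χ.IsFlatFrame a U F) (hF' : χ.IsFlatFrame a U' F') (hU : IsOpen U) (hU' : IsOpen U')
    {z₀ : ℂ} (hz : z₀ ∈ U) (hz' : z₀ ∈ U') (h : F z₀ = F' z₀) : F =ᶠ[𝓝 z₀] F' := by
  obtain ⟨ε, hε, hball⟩ := Metric.isOpen_iff.1 (hU.inter hU') z₀ ⟨hz, hz'⟩
  have hder : ∀ z ∈ Metric.ball z₀ ε,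
      HasMatDerivAt (fun t => (G.mat (F t))⁻¹ * G.mat (F' t)) 0 z := by
    intro z hzb
    have h1 := hF.hasMatDerivAt (hball hzb).1
    have h2 := hF'.hasMatDerivAt (hball hzb).2
    have h3 := (h1.inv (Eventually.of_forall fun t => G.det_mat_ne_zero (F t))).mul h2
    have hu : IsUnit (G.mat (F z)).det := isUnit_iff_ne_zero.2 (G.det_mat_ne_zero (F z))
    convert! h3 using 1
    simp only [← mul_assoc, Matrix.neg_mul]
    rw [mul_assoc _ (G.mat (F z)) (G.mat (F z))⁻¹, Matrix.mul_nonsing_inv _ hu, mul_one,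
      neg_add_cancel]
  have hconst : ∀ z ∈ Metric.ball z₀ ε, (G.mat (F z))⁻¹ * G.mat (F' z) = 1 := by
    intro z hzb
    have h0 : (G.mat (F z₀))⁻¹ * G.mat (F' z₀) = 1 := by
      rw [← h, ← G.mat_inv, G.mat_inv_mul]
    rw [← h0]
    ext i j
    exact (convex_ball z₀ ε).is_const_of_fderivWithin_eq_zero (𝕜 := ℂ)
      (f := fun t => ((G.mat (F t))⁻¹ * G.mat (F' t)) i j)
      (fun w hw => (hder w hw i j).differentiableAt.differentiableWithinAt)
      (fun w hw => by
        rw [fderivWithin_of_isOpen Metric.isOpen_ball hw]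
        have := (hder w hw i j).hasFDerivAt.fderiv
        rw [this]; ext; simp) hzb (Metric.mem_ball_self hε)
  filter_upwards [Metric.ball_mem_nhds z₀ hε] with z hzb
  apply G.mat_injective
  have h1 := hconst z hzb
  rw [← G.mat_inv] at h1
  have := congrArg (G.mat (F z) * ·) h1
  simpa [← mul_assoc, G.mat_mul_inv] using this.symm

/-- A flat frame in one chart gives a flat frame in another. -/
theorem IsFlatFrame.change [IsManifold 𝓘(ℂ) ω X] {b : J} {U : Set ℂ} {F : ℂ → G.grp}
    (hF : χ.IsFlatFrame b U F) (a : J) :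
    χ.IsFlatFrame a (S.overlap a b ∩ {z | S.chart b ((S.chart a).symm z) ∈ U})
      (fun z => χ.g a b ((S.chart a).symm z) * F (S.chart b ((S.chart a).symm z))) := by
  refine isFlatFrame_of_hasMatDerivAt fun z hz => ?_
  obtain ⟨⟨hza, hzb⟩, hzU⟩ := hz
  set x := (S.chart a).symm z with hx
  have hxa : x ∈ (S.chart a).source := (S.chart a).map_target hza
  have hxz : S.chart a x = z := (S.chart a).right_inv hza
  have hτ := S.hasDerivAt_transition hxa hzb
  rw [hxz] at hτ
  have hFd := HasMatDerivAt.comp (hF.hasMatDerivAt hzU) hτ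
  have hg : HasMatDerivAt (fun t => G.mat (χ.g a b ((S.chart a).symm t)))
      (jac (S.chart a) (S.chart b) x • (G.mat (χ.g a b x) * (χ.conn b (S.chart b x) : Mat N)) -
        (χ.conn a z : Mat N) * G.mat (χ.g a b x)) z := by
    have h := χ.conn_gauge a b x ⟨hxa, hzb⟩
    rw [hxz] at h
    rw [← h]
    intro i j
    exact ((χ.g_hol a b i j).differentiableAt
      ((S.isOpen_overlap a b).mem_nhds ⟨hza, hzb⟩)).hasDerivAt
  have h := hg.mul hFd
  simp only [← G.mat_mul] at h
  convert! h using 1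
  rw [← hx]
  simp only [NegMemClass.coe_neg, neg_mul, SimpleGroup.mat_mul, sub_mul, Matrix.smul_mul,
    Matrix.mul_smul, smul_neg, mul_neg, mul_assoc]
  abel

theorem isOpen_change {b : J} {U : Set ℂ} (hU : IsOpen U) (a : J) :
    IsOpen (S.overlap a b ∩ {z | S.chart b ((S.chart a).symm z) ∈ U}) := by
  have : S.overlap a b ∩ {z | S.chart b ((S.chart a).symm z) ∈ U} =
      (S.chart a).target ∩ (S.chart a).symm ⁻¹' ((S.chart b).source ∩ S.chart b ⁻¹' U) := by
    ext z; simp [SpinAtlas.overlap, and_assoc]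
  rw [this]
  exact (S.chart a).symm.isOpen_inter_preimage ((S.chart b).isOpen_inter_preimage hU)

/-! ### Parallel sections along paths -/

/-- A parallel section is given near each parameter, in every chart, by a flat frame. -/
theorem IsParallel.germ [IsManifold 𝓘(ℂ) ω X] {p q : X} {γ : Path p q}
    {y : unitInterval → J → G.grp} (hy : χ.IsParallel γ y) (t₀ : unitInterval) {a : J}
    (ha : γ t₀ ∈ (S.chart a).source) :
    ∃ U : Set ℂ, IsOpen U ∧ U ⊆ (S.chart a).target ∧ S.chart a (γ t₀) ∈ U ∧
      ∃ F : ℂ → G.grp, χ.IsFlatFrame a U F ∧ ∀ᶠ t in 𝓝 t₀, y t a = F (S.chart a (γ t)) := by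
  obtain ⟨b, hb, U, hU, hUt, hmem, F, hF, hev⟩ := hy.2 t₀
  refine ⟨_, isOpen_change hU a, fun z hz => hz.1.1, ⟨S.mem_overlap ha hb, ?_⟩, _, hF.change a, ?_⟩
  · simpa [(S.chart a).left_inv ha] using hmem
  · have h1 : ∀ᶠ t in 𝓝 t₀, γ t ∈ (S.chart a).source ∩ (S.chart b).source :=
      γ.continuous.continuousAt.eventually
        (((S.chart a).open_source.inter (S.chart b).open_source).mem_nhds ⟨ha, hb⟩)
    filter_upwards [hev, h1] with t ht hst
    rw [hy.1 t a b hst, ht, (S.chart a).left_inv hst.1]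

theorem IsParallel.eventually_eq [IsManifold 𝓘(ℂ) ω X] {p q : X} {γ : Path p q}
    {y : unitInterval → J → G.grp} (hy : χ.IsParallel γ y) {t₀ : unitInterval} {a : J}
    (ha : γ t₀ ∈ (S.chart a).source) {U : Set ℂ} (hU : IsOpen U) (hmem : S.chart a (γ t₀) ∈ U)
    {F : ℂ → G.grp} (hF : χ.IsFlatFrame a U F) (h0 : y t₀ a = F (S.chart a (γ t₀))) :
    ∀ᶠ t in 𝓝 t₀, y t a = F (S.chart a (γ t)) := by
  obtain ⟨U', hU', -, hmem', F', hF', hev⟩ := hy.germ t₀ ha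
  have h1 := hF'.eventuallyEq hF hU' hU hmem' hmem (hev.self_of_nhds.symm.trans h0)
  have hc : ContinuousAt (fun t => S.chart a (γ t)) t₀ :=
    ((S.chart a).continuousAt ha).comp γ.continuous.continuousAt
  filter_upwards [hev, hc.eventually h1] with t ht ht'
  rw [ht, ht']

theorem IsParallel.mul_right {p q : X} {γ : Path p q} {y : unitInterval → J → G.grp}
    (hy : χ.IsParallel γ y) (k : G.grp) : χ.IsParallel γ (fun t a => y t a * k) := by
  refine ⟨fun t a b h => by simp only [hy.1 t a b h, mul_assoc], fun t₀ => ?_⟩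
  obtain ⟨a, ha, U, hU, hUt, hmem, F, hF, hev⟩ := hy.2 t₀
  exact ⟨a, ha, U, hU, hUt, hmem, _, hF.mul_right k, hev.mono fun t ht => by simp only [ht]⟩

theorem IsParallel.symm {p q : X} {γ : Path p q} {y : unitInterval → J → G.grp}
    (hy : χ.IsParallel γ y) : χ.IsParallel γ.symm (fun t a => y (unitInterval.symm t) a) := by
  refine ⟨fun t a b h => hy.1 _ a b h, fun t₀ => ?_⟩
  obtain ⟨a, ha, U, hU, hUt, hmem, F, hF, hev⟩ := hy.2 (unitInterval.symm t₀)
  exact ⟨a, ha, U, hU, hUt, hmem, F, hF,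
    unitInterval.continuous_symm.continuousAt.eventually hev⟩

/-- A flat frame gives a parallel section along every path in its domain. -/
theorem IsFlatFrame.isParallel {a : J} {U : Set ℂ} {F : ℂ → G.grp} (hF : χ.IsFlatFrame a U F)
    (hU : IsOpen U) (hUt : U ⊆ (S.chart a).target) {p q : X} {γ : Path p q}
    (hγ : ∀ t, γ t ∈ (S.chart a).source ∧ S.chart a (γ t) ∈ U) :
    χ.IsParallel γ (fun t b => χ.g b a (γ t) * F (S.chart a (γ t))) := by
  refine ⟨fun t b c h => ?_, fun t₀ => ⟨a, (hγ t₀).1, U, hU, hUt, (hγ t₀).2, F, hF,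
    Eventually.of_forall fun t => ?_⟩⟩
  · rw [← mul_assoc, χ.g_cocycle b c a _ ⟨h, (hγ t).1⟩]
  · simp only [χ.g_self (hγ t).1, one_mul]

theorem IsParallel.trans [IsManifold 𝓘(ℂ) ω X] {p q s : X} {γ : Path p q} {γ' : Path q s}
    {y y' : unitInterval → J → G.grp} (hy : χ.IsParallel γ y) (hy' : χ.IsParallel γ' y')
    (h : ∀ a, q ∈ (S.chart a).source → y 1 a = y' 0 a) :
    ∃ y'' : unitInterval → J → G.grp, χ.IsParallel (γ.trans γ') y'' ∧ y'' 0 = y 0 ∧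
      y'' 1 = y' 1 := by
  let A : unitInterval → unitInterval := fun t => Set.projIcc 0 1 zero_le_one (2 * (t : ℝ))
  let B : unitInterval → unitInterval := fun t => Set.projIcc 0 1 zero_le_one (2 * (t : ℝ) - 1)
  have hAc : Continuous A := continuous_projIcc.comp (by fun_prop)
  have hBc : Continuous B := continuous_projIcc.comp (by fun_prop)
  have hγA : ∀ t : unitInterval, (t : ℝ) ≤ 1 / 2 → (γ.trans γ') t = γ (A t) := by
    intro t ht
    rw [Path.trans_apply, dif_pos ht]
    congr 1
    exact (Set.projIcc_of_mem zero_le_one _).symm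
  have hγB : ∀ t : unitInterval, ¬ (t : ℝ) ≤ 1 / 2 → (γ.trans γ') t = γ' (B t) := by
    intro t ht
    rw [Path.trans_apply, dif_neg ht]
    congr 1
    exact (Set.projIcc_of_mem zero_le_one _).symm
  let y'' : unitInterval → J → G.grp := fun t => if (t : ℝ) ≤ 1 / 2 then y (A t) else y' (B t)
  have hyA : ∀ t : unitInterval, (t : ℝ) ≤ 1 / 2 → y'' t = y (A t) := fun t ht => if_pos ht
  have hyB : ∀ t : unitInterval, ¬ (t : ℝ) ≤ 1 / 2 → y'' t = y' (B t) := fun t ht => if_neg ht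
  refine ⟨y'', ⟨fun t a b hab => ?_, fun t₀ => ?_⟩, ?_, ?_⟩
  · by_cases ht : (t : ℝ) ≤ 1 / 2
    · rw [hγA t ht] at hab ⊢
      rw [hyA t ht]
      exact hy.1 _ a b hab
    · rw [hγB t ht] at hab ⊢
      rw [hyB t ht]
      exact hy'.1 _ a b hab
  · rcases lt_trichotomy (t₀ : ℝ) (1 / 2) with ht | ht | ht
    · obtain ⟨a, ha, U, hU, hUt, hmem, F, hF, hev⟩ := hy.2 (A t₀)
      rw [← hγA t₀ ht.le] at ha hmem
      refine ⟨a, ha, U, hU, hUt, hmem, F, hF, ?_⟩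
      have h1 : ∀ᶠ t : unitInterval in 𝓝 t₀, (t : ℝ) < 1 / 2 :=
        continuous_subtype_val.continuousAt.eventually_lt_const ht
      filter_upwards [hAc.continuousAt.eventually hev, h1] with t h2 h3
      rw [hyA t h3.le, hγA t h3.le, h2]
    · have hA1 : A t₀ = 1 := Set.projIcc_of_right_le _ (by rw [ht]; norm_num)
      have hB0 : B t₀ = 0 := Set.projIcc_of_le_left _ (by rw [ht]; norm_num)
      have hq : (γ.trans γ') t₀ = q := by rw [hγA t₀ ht.le, hA1, γ.target]
      obtain ⟨a, ha, U, hU, hUt, hmem, F, hF, hev⟩ := hy.2 1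
      have haq : q ∈ (S.chart a).source := by simpa using ha
      have hmem' : S.chart a q ∈ U := by simpa using hmem
      have hev' : ∀ᶠ t in 𝓝 0, y' t a = F (S.chart a (γ' t)) := by
        refine hy'.eventually_eq (by simpa using haq) hU (by simpa using hmem') hF ?_
        rw [← h a haq, hev.self_of_nhds]; simp
      refine ⟨a, by rwa [hq], U, hU, hUt, by rwa [hq], F, hF, ?_⟩
      have hA : Tendsto A (𝓝 t₀) (𝓝 1) := hA1 ▸ hAc.continuousAt
      have hB : Tendsto B (𝓝 t₀) (𝓝 0) := hB0 ▸ hBc.continuousAt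
      filter_upwards [hA.eventually hev, hB.eventually hev'] with t h1 h2
      by_cases ht : (t : ℝ) ≤ 1 / 2
      · rw [hyA t ht, hγA t ht, h1]
      · rw [hyB t ht, hγB t ht, h2]
    · obtain ⟨a, ha, U, hU, hUt, hmem, F, hF, hev⟩ := hy'.2 (B t₀)
      rw [← hγB t₀ ht.not_ge] at ha hmem
      refine ⟨a, ha, U, hU, hUt, hmem, F, hF, ?_⟩
      have h1 : ∀ᶠ t : unitInterval in 𝓝 t₀, 1 / 2 < (t : ℝ) :=
        continuous_subtype_val.continuousAt.eventually_const_lt ht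
      filter_upwards [hBc.continuousAt.eventually hev, h1] with t h2 h3
      rw [hyB t h3.not_ge, hγB t h3.not_ge, h2]
  · have hA0 : A 0 = 0 := Set.projIcc_of_le_left _ (by simp)
    rw [hyA 0 (by simp), hA0]
  · have hB1 : B 1 = 1 := Set.projIcc_of_right_le _ (by norm_num)
    rw [hyB 1 (by norm_num), hB1]

/-- The parallel sections over the paths which start at `p`, normalized in the chart `a₀`. -/
def Reaches (χ : Oper G S) {p : X} (a₀ : J) (x : X) (y₁ : J → G.grp) : Prop :=
  ∃ γ : Path p x, ∃ y, χ.IsParallel γ y ∧ y 0 a₀ = 1 ∧ y 1 = y₁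

/-- Around each point there is a neighbourhood with a flat frame in which parallel sections can be
continued. -/
theorem exists_reaches_nhds [IsManifold 𝓘(ℂ) ω X] (χ : Oper G S) {p : X} (a₀ : J) {a : J} {U : Set ℂ}
    {F : ℂ → G.grp} (hF : χ.IsFlatFrame a U F) (hU : IsOpen U) (hUt : U ⊆ (S.chart a).target)
    (hconv : Convex ℝ U) {x₁ x₂ : X} (h₁ : x₁ ∈ (S.chart a).source) (h₁U : S.chart a x₁ ∈ U)
    (h₂ : x₂ ∈ (S.chart a).source) (h₂U : S.chart a x₂ ∈ U) {y₁ : J → G.grp}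
    (hy₁ : χ.Reaches (p := p) a₀ x₁ y₁) :
    χ.Reaches (p := p) a₀ x₂
      (fun b => χ.g b a x₂ * (F (S.chart a x₂) * ((F (S.chart a x₁))⁻¹ * y₁ a))) := by
  obtain ⟨γ, y, hy, hy0, rfl⟩ := hy₁
  let c : unitInterval → ℂ := fun t => AffineMap.lineMap (S.chart a x₁) (S.chart a x₂) (t : ℝ)
  have hcU : ∀ t, c t ∈ U := fun t =>
    hconv.segment_subset h₁U h₂U (by
      rw [segment_eq_image_lineMap]; exact ⟨(t : ℝ), t.2, rfl⟩)
  have hcc : Continuous c := AffineMap.lineMap_continuous.comp continuous_subtype_val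
  let δ : Path x₁ x₂ :=
    { toFun := fun t => (S.chart a).symm (c t)
      continuous_toFun := (S.chart a).continuousOn_symm.comp_continuous hcc fun t => hUt (hcU t)
      source' := by simp [c, (S.chart a).left_inv h₁]
      target' := by simp [c, (S.chart a).left_inv h₂] }
  have hδ : ∀ t, δ t = (S.chart a).symm (c t) := fun t => rfl
  have hpar := (hF.mul_right ((F (S.chart a x₁))⁻¹ * y 1 a)).isParallel hU hUt (γ := δ)
    (fun t => by
      rw [hδ]
      exact ⟨(S.chart a).map_target (hUt (hcU t)), by
        rw [(S.chart a).right_inv (hUt (hcU t))]; exact hcU t⟩)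
  obtain ⟨y'', hy'', h0, h1⟩ := hy.trans hpar (fun b hb => by
    simp only [δ.source, mul_inv_cancel_left]
    have := hy.1 1 b a ⟨by simpa using hb, by simpa using h₁⟩
    simpa using this)
  exact ⟨_, y'', hy'', by rw [h0, hy0], by rw [h1]; simp only [δ.target]⟩

/-- On a connected surface, every point can be reached by parallel transport. -/
theorem exists_reaches [IsManifold 𝓘(ℂ) ω X] [ConnectedSpace X] (χ : Oper G S) {p : X} {a₀ : J}
    (hp : p ∈ (S.chart a₀).source) (x : X) : ∃ y₁, χ.Reaches (p := p) a₀ x y₁ := by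
  let R : Set X := {x | ∃ y₁, χ.Reaches (p := p) a₀ x y₁}
  have hloc : ∀ x : X, ∃ V ∈ 𝓝 x, ∀ x₁ ∈ V, ∀ x₂ ∈ V, x₁ ∈ R → x₂ ∈ R := by
    intro x
    obtain ⟨a, ha⟩ := S.cover x
    obtain ⟨ε, hε, hsub, F, -, hF⟩ := χ.exists_flatFrame ((S.chart a).map_source ha) 1
    refine ⟨(S.chart a).source ∩ S.chart a ⁻¹' Metric.ball (S.chart a x) ε,
      ((S.chart a).isOpen_inter_preimage Metric.isOpen_ball).mem_nhds
        ⟨ha, Metric.mem_ball_self hε⟩, fun x₁ h₁ x₂ h₂ hR => ?_⟩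
    obtain ⟨y₁, hy₁⟩ := hR
    exact ⟨_, exists_reaches_nhds χ a₀ hF Metric.isOpen_ball hsub (convex_ball _ _) h₁.1 h₁.2 h₂.1
      h₂.2 hy₁⟩
  have hclopen : IsClopen R := by
    refine ⟨⟨isOpen_iff_mem_nhds.2 fun x hx => ?_⟩, isOpen_iff_mem_nhds.2 fun x hx => ?_⟩
    · obtain ⟨V, hV, h⟩ := hloc x
      exact mem_of_superset hV fun x' hx' hR => hx (h x' hx' x (mem_of_mem_nhds hV) hR)
    · obtain ⟨V, hV, h⟩ := hloc x
      exact mem_of_superset hV fun x' hx' => h x (mem_of_mem_nhds hV) x' hx' hx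
  have hne : R.Nonempty := by
    obtain ⟨ε, hε, hsub, F, hF0, hF⟩ := χ.exists_flatFrame ((S.chart a₀).map_source hp) 1
    refine ⟨p, _, Path.refl p, _, hF.isParallel Metric.isOpen_ball hsub (γ := Path.refl p)
      (fun t => ⟨by simpa using hp, by simpa using hε⟩), ?_, rfl⟩
    simp [χ.g_self hp, hF0]
  have : x ∈ R := by rw [hclopen.eq_univ hne]; trivial
  exact this

/-- Two parallel sections over paths with the same ends differ by a monodromy. -/
theorem Reaches.isMonodromy [IsManifold 𝓘(ℂ) ω X] {p : X} {a₀ : J} {x : X} {y₁ y₂ : J → G.grp}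
    (h₁ : χ.Reaches (p := p) a₀ x y₁)
    (h₂ : χ.Reaches (p := p) a₀ x y₂) {a : J} (ha : x ∈ (S.chart a).source) :
    ∃ γ : Path p p, χ.IsMonodromy a₀ γ ((y₂ a)⁻¹ * y₁ a) := by
  obtain ⟨γ₁, u₁, hu₁, h10, rfl⟩ := h₁
  obtain ⟨γ₂, u₂, hu₂, h20, rfl⟩ := h₂
  have hpar := (hu₂.symm).mul_right ((u₂ 1 a)⁻¹ * u₁ 1 a)
  obtain ⟨y, hy, h0, h1⟩ := hu₁.trans hpar (fun b hb => by
    have e1 := hu₁.1 1 b a ⟨by simpa using hb, by simpa using ha⟩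
    have e2 := hu₂.1 1 b a ⟨by simpa using hb, by simpa using ha⟩
    simp [e1, e2, mul_assoc])
  exact ⟨_, y, hy, by rw [h0, h10], by rw [h1]; simp [h20]⟩

theorem IsMonodromy.inv {p : X} {a : J} {γ : Path p p} {m : G.grp} (h : χ.IsMonodromy a γ m) :
    χ.IsMonodromy a γ.symm m⁻¹ := by
  obtain ⟨y, hy, h0, h1⟩ := h
  exact ⟨_, hy.symm.mul_right m⁻¹, by simp [h1], by simp [h0]⟩

/-- A condition on the fibres which is compatible with the coordinate changes and is locally
constant along flat frames holds at one end of a parallel section if and only if it holds at the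
other. -/
theorem IsParallel.transport [IsManifold 𝓘(ℂ) ω X] {p q : X} {γ : Path p q}
    {y : unitInterval → J → G.grp} (hy : χ.IsParallel γ y) {Q : J → ℂ → G.grp → Prop}
    (hchange : ∀ a b, ∀ x ∈ (S.chart a).source ∩ (S.chart b).source, ∀ k,
      Q a (S.chart a x) (χ.g a b x * k) ↔ Q b (S.chart b x) k)
    (hflat : ∀ a U F, IsOpen U → U ⊆ (S.chart a).target → χ.IsFlatFrame a U F → ∀ z ∈ U,
      ∀ᶠ w in 𝓝 z, (Q a w (F w) ↔ Q a z (F z)))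
    {a b : J} (ha : p ∈ (S.chart a).source) (hb : q ∈ (S.chart b).source) :
    Q a (S.chart a p) (y 0 a) ↔ Q b (S.chart b q) (y 1 b) := by
  let P : unitInterval → Prop := fun t =>
    ∃ a, γ t ∈ (S.chart a).source ∧ Q a (S.chart a (γ t)) (y t a)
  have hP : ∀ t a, γ t ∈ (S.chart a).source → (P t ↔ Q a (S.chart a (γ t)) (y t a)) := by
    intro t a ha
    refine ⟨?_, fun h => ⟨a, ha, h⟩⟩
    rintro ⟨b, hb, h⟩
    rw [hy.1 t a b ⟨ha, hb⟩]
    exact (hchange a b _ ⟨ha, hb⟩ _).2 h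
  have hlc : IsLocallyConstant P := by
    rw [IsLocallyConstant.iff_eventually_eq]
    intro t₀
    obtain ⟨a, ha, U, hU, hUt, hmem, F, hF, hev⟩ := hy.2 t₀
    have hc : ContinuousAt (fun t => S.chart a (γ t)) t₀ :=
      ((S.chart a).continuousAt ha).comp γ.continuous.continuousAt
    have hs : ∀ᶠ t in 𝓝 t₀, γ t ∈ (S.chart a).source :=
      γ.continuous.continuousAt.eventually ((S.chart a).open_source.mem_nhds ha)
    filter_upwards [hev, hs, hc.eventually (hflat a U F hU hUt hF _ hmem)] with t h1 h2 h3
    rw [eq_iff_iff, hP t a h2, hP t₀ a ha, h1, h3, hev.self_of_nhds]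
  have := hlc.apply_eq_of_preconnectedSpace 0 1
  rw [eq_iff_iff, hP 0 a (by simpa using ha), hP 1 b (by simpa using hb)] at this
  simpa using this

end Oper

end RealOper

end

noncomputable section

namespace RealOper

open Filter Topology

/-! ### Sesquilinear pairings depending on a parameter -/

/-- Sesquilinear pairings between `ℂ^d` and `ℂ^d'`. -/
abbrev Pairing (d d' : ℕ) := (Fin d → ℂ) →ₗ[ℂ] (Fin d' → ℂ) →ₗ⋆[ℂ] ℂ

section

variable {d d' : ℕ}

theorem Pairing.apply_eq_sum (B : Pairing d d') (u : Fin d → ℂ) (w : Fin d' → ℂ) :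
    B u w = ∑ i, ∑ j, u i * (starRingEnd ℂ) (w j) * B (Pi.single i 1) (Pi.single j 1) := by
  conv_lhs => rw [pi_eq_sum_univ' u, pi_eq_sum_univ' w]
  simp only [map_sum, map_smul, LinearMap.map_smulₛₗ, LinearMap.sum_apply, LinearMap.smul_apply,
    smul_eq_mul, Finset.mul_sum]
  rw [Finset.sum_comm]
  exact Finset.sum_congr rfl fun i _ => Finset.sum_congr rfl fun j _ => by ring

theorem Pairing.ext_single {B B' : Pairing d d'}
    (h : ∀ i j, B (Pi.single i 1) (Pi.single j 1) = B' (Pi.single i 1) (Pi.single j 1)) :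
    B = B' := by
  ext u w
  simp only [LinearMap.comp_apply, LinearMap.single_apply]
  rw [B.apply_eq_sum, B'.apply_eq_sum]
  simp only [h]

/-- The pairing with a given matrix of coefficients. -/
def Pairing.ofMatrix (b : Fin d → Fin d' → ℂ) : Pairing d d' :=
  LinearMap.mk₂'ₛₗ (RingHom.id ℂ) (starRingEnd ℂ)
    (fun u w => ∑ i, ∑ j, u i * (starRingEnd ℂ) (w j) * b i j)
    (fun u u' w => by simp [add_mul, Finset.sum_add_distrib])
    (fun c u w => by simp [Finset.mul_sum, mul_assoc])
    (fun u w w' => by simp [mul_add, add_mul, Finset.sum_add_distrib])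
    (fun c u w => by
      simp only [Pi.smul_apply, smul_eq_mul, map_mul, Finset.mul_sum]
      exact Finset.sum_congr rfl fun i _ => Finset.sum_congr rfl fun j _ => by ring)

theorem Pairing.ofMatrix_apply (b : Fin d → Fin d' → ℂ) (u : Fin d → ℂ) (w : Fin d' → ℂ) :
    Pairing.ofMatrix b u w = ∑ i, ∑ j, u i * (starRingEnd ℂ) (w j) * b i j := rfl

/-- The pairing transported by a pair of matrices. -/
def Pairing.pull (B : Pairing d d') (K : Mat d) (L : Mat d') : Pairing d d' :=
  LinearMap.mk₂'ₛₗ (RingHom.id ℂ) (starRingEnd ℂ) (fun u w => B (K *ᵥ u) (L *ᵥ w))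
    (fun u u' w => by simp [Matrix.mulVec_add])
    (fun c u w => by simp [Matrix.mulVec_smul])
    (fun u w w' => by simp [Matrix.mulVec_add])
    (fun c u w => by simp [Matrix.mulVec_smul])

@[simp] theorem Pairing.pull_apply (B : Pairing d d') (K : Mat d) (L : Mat d') (u : Fin d → ℂ)
    (w : Fin d' → ℂ) : B.pull K L u w = B (K *ᵥ u) (L *ᵥ w) := rfl

theorem hasDerivAt_real {f : ℂ → ℂ} {f' z : ℂ} (h : HasDerivAt f f' z) : DifferentiableAt ℝ f z :=
  h.differentiableAt.restrictScalars ℝ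

section Derivative

variable {B : ℂ → Pairing d d'} {z : ℂ} {u : ℂ → Fin d → ℂ} {u' : Fin d → ℂ}
  {w : ℂ → Fin d' → ℂ} {w' : Fin d' → ℂ}

theorem differentiableAt_pairing (hB : ∀ v x, DifferentiableAt ℝ (fun t => B t v x) z)
    (hu : HasDerivAt u u' z) (hw : HasDerivAt w w' z) :
    DifferentiableAt ℝ (fun t => B t (u t) (w t)) z := by
  rw [funext fun t => (B t).apply_eq_sum (u t) (w t)]
  refine DifferentiableAt.fun_sum fun i _ => DifferentiableAt.fun_sum fun j _ => ?_
  exact ((hasDerivAt_real (hasDerivAt_pi.1 hu i)).mul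
    (differentiableAt_conj (hasDerivAt_real (hasDerivAt_pi.1 hw j)))).mul (hB _ _)

theorem dz_pairing (hB : ∀ v x, DifferentiableAt ℝ (fun t => B t v x) z) {A : Mat d}
    (hA : ∀ v x, dz (fun t => B t v x) z = B z (A *ᵥ v) x)
    (hu : HasDerivAt u u' z) (hw : HasDerivAt w w' z) :
    dz (fun t => B t (u t) (w t)) z = B z (u' + A *ᵥ u z) (w z) := by
  have hui : ∀ i, DifferentiableAt ℝ (fun t => u t i) z := fun i =>
    hasDerivAt_real (hasDerivAt_pi.1 hu i)
  have hwj : ∀ j, DifferentiableAt ℝ (fun t => (starRingEnd ℂ) (w t j)) z := fun j =>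
    differentiableAt_conj (hasDerivAt_real (hasDerivAt_pi.1 hw j))
  have e1 : B z (A *ᵥ u z) (w z) = ∑ i, ∑ j, u z i * (starRingEnd ℂ) (w z j) *
      B z (A *ᵥ Pi.single i 1) (Pi.single j 1) := by
    have := ((B z).pull A 1).apply_eq_sum (u z) (w z)
    simpa only [Pairing.pull_apply, Matrix.one_mulVec] using this
  rw [map_add, LinearMap.add_apply, e1, (B z).apply_eq_sum u' (w z),
    funext fun t => (B t).apply_eq_sum (u t) (w t),
    dz_sum _ fun i _ => DifferentiableAt.fun_sum fun j _ => ((hui i).fun_mul (hwj j)).fun_mul (hB _ _),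
    ← Finset.sum_add_distrib]
  refine Finset.sum_congr rfl fun i _ => ?_
  rw [dz_sum _ fun j _ => ((hui i).fun_mul (hwj j)).fun_mul (hB _ _), ← Finset.sum_add_distrib]
  refine Finset.sum_congr rfl fun j _ => ?_
  rw [dz_mul ((hui i).fun_mul (hwj j)) (hB _ _), dz_mul (hui i) (hwj j),
    dz_of_hasDerivAt (hasDerivAt_pi.1 hu i), dz_conj_of_hasDerivAt (hasDerivAt_pi.1 hw j), hA]
  ring

theorem dzbar_pairing (hB : ∀ v x, DifferentiableAt ℝ (fun t => B t v x) z) {A : Mat d'}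
    (hA : ∀ v x, dzbar (fun t => B t v x) z = B z v (A *ᵥ x))
    (hu : HasDerivAt u u' z) (hw : HasDerivAt w w' z) :
    dzbar (fun t => B t (u t) (w t)) z = B z (u z) (w' + A *ᵥ w z) := by
  have hui : ∀ i, DifferentiableAt ℝ (fun t => u t i) z := fun i =>
    hasDerivAt_real (hasDerivAt_pi.1 hu i)
  have hwj : ∀ j, DifferentiableAt ℝ (fun t => (starRingEnd ℂ) (w t j)) z := fun j =>
    differentiableAt_conj (hasDerivAt_real (hasDerivAt_pi.1 hw j))
  have e1 : B z (u z) (A *ᵥ w z) = ∑ i, ∑ j, u z i * (starRingEnd ℂ) (w z j) *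
      B z (Pi.single i 1) (A *ᵥ Pi.single j 1) := by
    have := ((B z).pull 1 A).apply_eq_sum (u z) (w z)
    simpa only [Pairing.pull_apply, Matrix.one_mulVec] using this
  rw [map_add, e1, (B z).apply_eq_sum (u z) w',
    funext fun t => (B t).apply_eq_sum (u t) (w t),
    dzbar_sum _ fun i _ => DifferentiableAt.fun_sum fun j _ => ((hui i).fun_mul (hwj j)).fun_mul (hB _ _),
    ← Finset.sum_add_distrib]
  refine Finset.sum_congr rfl fun i _ => ?_
  rw [dzbar_sum _ fun j _ => ((hui i).fun_mul (hwj j)).fun_mul (hB _ _), ← Finset.sum_add_distrib]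
  refine Finset.sum_congr rfl fun j _ => ?_
  rw [dzbar_mul ((hui i).fun_mul (hwj j)) (hB _ _), dzbar_mul (hui i) (hwj j),
    dzbar_of_hasDerivAt (hasDerivAt_pi.1 hu i), dzbar_conj_of_hasDerivAt (hasDerivAt_pi.1 hw j), hA]
  ring

end Derivative

theorem contDiffOn_real {f : ℂ → ℂ} {U : Set ℂ} (hU : IsOpen U) (hf : DifferentiableOn ℂ f U) :
    ContDiffOn ℝ ∞ f U :=
  (hf.contDiffOn hU).restrict_scalars ℝ

theorem contDiffOn_conj {f : ℂ → ℂ} {U : Set ℂ} (hf : ContDiffOn ℝ ∞ f U) :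
    ContDiffOn ℝ ∞ (fun t => (starRingEnd ℂ) (f t)) U :=
  Complex.conjCLE.contDiff.comp_contDiffOn hf

theorem contDiffOn_pairing {U : Set ℂ} (hU : IsOpen U) (B : Pairing d d') {u : ℂ → Fin d → ℂ}
    {w : ℂ → Fin d' → ℂ} (hu : DifferentiableOn ℂ u U) (hw : DifferentiableOn ℂ w U) :
    ContDiffOn ℝ ∞ (fun t => B (u t) (w t)) U := by
  rw [funext fun t => B.apply_eq_sum (u t) (w t)]
  refine ContDiffOn.sum fun i _ => ContDiffOn.sum fun j _ => ?_
  exact ((contDiffOn_real hU (differentiableOn_pi.1 hu i)).mul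
    (contDiffOn_conj (contDiffOn_real hU (differentiableOn_pi.1 hw j)))).mul contDiffOn_const

end

variable {N r : ℕ} {G : SimpleGroup N r} {X : Type*} [TopologicalSpace X] [ChartedSpace ℂ X]
  {J : Type*} {S : SpinAtlas X J} {d d' : ℕ} {lam mu : Fin r → ℕ}

namespace Oper

variable {χ : Oper G S} {V : HighestWeightRep G d lam} {W : HighestWeightRep G d' mu}

/-! ### Flat frames of the associated vector bundles -/

theorem differential_neg_conn (χ : Oper G S) (V : HighestWeightRep G d lam) (a : J) (z : ℂ) :
    differential V.rep (-χ.conn a z) = -χ.connV V a z := by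
  have := V.isAlgebraicRep.differential_smul (-1) (χ.conn a z)
  rw [connV]
  simpa using this

theorem IsFlatFrame.rep {a : J} {U : Set ℂ} {F : ℂ → G.grp} (hF : χ.IsFlatFrame a U F)
    (V : HighestWeightRep G d lam) {z : ℂ} (hz : z ∈ U) :
    HasMatDerivAt (fun t => (V.rep (F t) : Mat d)) (-χ.connV V a z * (V.rep (F z) : Mat d)) z := by
  rw [← differential_neg_conn]
  exact V.isAlgebraicRep.hasMatDerivAt (hF.hasMatDerivAt hz)

theorem IsFlatFrame.rep_inv {a : J} {U : Set ℂ} {F : ℂ → G.grp} (hF : χ.IsFlatFrame a U F)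
    (V : HighestWeightRep G d lam) {z : ℂ} (hz : z ∈ U) :
    HasMatDerivAt (fun t => (V.rep (F t)⁻¹ : Mat d)) ((V.rep (F z)⁻¹ : Mat d) * χ.connV V a z) z := by
  have h := (hF.rep V hz).inv (Eventually.of_forall fun t => det_rep_ne_zero V.rep (F t))
  simp only [← RealOper.rep_inv] at h
  convert! h using 1
  rw [← mul_assoc, mul_assoc, rep_mul_inv]
  simp

theorem IsFlatFrame.differentiableOn_rep_inv {a : J} {U : Set ℂ} {F : ℂ → G.grp}
    (hF : χ.IsFlatFrame a U F) (V : HighestWeightRep G d lam) (v : Fin d → ℂ) :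
    DifferentiableOn ℂ (fun t => (V.rep (F t)⁻¹ : Mat d) *ᵥ v) U := fun z hz =>
  ((hF.rep_inv V hz).mulVec (hasDerivAt_const z v)).differentiableAt.differentiableWithinAt

/-- The pairing is constant in flat frames. -/
structure IsLocallyFlat (χ : Oper G S) (V : HighestWeightRep G d lam)
    (W : HighestWeightRep G d' mu) (h : J → ℂ → Pairing d d') : Prop where
  compat : ∀ a b, ∀ x ∈ (S.chart a).source ∩ (S.chart b).source, ∀ v w,
    h a (S.chart a x) ((V.rep (χ.g a b x) : Mat d) *ᵥ v) ((W.rep (χ.g a b x) : Mat d') *ᵥ w) =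
      h b (S.chart b x) v w
  flat : ∀ a U F, IsOpen U → U ⊆ (S.chart a).target → χ.IsFlatFrame a U F → ∀ z ∈ U,
    ∀ᶠ t in 𝓝 z, ∀ v w,
      h a t ((V.rep (F t) : Mat d) *ᵥ v) ((W.rep (F t) : Mat d') *ᵥ w) =
        h a z ((V.rep (F z) : Mat d) *ᵥ v) ((W.rep (F z) : Mat d') *ᵥ w)

theorem IsFlatPairing.differentiableAt {h : J → ℂ → Pairing d d'} (hh : χ.IsFlatPairing V W h)
    {a : J} {z : ℂ} (hz : z ∈ (S.chart a).target) (v : Fin d → ℂ) (w : Fin d' → ℂ) :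
    DifferentiableAt ℝ (fun t => h a t v w) z :=
  ((hh.smooth a v w).contDiffAt ((S.chart a).open_target.mem_nhds hz)).differentiableAt (by simp)

theorem IsFlatPairing.isLocallyFlat {h : J → ℂ → Pairing d d'} (hh : χ.IsFlatPairing V W h) :
    χ.IsLocallyFlat V W h := by
  refine ⟨hh.compat, fun a U F hU hUt hF z hz => ?_⟩
  obtain ⟨ε, hε, hball⟩ := Metric.isOpen_iff.1 hU z hz
  filter_upwards [Metric.ball_mem_nhds z hε] with t ht v w
  have hu : ∀ s ∈ Metric.ball z ε, HasDerivAt (fun s => (V.rep (F s) : Mat d) *ᵥ v)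
      ((-χ.connV V a s * (V.rep (F s) : Mat d)) *ᵥ v) s := fun s hs => by
    simpa using (hF.rep V (hball hs)).mulVec (hasDerivAt_const s v)
  have hw : ∀ s ∈ Metric.ball z ε, HasDerivAt (fun s => (W.rep (F s) : Mat d') *ᵥ w)
      ((-χ.connV W a s * (W.rep (F s) : Mat d')) *ᵥ w) s := fun s hs => by
    simpa using (hF.rep W (hball hs)).mulVec (hasDerivAt_const s w)
  refine (convex_ball z ε).is_const_of_fderivWithin_eq_zero (𝕜 := ℝ)
    (f := fun s => h a s ((V.rep (F s) : Mat d) *ᵥ v) ((W.rep (F s) : Mat d') *ᵥ w))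
    (fun s hs => ?_) (fun s hs => ?_) ht (Metric.mem_ball_self hε)
  · exact (differentiableAt_pairing (hh.differentiableAt (hUt (hball hs))) (hu s hs)
      (hw s hs)).differentiableWithinAt
  · rw [fderivWithin_of_isOpen Metric.isOpen_ball hs]
    have hd := hh.differentiableAt (hUt (hball hs))
    refine fderiv_eq_zero_of_dz_of_dzbar ?_ ?_
    · rw [dz_pairing hd (hh.flat a s (hUt (hball hs))) (hu s hs) (hw s hs)]
      simp [Matrix.neg_mulVec]
    · rw [dzbar_pairing hd (hh.flat_conj a s (hUt (hball hs))) (hu s hs) (hw s hs)]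
      simp [Matrix.neg_mulVec]

theorem IsLocallyFlat.eventually_eq {h : J → ℂ → Pairing d d'} (hh : χ.IsLocallyFlat V W h)
    {a : J} {U : Set ℂ} {F : ℂ → G.grp} (hU : IsOpen U) (hUt : U ⊆ (S.chart a).target)
    (hF : χ.IsFlatFrame a U F) {z : ℂ} (hz : z ∈ U) (h1 : F z = 1) :
    ∀ᶠ t in 𝓝 z, ∀ v w,
      h a t v w = h a z ((V.rep (F t)⁻¹ : Mat d) *ᵥ v) ((W.rep (F t)⁻¹ : Mat d') *ᵥ w) := by
  filter_upwards [hh.flat a U F hU hUt hF z hz] with t ht v w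
  have := ht ((V.rep (F t)⁻¹ : Mat d) *ᵥ v) ((W.rep (F t)⁻¹ : Mat d') *ᵥ w)
  rw [Matrix.mulVec_mulVec, Matrix.mulVec_mulVec, rep_mul_inv, rep_mul_inv, h1] at this
  simpa using this

theorem IsLocallyFlat.isFlatPairing {h : J → ℂ → Pairing d d'} (hh : χ.IsLocallyFlat V W h)
    (hn : ∀ a, ∀ z ∈ (S.chart a).target, (h a z).Nondegenerate) : χ.IsFlatPairing V W h := by
  have key : ∀ a, ∀ z ∈ (S.chart a).target, ∀ v w,
      ContDiffAt ℝ ∞ (fun t => h a t v w) z ∧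
      dz (fun t => h a t v w) z = h a z (χ.connV V a z *ᵥ v) w ∧
      dzbar (fun t => h a t v w) z = h a z v (χ.connV W a z *ᵥ w) := by
    intro a z hz v w
    obtain ⟨ε, hε, hsub, F, hF1, hF⟩ := χ.exists_flatFrame hz 1
    have hzb := Metric.mem_ball_self (x := z) hε
    have hev : (fun t => h a t v w) =ᶠ[𝓝 z] fun t => h a z ((V.rep (F t)⁻¹ : Mat d) *ᵥ v)
        ((W.rep (F t)⁻¹ : Mat d') *ᵥ w) :=
      (hh.eventually_eq Metric.isOpen_ball hsub hF hzb hF1).mono fun t ht => ht v w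
    have hu := (hF.rep_inv V hzb).mulVec (hasDerivAt_const z v)
    have hw := (hF.rep_inv W hzb).mulVec (hasDerivAt_const z w)
    have hd : ∀ v x, DifferentiableAt ℝ (fun _ : ℂ => h a z v x) z := fun v x =>
      differentiableAt_const _
    refine ⟨?_, ?_, ?_⟩
    · refine ContDiffAt.congr_of_eventuallyEq ?_ hev
      exact (contDiffOn_pairing Metric.isOpen_ball (h a z) (hF.differentiableOn_rep_inv V v)
        (hF.differentiableOn_rep_inv W w)).contDiffAt (Metric.ball_mem_nhds z hε)
    · rw [dz_congr hev, dz_pairing (B := fun _ => h a z) (A := 0) hd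
        (fun v x => by simp [dz_const]) hu hw]
      simp [hF1]
    · rw [dzbar_congr hev, dzbar_pairing (B := fun _ => h a z) (A := 0) hd
        (fun v x => by simp [dzbar]) hu hw]
      simp [hF1]
  exact ⟨fun a v w z hz => (key a z hz v w).1.contDiffWithinAt, hh.compat,
    fun a z hz v w => (key a z hz v w).2.1, fun a z hz v w => (key a z hz v w).2.2, hn⟩

/-- A flat pairing is invariant under the monodromy. -/
theorem IsLocallyFlat.monodromy [IsManifold 𝓘(ℂ) ω X] {h : J → ℂ → Pairing d d'}
    (hh : χ.IsLocallyFlat V W h) {p : X} {a : J} (ha : p ∈ (S.chart a).source) {γ : Path p p}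
    {m : G.grp} (hm : χ.IsMonodromy a γ m) (v : Fin d → ℂ) (w : Fin d' → ℂ) :
    h a (S.chart a p) ((V.rep m : Mat d) *ᵥ v) ((W.rep m : Mat d') *ᵥ w) =
      h a (S.chart a p) v w := by
  obtain ⟨y, hy, h0, h1⟩ := hm
  have := hy.transport
    (Q := fun b z k => h b z ((V.rep k : Mat d) *ᵥ v) ((W.rep k : Mat d') *ᵥ w) =
      h a (S.chart a p) v w)
    (fun b c x hx k => by
      rw [rep_mul, rep_mul, ← Matrix.mulVec_mulVec, ← Matrix.mulVec_mulVec, hh.compat b c x hx])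
    (fun b U F hU hUt hF z hz => (hh.flat b U F hU hUt hF z hz).mono fun t ht => by rw [ht v w])
    ha ha
  rw [h0, h1] at this
  exact this.1 (by simp)

/-- Flat pairings which agree at one point agree everywhere. -/
theorem IsLocallyFlat.eq_of_eq [IsManifold 𝓘(ℂ) ω X] [ConnectedSpace X]
    {h h' : J → ℂ → Pairing d d'} (hh : χ.IsLocallyFlat V W h) (hh' : χ.IsLocallyFlat V W h')
    {p : X} {a₀ : J} (hp : p ∈ (S.chart a₀).source)
    (heq : h a₀ (S.chart a₀ p) = h' a₀ (S.chart a₀ p)) (a : J) {z : ℂ}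
    (hz : z ∈ (S.chart a).target) : h a z = h' a z := by
  obtain ⟨y₁, γ, y, hy, h0, h1⟩ := χ.exists_reaches hp ((S.chart a).symm z)
  have := hy.transport
    (Q := fun b z k => ∀ v w, h b z ((V.rep k : Mat d) *ᵥ v) ((W.rep k : Mat d') *ᵥ w) =
      h' b z ((V.rep k : Mat d) *ᵥ v) ((W.rep k : Mat d') *ᵥ w))
    (fun b c x hx k => by
      simp only [rep_mul, ← Matrix.mulVec_mulVec, hh.compat b c x hx, hh'.compat b c x hx])
    (fun b U F hU hUt hF z hz => by
      filter_upwards [hh.flat b U F hU hUt hF z hz, hh'.flat b U F hU hUt hF z hz] with t ht ht'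
      simp only [ht, ht'])
    hp ((S.chart a).map_target hz)
  have h2 := this.1 (fun v w => by rw [heq])
  rw [(S.chart a).right_inv hz] at h2
  refine LinearMap.ext fun v => LinearMap.ext fun w => ?_
  have h3 := h2 ((V.rep (y 1 a)⁻¹ : Mat d) *ᵥ v) ((W.rep (y 1 a)⁻¹ : Mat d') *ᵥ w)
  simpa only [Matrix.mulVec_mulVec, rep_mul_inv, Matrix.one_mulVec] using h3

theorem IsLocallyFlat.smul {h : J → ℂ → Pairing d d'} (hh : χ.IsLocallyFlat V W h) (c : ℂ) :
    χ.IsLocallyFlat V W (fun a z => c • h a z) := by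
  refine ⟨fun a b x hx v w => ?_, fun a U F hU hUt hF z hz => ?_⟩
  · simp only [LinearMap.smul_apply, hh.compat a b x hx]
  · filter_upwards [hh.flat a U F hU hUt hF z hz] with t ht v w
    simp only [LinearMap.smul_apply, ht v w]

/-- A pairing at one point which is invariant under the monodromy extends to a flat pairing. -/
theorem exists_isLocallyFlat [IsManifold 𝓘(ℂ) ω X] [ConnectedSpace X] (χ : Oper G S)
    (V : HighestWeightRep G d lam) (W : HighestWeightRep G d' mu) {p : X} {a₀ : J}
    (hp : p ∈ (S.chart a₀).source) (B : Pairing d d') (hB : ∀ γ m, χ.IsMonodromy (p := p) a₀ γ m →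
      ∀ v w, B ((V.rep m : Mat d) *ᵥ v) ((W.rep m : Mat d') *ᵥ w) = B v w)
    (hn : B.Nondegenerate) : ∃ h : J → ℂ → Pairing d d', χ.IsLocallyFlat V W h ∧
      ∀ a, ∀ z ∈ (S.chart a).target, (h a z).Nondegenerate := by
  choose y hy using χ.exists_reaches hp
  have hcompat : ∀ a b x, x ∈ (S.chart a).source ∩ (S.chart b).source →
      y x a = χ.g a b x * y x b := by
    intro a b x hx
    obtain ⟨γ, u, hu, -, hu1⟩ := hy x
    rw [← hu1]
    simpa using hu.1 1 a b (by simpa using hx)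
  let h : J → ℂ → Pairing d d' := fun a z =>
    B.pull (V.rep (y ((S.chart a).symm z) a)⁻¹ : Mat d) (W.rep (y ((S.chart a).symm z) a)⁻¹ : Mat d')
  have hind : ∀ x a, x ∈ (S.chart a).source → ∀ y₁, χ.Reaches (p := p) a₀ x y₁ → ∀ v w,
      B ((V.rep (y x a)⁻¹ : Mat d) *ᵥ v) ((W.rep (y x a)⁻¹ : Mat d') *ᵥ w) =
        B ((V.rep (y₁ a)⁻¹ : Mat d) *ᵥ v) ((W.rep (y₁ a)⁻¹ : Mat d') *ᵥ w) := by
    intro x a hx y₁ hy₁ v w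
    obtain ⟨γ, hγ⟩ := hy₁.isMonodromy (hy x) hx
    rw [← hB γ _ hγ ((V.rep (y₁ a)⁻¹ : Mat d) *ᵥ v), Matrix.mulVec_mulVec, Matrix.mulVec_mulVec,
      ← rep_mul, ← rep_mul, mul_assoc, mul_inv_cancel, mul_one]
  refine ⟨h, ⟨fun a b x hx v w => ?_, fun a U F hU hUt hF z hz => ?_⟩, fun a z hz => ?_⟩
  · simp only [h, Pairing.pull_apply, (S.chart a).left_inv hx.1, (S.chart b).left_inv hx.2,
      hcompat a b x hx, Matrix.mulVec_mulVec, ← rep_mul]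
    simp only [mul_inv_rev, inv_mul_cancel_right]
  · obtain ⟨ε, hε, hball⟩ := Metric.isOpen_iff.1 hU z hz
    filter_upwards [Metric.ball_mem_nhds z hε] with t ht v w
    have hzt := hUt hz
    have htt := hUt (hball ht)
    have hr := exists_reaches_nhds χ a₀ (hF.mono hball) Metric.isOpen_ball (hball.trans hUt)
      (convex_ball z ε) ((S.chart a).map_target hzt)
      (by rw [(S.chart a).right_inv hzt]; exact Metric.mem_ball_self hε)
      ((S.chart a).map_target htt) (by rw [(S.chart a).right_inv htt]; exact ht)
      (hy ((S.chart a).symm z))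
    simp only [h, Pairing.pull_apply]
    rw [hind _ a ((S.chart a).map_target htt) _ hr]
    simp only [χ.g_self ((S.chart a).map_target htt), (S.chart a).right_inv hzt,
      (S.chart a).right_inv htt, Matrix.mulVec_mulVec, ← rep_mul, one_mul]
    simp only [mul_inv_rev, inv_inv, inv_mul_cancel_right]
  · refine ⟨fun v hv => ?_, fun w hw => ?_⟩
    · have h1 : (V.rep (y ((S.chart a).symm z) a)⁻¹ : Mat d) *ᵥ v = 0 := hn.1 _ fun w => by
        have := hv ((W.rep (y ((S.chart a).symm z) a) : Mat d') *ᵥ w)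
        simpa only [h, Pairing.pull_apply, Matrix.mulVec_mulVec, rep_inv_mul, Matrix.one_mulVec]
          using this
      have h2 := congrArg ((V.rep (y ((S.chart a).symm z) a) : Mat d) *ᵥ ·) h1
      simpa only [Matrix.mulVec_mulVec, rep_mul_inv, Matrix.one_mulVec, Matrix.mulVec_zero] using h2
    · have h1 : (W.rep (y ((S.chart a).symm z) a)⁻¹ : Mat d') *ᵥ w = 0 := hn.2 _ fun v => by
        have := hw ((V.rep (y ((S.chart a).symm z) a) : Mat d) *ᵥ v)
        simpa only [h, Pairing.pull_apply, Matrix.mulVec_mulVec, rep_inv_mul, Matrix.one_mulVec]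
          using this
      have h2 := congrArg ((W.rep (y ((S.chart a).symm z) a) : Mat d') *ᵥ ·) h1
      simpa only [Matrix.mulVec_mulVec, rep_mul_inv, Matrix.one_mulVec, Matrix.mulVec_zero] using h2

end Oper

end RealOper

end

noncomputable section

namespace RealOper

open Filter Topology

/-! ### Holonomic systems with a given space of solutions -/

section Iterate

variable {U : Set ℂ} {f g : ℂ → ℂ}

theorem iterate_dz_congr (hU : IsOpen U) (h : ∀ z ∈ U, f z = g z) (n : ℕ) :
    ∀ z ∈ U, dz^[n] f z = dz^[n] g z := by
  induction n with
  | zero => simpa using h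
  | succ n ih =>
    intro z hz
    rw [Function.iterate_succ_apply', Function.iterate_succ_apply']
    exact dz_congr (by filter_upwards [hU.mem_nhds hz] with w hw using ih w hw)

theorem iterate_dzbar_congr (hU : IsOpen U) (h : ∀ z ∈ U, f z = g z) (n : ℕ) :
    ∀ z ∈ U, dzbar^[n] f z = dzbar^[n] g z := by
  induction n with
  | zero => simpa using h
  | succ n ih =>
    intro z hz
    rw [Function.iterate_succ_apply', Function.iterate_succ_apply']
    exact dzbar_congr (by filter_upwards [hU.mem_nhds hz] with w hw using ih w hw)

theorem contDiffOn_iterate_dz (hU : IsOpen U) (hf : ContDiffOn ℝ ∞ f U) (n : ℕ) :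
    ContDiffOn ℝ ∞ (dz^[n] f) U := by
  induction n with
  | zero => exact hf
  | succ n ih => rw [Function.iterate_succ_apply']; exact contDiffOn_dz hU ih

theorem contDiffOn_iterate_dzbar (hU : IsOpen U) (hf : ContDiffOn ℝ ∞ f U) (n : ℕ) :
    ContDiffOn ℝ ∞ (dzbar^[n] f) U := by
  induction n with
  | zero => exact hf
  | succ n ih => rw [Function.iterate_succ_apply']; exact contDiffOn_dzbar hU ih

theorem differentiableAt_real_of_contDiffOn (hU : IsOpen U) (hf : ContDiffOn ℝ ∞ f U) {z : ℂ}
    (hz : z ∈ U) : DifferentiableAt ℝ f z :=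
  (hf.contDiffAt (hU.mem_nhds hz)).differentiableAt (by simp)

theorem dz_iterate_dzbar (hU : IsOpen U) (hf : ContDiffOn ℝ ∞ f U) (n : ℕ) :
    ∀ z ∈ U, dz (dzbar^[n] f) z = dzbar^[n] (dz f) z := by
  induction n with
  | zero => simp
  | succ n ih =>
    intro z hz
    rw [Function.iterate_succ_apply', Function.iterate_succ_apply',
      dz_dzbar_comm hU (contDiffOn_iterate_dzbar hU hf n) hz]
    exact dzbar_congr (by filter_upwards [hU.mem_nhds hz] with w hw using ih w hw)

theorem iterate_dz_conj (f : ℂ → ℂ) (n : ℕ) :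
    dz^[n] (fun t => (starRingEnd ℂ) (f t)) = fun t => (starRingEnd ℂ) (dzbar^[n] f t) := by
  induction n with
  | zero => rfl
  | succ n ih =>
    rw [Function.iterate_succ_apply', ih, Function.iterate_succ_apply']
    funext t
    rw [conj_dz_conj, Complex.conj_conj]

end Iterate

section Solutions

variable {d d' : ℕ} {U : Set ℂ} {σ : ℂ → Fin d → ℂ} {σ' : ℂ → Fin d' → ℂ}

theorem hasDerivAt_iteratedDeriv (hU : IsOpen U) (hσ : DifferentiableOn ℂ σ U) (k : ℕ) {z : ℂ}
    (hz : z ∈ U) : HasDerivAt (iteratedDeriv k σ) (iteratedDeriv (k + 1) σ z) z := by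
  have : ∀ k, DifferentiableOn ℂ (iteratedDeriv k σ) U := by
    intro k
    induction k with
    | zero => simpa using hσ
    | succ k ih => rw [iteratedDeriv_succ]; exact ih.deriv hU
  rw [iteratedDeriv_succ]
  exact ((this k).differentiableAt (hU.mem_nhds hz)).hasDerivAt

theorem differentiableOn_iteratedDeriv (hU : IsOpen U) (hσ : DifferentiableOn ℂ σ U) (k : ℕ)
    (m : Fin d) : DifferentiableOn ℂ (fun z => iteratedDeriv k σ z m) U := fun _ hz =>
  (hasDerivAt_pi.1 (hasDerivAt_iteratedDeriv hU hσ k hz)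
    m).differentiableAt.differentiableWithinAt

/-- The components of `σ` have no nontrivial linear relation near `z₀`. -/
def IsIndependentAt (σ : ℂ → Fin d → ℂ) (z₀ : ℂ) : Prop :=
  ∀ ℓ : (Fin d → ℂ) →ₗ[ℂ] ℂ, (∀ᶠ z in 𝓝 z₀, ℓ (σ z) = 0) → ℓ = 0

/-- The matrix whose rows are the derivatives of `σ` of the orders `n i`. -/
def derivMatrix (σ : ℂ → Fin d → ℂ) (n : Fin d → ℕ) (z : ℂ) : Mat d :=
  Matrix.of fun i m => iteratedDeriv (n i) σ z m

theorem differentiableAt_derivMatrix (hU : IsOpen U) (hσ : DifferentiableOn ℂ σ U)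
    (n : Fin d → ℕ) {z : ℂ} (hz : z ∈ U) (i j : Fin d) :
    DifferentiableAt ℂ (fun t => derivMatrix σ n t i j) z :=
  (differentiableOn_iteratedDeriv hU hσ (n i) j).differentiableAt (hU.mem_nhds hz)

theorem exists_derivMatrix (hU : IsOpen U) (hσ : DifferentiableOn ℂ σ U) {z₀ : ℂ} (hz₀ : z₀ ∈ U)
    (hind : IsIndependentAt σ z₀) : ∃ n, (derivMatrix σ n z₀).det ≠ 0 := by
  have hspan : Submodule.span ℂ (Set.range fun k => iteratedDeriv k σ z₀) = ⊤ := by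
    by_contra hne
    obtain ⟨ℓ, hℓ0, hℓ⟩ := Submodule.exists_le_ker_of_lt_top _ (lt_top_iff_ne_top.2 hne)
    obtain ⟨ε, hε, hball⟩ := Metric.isOpen_iff.1 hU z₀ hz₀
    have hder : ∀ k, ∀ z ∈ U, iteratedDeriv k (fun t => ℓ (σ t)) z = ℓ (iteratedDeriv k σ z) := by
      intro k
      induction k with
      | zero => intro z _; simp
      | succ k ih =>
        intro z hz
        rw [iteratedDeriv_succ]
        have h1 : iteratedDeriv k (fun t => ℓ (σ t)) =ᶠ[𝓝 z] fun t => ℓ (iteratedDeriv k σ t) := by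
          filter_upwards [hU.mem_nhds hz] with w hw using ih w hw
        rw [h1.deriv_eq]
        exact (ℓ.toContinuousLinearMap.hasFDerivAt.comp_hasDerivAt z
          (hasDerivAt_iteratedDeriv hU hσ k hz)).deriv
    refine hℓ0 (hind ℓ ?_)
    have hdiff : DifferentiableOn ℂ (fun t => ℓ (σ t)) (Metric.ball z₀ ε) :=
      ℓ.toContinuousLinearMap.differentiable.comp_differentiableOn (hσ.mono hball)
    filter_upwards [Metric.ball_mem_nhds z₀ hε] with z hz
    refine eq_zero_of_iteratedDeriv hdiff (fun k => ?_) z hz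
    rw [hder k z₀ hz₀]
    exact hℓ (Submodule.subset_span ⟨k, rfl⟩)
  obtain ⟨f, hf, -, hli⟩ := Submodule.exists_fun_fin_finrank_span_eq ℂ
    (Set.range fun k => iteratedDeriv k σ z₀)
  have hrank : Module.finrank ℂ (Submodule.span ℂ (Set.range fun k => iteratedDeriv k σ z₀)) = d := by
    rw [hspan, finrank_top]; simp
  choose n hn using hf
  refine ⟨fun i => n (Fin.cast hrank.symm i), ?_⟩
  have hli' : LinearIndependent ℂ (derivMatrix σ (fun i => n (Fin.cast hrank.symm i)) z₀).row := by
    have := hli.comp (Fin.cast hrank.symm) (Fin.cast_injective _)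
    have e : (derivMatrix σ (fun i => n (Fin.cast hrank.symm i)) z₀).row =
        f ∘ Fin.cast hrank.symm := funext fun i => hn _
    rw [e]
    exact this
  rw [Matrix.linearIndependent_rows_iff_isUnit, Matrix.isUnit_iff_isUnit_det] at hli'
  exact hli'.ne_zero

theorem eq_zero_of_derivMatrix {n : Fin d → ℕ} {z : ℂ} (hdet : (derivMatrix σ n z).det ≠ 0)
    {x : Fin d → ℂ} (h : ∀ k, iteratedDeriv k σ z ⬝ᵥ x = 0) : x = 0 :=
  Matrix.eq_zero_of_mulVec_eq_zero hdet (funext fun i => h (n i))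

/-- The differential operator `∂^k - ∑ a i ∂^(n i)`. -/
def relationOp {n : Fin d → ℕ} (k : ℕ) (a : Fin d → ℂ → ℂ) (ha : ∀ i, DifferentiableOn ℂ (a i) U) :
    DiffOp U where
  order := k + ∑ i, n i
  coeff m z := (if m = k then 1 else 0) - ∑ i, if m = n i then a i z else 0
  hol m := by
    refine (differentiableOn_const _).sub (DifferentiableOn.fun_sum fun i _ => ?_)
    split_ifs
    · exact ha i
    · exact differentiableOn_const _

theorem relationOp_act {E : Type*} [AddCommGroup E] [Module ℂ E] {n : Fin d → ℕ} (k : ℕ)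
    (a : Fin d → ℂ → ℂ) (ha : ∀ i, DifferentiableOn ℂ (a i) U) (D : (ℂ → E) → (ℂ → E)) (s : ℂ → E)
    (z : ℂ) : (relationOp (n := n) k a ha).act D s z =
      (D^[k] s) z - ∑ i, a i z • (D^[n i] s) z := by
  have hn : ∀ i, n i < k + ∑ i, n i + 1 := fun i => by
    have := Finset.single_le_sum (f := n) (fun i _ => Nat.zero_le _) (Finset.mem_univ i)
    omega
  simp only [DiffOp.act, relationOp, sub_smul, Finset.sum_smul, Finset.sum_sub_distrib, ite_smul,
    one_smul, zero_smul]
  rw [Finset.sum_comm]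
  simp [hn]

/-- A smooth function annihilated by all the holomorphic differential operators which annihilate
`σ` is a combination of the components of `σ`. -/
theorem exists_coefficients (hU : IsOpen U) (hσ : DifferentiableOn ℂ σ U) {n : Fin d → ℕ}
    (hdet : ∀ z ∈ U, (derivMatrix σ n z).det ≠ 0) {Φ : ℂ → ℂ} (hΦ : ContDiffOn ℝ ∞ Φ U)
    (hann : ∀ P : DiffOp U, (∀ z ∈ U, P.act deriv σ z = 0) → ∀ z ∈ U, P.act dz Φ z = 0) :
    ∃ c : ℂ → Fin d → ℂ, (∀ m, ContDiffOn ℝ ∞ (fun z => c z m) U) ∧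
      (∀ k, ∀ z ∈ U, dz^[k] Φ z = iteratedDeriv k σ z ⬝ᵥ c z) ∧
      ∀ m, ∀ z ∈ U, dz (fun z => c z m) z = 0 := by
  have hinv : ∀ i j, DifferentiableOn ℂ (fun z => (derivMatrix σ n z)⁻¹ i j) U := fun i j z hz =>
    (HasMatDerivAt.differentiableAt_inv (differentiableAt_derivMatrix hU hσ n hz) (hdet z hz)
      i j).differentiableWithinAt
  let Ψ : ℂ → Fin d → ℂ := fun z i => dz^[n i] Φ z
  let c : ℂ → Fin d → ℂ := fun z => (derivMatrix σ n z)⁻¹ *ᵥ Ψ z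
  have hc : ∀ m, ContDiffOn ℝ ∞ (fun z => c z m) U := by
    intro m
    simp only [c, Matrix.mulVec, dotProduct, Ψ]
    exact ContDiffOn.sum fun i _ =>
      (contDiffOn_real hU (hinv m i)).mul (contDiffOn_iterate_dz hU hΦ _)
  have hunit : ∀ z ∈ U, IsUnit (derivMatrix σ n z).det := fun z hz =>
    isUnit_iff_ne_zero.2 (hdet z hz)
  have hk : ∀ k, ∀ z ∈ U, dz^[k] Φ z = iteratedDeriv k σ z ⬝ᵥ c z := by
    intro k z hz
    let a : Fin d → ℂ → ℂ := fun i z => (iteratedDeriv k σ z ᵥ* (derivMatrix σ n z)⁻¹) i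
    have ha : ∀ i, DifferentiableOn ℂ (a i) U := by
      intro i
      simp only [a, Matrix.vecMul, dotProduct]
      exact DifferentiableOn.fun_sum fun m _ =>
        (differentiableOn_iteratedDeriv hU hσ k m).mul (hinv m i)
    have h1 := hann (relationOp (n := n) k a ha) (fun z hz => by
      rw [relationOp_act, ← iteratedDeriv_eq_iterate]
      have : ∑ i, a i z • (deriv^[n i] σ) z = (fun i => a i z) ᵥ* derivMatrix σ n z := by
        ext m
        simp [Matrix.vecMul, dotProduct, derivMatrix, iteratedDeriv_eq_iterate]
      rw [this]
      simp only [a]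
      rw [Matrix.vecMul_vecMul, Matrix.nonsing_inv_mul _ (hunit z hz), Matrix.vecMul_one, sub_self])
      z hz
    rw [relationOp_act, sub_eq_zero] at h1
    rw [h1]
    simp only [c]
    rw [Matrix.dotProduct_mulVec]
    rfl
  refine ⟨c, hc, hk, fun m z hz => ?_⟩
  suffices h : (fun m => dz (fun z => c z m) z) = 0 from congrFun h m
  refine eq_zero_of_derivMatrix (hdet z hz) fun k => ?_
  have h1 : dz^[k + 1] Φ z = dz (fun t => ∑ m, iteratedDeriv k σ t m * c t m) z := by
    rw [Function.iterate_succ_apply']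
    exact dz_congr (by filter_upwards [hU.mem_nhds hz] with w hw using hk k w hw)
  have hs := fun m => hasDerivAt_pi.1 (hasDerivAt_iteratedDeriv hU hσ k hz) m
  have hcd := fun m => differentiableAt_real_of_contDiffOn hU (hc m) hz
  rw [hk (k + 1) z hz, dz_sum _ fun m _ => (hasDerivAt_real (hs m)).fun_mul (hcd m)] at h1
  simp only [dz_mul (hasDerivAt_real (hs _)) (hcd _), dz_of_hasDerivAt (hs _),
    Finset.sum_add_distrib] at h1
  simp only [dotProduct] at h1 ⊢
  linear_combination -h1

theorem iterate_dz_dotProduct (hU : IsOpen U) (hσ : DifferentiableOn ℂ σ U) {c : ℂ → Fin d → ℂ}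
    (hc : ∀ m, ContDiffOn ℝ ∞ (fun z => c z m) U)
    (hdz : ∀ m, ∀ z ∈ U, dz (fun z => c z m) z = 0) (k : ℕ) :
    ∀ z ∈ U, dz^[k] (fun t => σ t ⬝ᵥ c t) z = iteratedDeriv k σ z ⬝ᵥ c z := by
  induction k with
  | zero => intro z _; simp
  | succ k ih =>
    intro z hz
    rw [Function.iterate_succ_apply']
    have h1 : dz (dz^[k] fun t => σ t ⬝ᵥ c t) z = dz (fun t => ∑ m, iteratedDeriv k σ t m * c t m) z :=
      dz_congr (by filter_upwards [hU.mem_nhds hz] with w hw using ih w hw)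
    have hs := fun m => hasDerivAt_pi.1 (hasDerivAt_iteratedDeriv hU hσ k hz) m
    have hcd := fun m => differentiableAt_real_of_contDiffOn hU (hc m) hz
    rw [h1, dz_sum _ fun m _ => (hasDerivAt_real (hs m)).fun_mul (hcd m)]
    simp only [dz_mul (hasDerivAt_real (hs _)) (hcd _), dz_of_hasDerivAt (hs _), hdz _ z hz,
      mul_zero, add_zero, dotProduct]

theorem iterate_dzbar_dotProduct (hU : IsOpen U) (hσ : DifferentiableOn ℂ σ U) {c : ℂ → Fin d → ℂ}
    (hc : ∀ m, ContDiffOn ℝ ∞ (fun z => c z m) U) (k : ℕ) :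
    ∀ z ∈ U, dzbar^[k] (fun t => σ t ⬝ᵥ c t) z =
      σ z ⬝ᵥ fun m => dzbar^[k] (fun t => c t m) z := by
  induction k with
  | zero => intro z _; simp
  | succ k ih =>
    intro z hz
    rw [Function.iterate_succ_apply']
    have h1 : dzbar (dzbar^[k] fun t => σ t ⬝ᵥ c t) z =
        dzbar (fun t => ∑ m, σ t m * dzbar^[k] (fun t => c t m) t) z :=
      dzbar_congr (by filter_upwards [hU.mem_nhds hz] with w hw using ih w hw)
    have hs := fun m => hasDerivAt_pi.1 ((hσ.differentiableAt (hU.mem_nhds hz)).hasDerivAt) m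
    have hcd := fun m =>
      differentiableAt_real_of_contDiffOn hU (contDiffOn_iterate_dzbar hU (hc m) k) hz
    rw [h1, dzbar_sum _ fun m _ => (hasDerivAt_real (hs m)).fun_mul (hcd m)]
    simp only [dzbar_mul (hasDerivAt_real (hs _)) (hcd _), dzbar_of_hasDerivAt (hs _),
      zero_mul, zero_add, dotProduct, Function.iterate_succ_apply']

/-- The conjugate of a holomorphic differential operator commutes with `∂/∂z`. -/
theorem actConj_iterate_dz (hU : IsOpen U) {Φ : ℂ → ℂ} (hΦ : ContDiffOn ℝ ∞ Φ U) (P : DiffOp U)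
    (h : ∀ z ∈ U, P.actConj dzbar Φ z = 0) (k : ℕ) :
    ∀ z ∈ U, P.actConj dzbar (dz^[k] Φ) z = 0 := by
  induction k with
  | zero => exact h
  | succ k ih =>
    intro z hz
    have hk := contDiffOn_iterate_dz hU hΦ k
    have hq := fun m => ((P.hol m).differentiableAt (hU.mem_nhds hz)).hasDerivAt
    have hd := fun m => differentiableAt_real_of_contDiffOn hU (contDiffOn_iterate_dzbar hU hk m) hz
    have h1 : dz (fun t => P.actConj dzbar (dz^[k] Φ) t) z = 0 := by
      rw [dz_congr (g := fun _ => 0)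
        (by filter_upwards [hU.mem_nhds hz] with w hw using ih w hw), dz_const]
    simp only [DiffOp.actConj] at h1 ⊢
    rw [dz_sum _ fun m _ => (differentiableAt_conj (hasDerivAt_real (hq m))).fun_mul (hd m)] at h1
    rw [← h1]
    refine Finset.sum_congr rfl fun m _ => ?_
    rw [dz_mul (differentiableAt_conj (hasDerivAt_real (hq m))) (hd m),
      dz_conj_of_hasDerivAt (hq m), zero_mul, zero_add, dz_iterate_dzbar hU hk m z hz,
      Function.iterate_succ_apply']

/-- A smooth function annihilated by the operators which annihilate `σ` and by the conjugates of
those which annihilate `σ'` is, locally, a sesquilinear expression in `σ` and `σ'`. -/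
theorem exists_pairing (hU : IsOpen U) (hσ : DifferentiableOn ℂ σ U)
    (hσ' : DifferentiableOn ℂ σ' U) {n : Fin d → ℕ} {n' : Fin d' → ℕ}
    (hdet : ∀ z ∈ U, (derivMatrix σ n z).det ≠ 0)
    (hdet' : ∀ z ∈ U, (derivMatrix σ' n' z).det ≠ 0) {Φ : ℂ → ℂ} (hΦ : ContDiffOn ℝ ∞ Φ U)
    (hann : ∀ P : DiffOp U, (∀ z ∈ U, P.act deriv σ z = 0) → ∀ z ∈ U, P.act dz Φ z = 0)
    (hann' : ∀ P : DiffOp U, (∀ z ∈ U, P.act deriv σ' z = 0) → ∀ z ∈ U, P.actConj dzbar Φ z = 0)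
    {z₀ : ℂ} (hz₀ : z₀ ∈ U) :
    ∃ B : Pairing d d', ∀ᶠ z in 𝓝 z₀, Φ z = B (σ z) (σ' z) := by
  obtain ⟨c, hc, hk, hdz⟩ := exists_coefficients hU hσ hdet hΦ hann
  have hcann : ∀ P : DiffOp U, (∀ z ∈ U, P.act deriv σ' z = 0) → ∀ m, ∀ z ∈ U,
      P.actConj dzbar (fun t => c t m) z = 0 := by
    intro P hP m z hz
    suffices h : (fun m => P.actConj dzbar (fun t => c t m) z) = 0 from congrFun h m
    refine eq_zero_of_derivMatrix (hdet z hz) fun k => ?_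
    have h1 := actConj_iterate_dz hU hΦ P (hann' P hP) k z hz
    have hkd : DifferentiableOn ℂ (iteratedDeriv k σ) U := fun w hw =>
      (hasDerivAt_iteratedDeriv hU hσ k hw).differentiableAt.differentiableWithinAt
    have h2 : ∀ l, dzbar^[l] (dz^[k] Φ) z =
        iteratedDeriv k σ z ⬝ᵥ fun m => dzbar^[l] (fun t => c t m) z := fun l => by
      rw [iterate_dzbar_congr hU (hk k) l z hz]
      exact iterate_dzbar_dotProduct hU hkd hc l z hz
    simp only [DiffOp.actConj, h2] at h1
    simp only [DiffOp.actConj, dotProduct, Finset.mul_sum] at h1 ⊢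
    rw [Finset.sum_comm, ← h1]
    exact Finset.sum_congr rfl fun _ _ => Finset.sum_congr rfl fun _ _ => by ring
  have hφ : ∀ m, ∃ e : ℂ → Fin d' → ℂ, (∀ j, ContDiffOn ℝ ∞ (fun z => e z j) U) ∧
      (∀ z ∈ U, (starRingEnd ℂ) (c z m) = σ' z ⬝ᵥ e z) ∧
      (∀ j, ∀ z ∈ U, dz (fun z => e z j) z = 0) ∧ ∀ j, ∀ z ∈ U, dzbar (fun z => e z j) z = 0 := by
    intro m
    have hsm : ContDiffOn ℝ ∞ (fun z => (starRingEnd ℂ) (c z m)) U := contDiffOn_conj (hc m)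
    obtain ⟨e, he, hek, hed⟩ := exists_coefficients hU hσ' hdet' hsm (fun P hP z hz => by
      have h1 := congrArg (starRingEnd ℂ) (hcann P hP m z hz)
      simp only [DiffOp.actConj, map_sum, map_mul, Complex.conj_conj, map_zero] at h1
      simp only [DiffOp.act, iterate_dz_conj, smul_eq_mul]
      exact h1)
    refine ⟨e, he, fun z hz => by simpa using hek 0 z hz, hed, fun j z hz => ?_⟩
    suffices h : (fun j => dzbar (fun z => e z j) z) = 0 from congrFun h j
    refine eq_zero_of_derivMatrix (hdet' z hz) fun k => ?_
    have hkd : DifferentiableOn ℂ (iteratedDeriv k σ') U := fun w hw =>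
      (hasDerivAt_iteratedDeriv hU hσ' k hw).differentiableAt.differentiableWithinAt
    have h1 := iterate_dzbar_dotProduct hU hkd he 1 z hz
    simp only [Function.iterate_one] at h1
    rw [← h1, ← dzbar_congr (by filter_upwards [hU.mem_nhds hz] with w hw using hek k w hw)]
    rw [iterate_dz_conj, conj_dz_conj]
    simp only [Complex.conj_conj]
    rw [dz_iterate_dzbar hU (hc m) k z hz, iterate_dzbar_congr hU (hdz m) k z hz]
    have h0 : ∀ k : ℕ, dzbar^[k] (fun _ => (0 : ℂ)) = fun _ => 0 := by
      intro k
      induction k with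
      | zero => rfl
      | succ k ih => rw [Function.iterate_succ_apply', ih]; funext t; simp [dzbar]
    rw [h0, map_zero]
  choose e he heq hedz hedzbar using hφ
  obtain ⟨ε, hε, hball⟩ := Metric.isOpen_iff.1 hU z₀ hz₀
  have hconst : ∀ m j, ∀ z ∈ Metric.ball z₀ ε, e m z j = e m z₀ j := by
    intro m j z hz
    refine (convex_ball z₀ ε).is_const_of_fderivWithin_eq_zero (𝕜 := ℝ) (f := fun z => e m z j)
      (fun w hw => ?_) (fun w hw => ?_) hz (Metric.mem_ball_self hε)
    · exact (differentiableAt_real_of_contDiffOn hU (he m j) (hball hw)).differentiableWithinAt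
    · rw [fderivWithin_of_isOpen Metric.isOpen_ball hw]
      exact fderiv_eq_zero_of_dz_of_dzbar (hedz m j w (hball hw)) (hedzbar m j w (hball hw))
  refine ⟨Pairing.ofMatrix fun m j => (starRingEnd ℂ) (e m z₀ j), ?_⟩
  filter_upwards [Metric.ball_mem_nhds z₀ hε] with z hz
  have h1 := hk 0 z (hball hz)
  simp only [Function.iterate_zero, id, iteratedDeriv_zero] at h1
  rw [h1, Pairing.ofMatrix_apply, dotProduct]
  refine Finset.sum_congr rfl fun m _ => ?_
  have h2 := congrArg (starRingEnd ℂ) (heq m z (hball hz))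
  rw [Complex.conj_conj] at h2
  rw [h2, dotProduct, map_sum, Finset.mul_sum]
  refine Finset.sum_congr rfl fun j _ => ?_
  rw [hconst m j z hz, map_mul]; ring

/-- A sesquilinear expression in independent functions vanishes only if its coefficients do. -/
theorem pairing_eq_zero (hU : IsOpen U) (hσ : DifferentiableOn ℂ σ U)
    (hσ' : DifferentiableOn ℂ σ' U) {z₀ : ℂ} (hz₀ : z₀ ∈ U) (hind : IsIndependentAt σ z₀)
    (hind' : IsIndependentAt σ' z₀) {B : Pairing d d'}
    (h : ∀ᶠ z in 𝓝 z₀, B (σ z) (σ' z) = 0) : B = 0 := by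
  obtain ⟨n, hn⟩ := exists_derivMatrix hU hσ hz₀ hind
  have hdet : ∀ᶠ z in 𝓝 z₀, (derivMatrix σ n z).det ≠ 0 :=
    (HasMatDerivAt.differentiableAt_det
      (differentiableAt_derivMatrix hU hσ n hz₀)).continuousAt.eventually_ne hn
  obtain ⟨ε, hε, hball⟩ := Metric.eventually_nhds_iff_ball.1
    (h.and (hdet.and (hU.mem_nhds hz₀)))
  set U' := Metric.ball z₀ ε
  have hU' : IsOpen U' := Metric.isOpen_ball
  have hsub : U' ⊆ U := fun z hz => (hball z hz).2.2
  let c : ℂ → Fin d → ℂ := fun z m => B (Pi.single m 1) (σ' z)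
  have hBc : ∀ z, B (σ z) (σ' z) = σ z ⬝ᵥ c z := by
    intro z
    conv_lhs => rw [pi_eq_sum_univ' (σ z)]
    simp [dotProduct, c, LinearMap.sum_apply]
  have hc : ∀ m, ContDiffOn ℝ ∞ (fun z => c z m) U' := fun m =>
    contDiffOn_pairing hU' B (differentiableOn_const _) (hσ'.mono hsub)
  have hdz : ∀ m, ∀ z ∈ U', dz (fun z => c z m) z = 0 := fun m z hz => by
    have := dz_pairing (B := fun _ => B) (A := 0) (fun v x => differentiableAt_const _)
      (fun v x => by simp [dz_const]) (hasDerivAt_const z (Pi.single m (1 : ℂ)))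
      ((hσ'.differentiableAt (hU.mem_nhds (hsub hz))).hasDerivAt)
    simpa only [Matrix.zero_mulVec, add_zero, map_zero, LinearMap.zero_apply] using this
  have hc0 : ∀ z ∈ U', c z = 0 := by
    intro z hz
    refine eq_zero_of_derivMatrix (hball z hz).2.1 fun k => ?_
    rw [← iterate_dz_dotProduct hU' (hσ.mono hsub) hc hdz k z hz,
      iterate_dz_congr (g := fun _ => 0) hU' (fun w hw => by rw [← hBc]; exact (hball w hw).1) k z hz]
    have h0 : ∀ k : ℕ, dz^[k] (fun _ => (0 : ℂ)) = fun _ => 0 := by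
      intro k
      induction k with
      | zero => rfl
      | succ k ih => rw [Function.iterate_succ_apply', ih]; funext t; exact dz_const 0
    rw [h0]
  have hrow : ∀ m, (B (Pi.single m 1)) = 0 := by
    intro m
    let ℓ : (Fin d' → ℂ) →ₗ[ℂ] ℂ :=
      { toFun := fun w => (starRingEnd ℂ) (B (Pi.single m 1) w)
        map_add' := fun x y => by simp
        map_smul' := fun a x => by simp }
    have hℓ : ℓ = 0 := hind' ℓ (by
      filter_upwards [Metric.ball_mem_nhds z₀ hε] with z hz
      have := congrFun (hc0 z hz) m
      simpa [ℓ, c] using this)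
    refine LinearMap.ext fun w => ?_
    have := LinearMap.congr_fun hℓ w
    simpa [ℓ] using this
  refine Pairing.ext_single fun i j => ?_
  rw [hrow]; rfl

end Solutions

end RealOper

end

noncomputable section

namespace RealOper

open Filter Topology

variable {N r : ℕ} {G : SimpleGroup N r} {X : Type*} [TopologicalSpace X] [ChartedSpace ℂ X]
  {J : Type*} {S : SpinAtlas X J} {d d' : ℕ} {lam mu : Fin r → ℕ}

/-! ### The action of the Borel subgroup on the highest weight line -/

/-- The scalar by which the cocharacter `2ρ` acts on a highest weight vector. -/
def SimpleGroup.weightFactor (G : SimpleGroup N r) (lam : Fin r → ℕ) (z : ℂ) : ℂ :=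
  Complex.exp (Complex.log z * ((2 * G.rhoPairing lam : ℝ) : ℂ))

theorem SimpleGroup.weightFactor_ne_zero (lam : Fin r → ℕ) (z : ℂ) : G.weightFactor lam z ≠ 0 :=
  Complex.exp_ne_zero _

theorem SimpleGroup.weightFactor_mul_conj (lam : Fin r → ℕ) {z : ℂ} (hz : z ≠ 0) :
    G.weightFactor lam z * (starRingEnd ℂ) (G.weightFactor lam z) =
      (((‖z ^ 2‖ ^ 2) ^ G.rhoPairing lam : ℝ) : ℂ) := by
  have hpos : 0 < ‖z‖ := norm_pos_iff.2 hz
  rw [Complex.mul_conj, Complex.normSq_eq_norm_sq, weightFactor, Complex.norm_exp,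
    Complex.re_mul_ofReal, Complex.log_re, norm_pow,
    Real.rpow_def_of_pos (by positivity), ← Real.exp_nat_mul, Real.log_pow, Real.log_pow]
  congr 2
  push_cast
  ring

namespace HighestWeightRep

theorem nPlus_vec (V : HighestWeightRep G d lam) {Y : G.lie} (hY : Y ∈ G.nPlus) :
    differential V.rep Y *ᵥ V.vec = 0 := by
  induction hY using LieSubalgebra.lieSpan_induction with
  | mem x hx => obtain ⟨i, rfl⟩ := hx; exact V.e_vec i
  | zero => simp [V.isAlgebraicRep.differential_zero]
  | add u w _ _ hu hw => rw [V.isAlgebraicRep.differential_add, Matrix.add_mulVec, hu, hw, add_zero]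
  | smul t u _ hu => rw [V.isAlgebraicRep.differential_smul, Matrix.smul_mulVec, hu, smul_zero]
  | lie u w _ _ hu hw =>
    rw [V.isAlgebraicRep.differential_lie, Matrix.sub_mulVec, ← Matrix.mulVec_mulVec,
      ← Matrix.mulVec_mulVec, hu, hw, Matrix.mulVec_zero, Matrix.mulVec_zero, sub_zero]

theorem unipotent_vec (V : HighestWeightRep G d lam) {u : G.grp} (hu : u ∈ G.unipotent) :
    (V.rep u : Mat d) *ᵥ V.vec = V.vec := by
  induction hu using Subgroup.closure_induction with
  | mem x hx =>
    obtain ⟨Y, hY, rfl⟩ := hx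
    have := V.isAlgebraicRep.exp_mulVec (Y := Y) (v := V.vec) (c := 0)
      (by rw [V.nPlus_vec hY, zero_smul])
    simpa using this
  | one => simp
  | mul x y _ _ hx hy => rw [rep_mul, ← Matrix.mulVec_mulVec, hy, hx]
  | inv x _ hx =>
    conv_lhs => rw [← hx]
    rw [Matrix.mulVec_mulVec, rep_inv_mul, Matrix.one_mulVec]

theorem twoRhoCochar_vec (V : HighestWeightRep G d lam) (z : ℂ) :
    (V.rep (G.twoRhoCochar z) : Mat d) *ᵥ V.vec = G.weightFactor lam z • V.vec := by
  refine V.isAlgebraicRep.exp_mulVec ?_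
  rw [V.isAlgebraicRep.differential_smul, SimpleGroup.twoRho, V.isAlgebraicRep.differential_sum,
    Matrix.smul_mulVec, Matrix.sum_mulVec]
  simp only [V.isAlgebraicRep.differential_smul, Matrix.smul_mulVec, V.h_vec, smul_smul,
    ← Finset.sum_smul]
  congr 2
  simp only [SimpleGroup.rhoPairing]
  push_cast
  rw [Finset.mul_sum]
  exact Finset.sum_congr rfl fun j _ => by ring

end HighestWeightRep

namespace Oper

variable {χ : Oper G S} {V : HighestWeightRep G d lam} {W : HighestWeightRep G d' mu}

theorem rep_g_vec (χ : Oper G S) (V : HighestWeightRep G d lam) {a b : J} {x : X}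
    (hx : x ∈ (S.chart a).source ∩ (S.chart b).source) :
    (V.rep (χ.g a b x) : Mat d) *ᵥ V.vec = G.weightFactor lam (S.k a b x) • V.vec := by
  obtain ⟨u, hu, h⟩ := χ.g_borel a b x hx
  rw [h, rep_mul, ← Matrix.mulVec_mulVec, V.unipotent_vec hu, V.twoRhoCochar_vec]

theorem rep_g_inv_vec (χ : Oper G S) (V : HighestWeightRep G d lam) {a b : J} {x : X}
    (hx : x ∈ (S.chart a).source ∩ (S.chart b).source) :
    (V.rep (χ.g a b x)⁻¹ : Mat d) *ᵥ V.vec = (G.weightFactor lam (S.k a b x))⁻¹ • V.vec := by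
  have h := congrArg ((V.rep (χ.g a b x)⁻¹ : Mat d) *ᵥ ·) (χ.rep_g_vec V hx)
  simp only [Matrix.mulVec_mulVec, rep_inv_mul, Matrix.one_mulVec, Matrix.mulVec_smul] at h
  rw [h, smul_smul, inv_mul_cancel₀ (G.weightFactor_ne_zero _ _), one_smul]
  rw [← h]

/-- A section of `Ω^{-⟨λ,ρ⟩}` transforms as the pairing of two highest weight vectors. -/
theorem omega_factor (S : SpinAtlas X J) (hρ : G.rhoPairing lam = G.rhoPairing mu) {a b : J} {x : X}
    (hx : x ∈ (S.chart a).source ∩ (S.chart b).source) :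
    (((‖jac (S.chart a) (S.chart b) x‖ ^ 2) ^ (-G.rhoPairing lam) : ℝ) : ℂ) =
      (G.weightFactor lam (S.k a b x) * (starRingEnd ℂ) (G.weightFactor mu (S.k a b x)))⁻¹ := by
  have h : G.weightFactor mu (S.k a b x) = G.weightFactor lam (S.k a b x) := by
    rw [SimpleGroup.weightFactor, SimpleGroup.weightFactor, hρ]
  rw [h, G.weightFactor_mul_conj lam (S.k_ne_zero hx.1 hx.2), S.k_sq a b x hx,
    Real.rpow_neg (by positivity), Complex.ofReal_inv]

theorem IsFlatPairing.isOmegaSection {h : J → ℂ → Pairing d d'} (hh : χ.IsFlatPairing V W h)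
    (hρ : G.rhoPairing lam = G.rhoPairing mu) :
    IsOmegaSection S (-G.rhoPairing lam) (pairedSection V W h) := by
  refine ⟨fun a => hh.smooth a V.vec W.vec, fun a b x hx => ?_⟩
  have h1 := hh.compat a b x hx V.vec W.vec
  rw [χ.rep_g_vec V hx, χ.rep_g_vec W hx] at h1
  simp only [map_smul, LinearMap.map_smulₛₗ, LinearMap.smul_apply, smul_eq_mul] at h1
  have h2 := G.weightFactor_ne_zero lam (S.k a b x)
  have h3 : (starRingEnd ℂ) (G.weightFactor mu (S.k a b x)) ≠ 0 :=
    (map_ne_zero _).2 (G.weightFactor_ne_zero mu (S.k a b x))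
  rw [omega_factor S hρ hx]
  simp only [pairedSection, canonicalSection]
  rw [← h1]
  field_simp

/-! ### The canonical section in a flat frame -/

/-- The canonical section in the flat frame `F`. -/
def flatSection (V : HighestWeightRep G d lam) (F : ℂ → G.grp) (z : ℂ) : Fin d → ℂ :=
  (V.rep (F z)⁻¹ : Mat d) *ᵥ V.vec

theorem IsFlatFrame.differentiableOn_flatSection {a : J} {U : Set ℂ} {F : ℂ → G.grp}
    (hF : χ.IsFlatFrame a U F) (V : HighestWeightRep G d lam) :
    DifferentiableOn ℂ (flatSection V F) U := hF.differentiableOn_rep_inv V V.vec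

theorem IsFlatFrame.iterate_nabla {a : J} {U : Set ℂ} {F : ℂ → G.grp} (hF : χ.IsFlatFrame a U F)
    (hU : IsOpen U) (V : HighestWeightRep G d lam) (n : ℕ) : ∀ z ∈ U,
    ((χ.nabla V a)^[n] (canonicalSection V)) z =
      (V.rep (F z) : Mat d) *ᵥ iteratedDeriv n (flatSection V F) z := by
  induction n with
  | zero =>
    intro z _
    simp only [Function.iterate_zero, id, iteratedDeriv_zero, flatSection, canonicalSection,
      Matrix.mulVec_mulVec, rep_mul_inv, Matrix.one_mulVec]
  | succ n ih =>
    intro z hz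
    have h1 : (χ.nabla V a)^[n] (canonicalSection V) =ᶠ[𝓝 z] fun t =>
        (V.rep (F t) : Mat d) *ᵥ iteratedDeriv n (flatSection V F) t := by
      filter_upwards [hU.mem_nhds hz] with w hw using ih w hw
    have h2 := (hF.rep V hz).mulVec
      (hasDerivAt_iteratedDeriv hU (hF.differentiableOn_flatSection V) n hz)
    rw [Function.iterate_succ_apply', nabla, h1.deriv_eq, h2.deriv, ih z hz,
      ← Matrix.mulVec_mulVec, Matrix.neg_mulVec]
    abel

theorem IsFlatFrame.act_nabla {a : J} {U U' : Set ℂ} {F : ℂ → G.grp} (hF : χ.IsFlatFrame a U F)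
    (hU : IsOpen U) (V : HighestWeightRep G d lam) (P : DiffOp U') {z : ℂ} (hz : z ∈ U) :
    P.act (χ.nabla V a) (canonicalSection V) z =
      (V.rep (F z) : Mat d) *ᵥ P.act deriv (flatSection V F) z := by
  simp only [DiffOp.act, hF.iterate_nabla hU V _ z hz, ← iteratedDeriv_eq_iterate]
  rw [← Matrix.mulVecLin_apply, map_sum]
  simp only [map_smul, Matrix.mulVecLin_apply]

theorem IsFlatFrame.act_nabla_eq_zero_iff {a : J} {U U' : Set ℂ} {F : ℂ → G.grp}
    (hF : χ.IsFlatFrame a U F) (hU : IsOpen U) (V : HighestWeightRep G d lam) (P : DiffOp U') {z : ℂ}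
    (hz : z ∈ U) : P.act (χ.nabla V a) (canonicalSection V) z = 0 ↔
      P.act deriv (flatSection V F) z = 0 := by
  rw [hF.act_nabla hU V P hz]
  refine ⟨fun h => Matrix.eq_zero_of_mulVec_eq_zero (det_rep_ne_zero V.rep (F z)) h, fun h => ?_⟩
  rw [h, Matrix.mulVec_zero]

end Oper

section ConstantPairing

variable {U : Set ℂ} {σ : ℂ → Fin d → ℂ} {σ' : ℂ → Fin d' → ℂ}

theorem iterate_dz_pairing (hU : IsOpen U) (hσ : DifferentiableOn ℂ σ U)
    (hσ' : DifferentiableOn ℂ σ' U) (B : Pairing d d') (k : ℕ) : ∀ z ∈ U,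
    dz^[k] (fun t => B (σ t) (σ' t)) z = B (iteratedDeriv k σ z) (σ' z) := by
  induction k with
  | zero => intro z _; simp
  | succ k ih =>
    intro z hz
    have h1 : dz (dz^[k] fun t => B (σ t) (σ' t)) z =
        dz (fun t => B (iteratedDeriv k σ t) (σ' t)) z :=
      dz_congr (by filter_upwards [hU.mem_nhds hz] with w hw using ih w hw)
    rw [Function.iterate_succ_apply', h1, dz_pairing (B := fun _ => B) (A := 0)
      (fun v x => differentiableAt_const _) (fun v x => by simp [dz_const])
      (hasDerivAt_iteratedDeriv hU hσ k hz) (hσ'.differentiableAt (hU.mem_nhds hz)).hasDerivAt,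
      Matrix.zero_mulVec, add_zero]

theorem iterate_dzbar_pairing (hU : IsOpen U) (hσ : DifferentiableOn ℂ σ U)
    (hσ' : DifferentiableOn ℂ σ' U) (B : Pairing d d') (k : ℕ) : ∀ z ∈ U,
    dzbar^[k] (fun t => B (σ t) (σ' t)) z = B (σ z) (iteratedDeriv k σ' z) := by
  induction k with
  | zero => intro z _; simp
  | succ k ih =>
    intro z hz
    have h1 : dzbar (dzbar^[k] fun t => B (σ t) (σ' t)) z =
        dzbar (fun t => B (σ t) (iteratedDeriv k σ' t)) z :=
      dzbar_congr (by filter_upwards [hU.mem_nhds hz] with w hw using ih w hw)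
    rw [Function.iterate_succ_apply', h1, dzbar_pairing (B := fun _ => B) (A := 0)
      (fun v x => differentiableAt_const _) (fun v x => by simp [dzbar])
      (hσ.differentiableAt (hU.mem_nhds hz)).hasDerivAt (hasDerivAt_iteratedDeriv hU hσ' k hz),
      Matrix.zero_mulVec, add_zero]

theorem act_dz_pairing {U' : Set ℂ} (hU : IsOpen U) (hσ : DifferentiableOn ℂ σ U)
    (hσ' : DifferentiableOn ℂ σ' U) (B : Pairing d d') (P : DiffOp U') {Ψ : ℂ → ℂ}
    (hΨ : ∀ z ∈ U, Ψ z = B (σ z) (σ' z)) {z : ℂ} (hz : z ∈ U) :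
    P.act dz Ψ z = B (P.act deriv σ z) (σ' z) := by
  simp only [DiffOp.act, iterate_dz_congr hU hΨ _ z hz, iterate_dz_pairing hU hσ hσ' B _ z hz,
    iteratedDeriv_eq_iterate, map_sum, map_smul, LinearMap.sum_apply, LinearMap.smul_apply]

theorem actConj_dzbar_pairing {U' : Set ℂ} (hU : IsOpen U) (hσ : DifferentiableOn ℂ σ U)
    (hσ' : DifferentiableOn ℂ σ' U) (B : Pairing d d') (P : DiffOp U') {Ψ : ℂ → ℂ}
    (hΨ : ∀ z ∈ U, Ψ z = B (σ z) (σ' z)) {z : ℂ} (hz : z ∈ U) :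
    P.actConj dzbar Ψ z = B (σ z) (P.act deriv σ' z) := by
  simp only [DiffOp.act, DiffOp.actConj, iterate_dzbar_congr hU hΨ _ z hz,
    iterate_dzbar_pairing hU hσ hσ' B _ z hz, iteratedDeriv_eq_iterate, map_sum,
    LinearMap.map_smulₛₗ, smul_eq_mul]

end ConstantPairing

namespace Oper

variable {χ : Oper G S} {V : HighestWeightRep G d lam} {W : HighestWeightRep G d' mu}

/-- The pairing of the canonical sections, in flat frames. -/
theorem IsLocallyFlat.exists_pairedSection_eq {h : J → ℂ → Pairing d d'}
    (hh : χ.IsLocallyFlat V W h) {a : J} {z : ℂ} (hz : z ∈ (S.chart a).target) :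
    ∃ ε > 0, Metric.ball z ε ⊆ (S.chart a).target ∧ ∃ F : ℂ → G.grp, F z = 1 ∧
      χ.IsFlatFrame a (Metric.ball z ε) F ∧ ∀ t ∈ Metric.ball z ε,
        pairedSection V W h a t = h a z (flatSection V F t) (flatSection W F t) := by
  obtain ⟨ε, hε, hsub, F, hF1, hF⟩ := χ.exists_flatFrame hz 1
  have hev := hh.eventually_eq Metric.isOpen_ball hsub hF (Metric.mem_ball_self hε) hF1
  obtain ⟨δ, hδ, hball⟩ := Metric.eventually_nhds_iff_ball.1
    (hev.and (Metric.ball_mem_nhds z hε))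
  have hle : Metric.ball z δ ⊆ Metric.ball z ε := fun t ht => (hball t ht).2
  exact ⟨δ, hδ, hle.trans hsub, F, hF1, hF.mono hle, fun t ht => (hball t ht).1 V.vec W.vec⟩

theorem IsLocallyFlat.annihilatedBy {h : J → ℂ → Pairing d d'} (hh : χ.IsLocallyFlat V W h) :
    χ.AnnihilatedBy V (pairedSection V W h) := by
  intro a U _ hUt P hP z hz
  obtain ⟨ε, hε, -, F, -, hF, hΨ⟩ := hh.exists_pairedSection_eq (hUt hz)
  have hzb := Metric.mem_ball_self (x := z) hε
  rw [act_dz_pairing Metric.isOpen_ball (hF.differentiableOn_flatSection V)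
    (hF.differentiableOn_flatSection W) (h a z) P hΨ hzb,
    (hF.act_nabla_eq_zero_iff Metric.isOpen_ball V P hzb).1 (hP z hz), map_zero,
    LinearMap.zero_apply]

theorem IsLocallyFlat.annihilatedByConj {h : J → ℂ → Pairing d d'} (hh : χ.IsLocallyFlat V W h) :
    χ.AnnihilatedByConj W (pairedSection V W h) := by
  intro a U _ hUt P hP z hz
  obtain ⟨ε, hε, -, F, -, hF, hΨ⟩ := hh.exists_pairedSection_eq (hUt hz)
  have hzb := Metric.mem_ball_self (x := z) hε
  rw [actConj_dzbar_pairing Metric.isOpen_ball (hF.differentiableOn_flatSection V)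
    (hF.differentiableOn_flatSection W) (h a z) P hΨ hzb,
    (hF.act_nabla_eq_zero_iff Metric.isOpen_ball W P hzb).1 (hP z hz), map_zero]

end Oper

end RealOper

end

noncomputable section

namespace RealOper

open Filter Topology

variable {N r : ℕ} {G : SimpleGroup N r} {X : Type*} [TopologicalSpace X] [ChartedSpace ℂ X]
  {J : Type*} {S : SpinAtlas X J} {d d' : ℕ} {lam mu : Fin r → ℕ}

/-! ### Non-degenerate pairings -/

/-- The linear map from `ℂ^d` to the dual of `ℂ^d'` given by a sesquilinear pairing, through the
complex conjugation of `ℂ^d'`. -/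
def Pairing.toDual (B : Pairing d d') : (Fin d → ℂ) →ₗ[ℂ] Module.Dual ℂ (Fin d' → ℂ) :=
  LinearMap.mk₂ ℂ (fun u w => B u (star w)) (by simp) (by simp) (by simp)
    (fun c u w => by rw [star_smul, LinearMap.map_smulₛₗ]; simp)

@[simp] theorem Pairing.toDual_apply (B : Pairing d d') (u : Fin d → ℂ) (w : Fin d' → ℂ) :
    B.toDual u w = B u (star w) := rfl

theorem Pairing.toDual_injective {B : Pairing d d'} (hB : B.Nondegenerate) :
    Function.Injective B.toDual := by
  rw [injective_iff_map_eq_zero]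
  refine fun u hu => hB.1 u fun w => ?_
  simpa using LinearMap.congr_fun hu (star w)

theorem Pairing.flip_toDual_injective {B : Pairing d d'} (hB : B.Nondegenerate) :
    Function.Injective B.toDual.flip := by
  rw [injective_iff_map_eq_zero]
  refine fun w hw => star_eq_zero.1 (hB.2 (star w) fun u => ?_)
  simpa using LinearMap.congr_fun hw u

theorem Pairing.dim_eq {B : Pairing d d'} (hB : B.Nondegenerate) : d = d' := by
  have h1 := LinearMap.finrank_le_finrank_of_injective (toDual_injective hB)
  have h2 := LinearMap.finrank_le_finrank_of_injective (flip_toDual_injective hB)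
  simp only [Subspace.dual_finrank_eq, Module.finrank_fin_fun] at h1 h2
  exact le_antisymm h1 h2

theorem Pairing.toDual_bijective {B : Pairing d d'} (hB : B.Nondegenerate) :
    Function.Bijective B.toDual := by
  refine ⟨toDual_injective hB,
    (LinearMap.injective_iff_surjective_of_finrank_eq_finrank ?_).1 (toDual_injective hB)⟩
  simp [Subspace.dual_finrank_eq, dim_eq hB]

/-- Every sesquilinear pairing is obtained from a non-degenerate one by an endomorphism. -/
theorem Pairing.exists_endomorphism {B : Pairing d d'} (hB : B.Nondegenerate) (B' : Pairing d d') :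
    ∃ T : Module.End ℂ (Fin d → ℂ), ∀ u w, B' u w = B (T u) w := by
  let e := LinearEquiv.ofBijective B.toDual (toDual_bijective hB)
  refine ⟨e.symm.toLinearMap ∘ₗ B'.toDual, fun u w => ?_⟩
  have h : B.toDual (e.symm (B'.toDual u)) = B'.toDual u := e.apply_symm_apply _
  have := LinearMap.congr_fun h (star w)
  simpa using this.symm

namespace Oper

variable {χ : Oper G S} {V : HighestWeightRep G d lam} {W : HighestWeightRep G d' mu}

/-- If the monodromy of `V` is irreducible and `W` is dual to the complex conjugate of `V`, then the
monodromy of `W` is irreducible. -/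
theorem IrreducibleMonodromy.of_pairing [IsManifold 𝓘(ℂ) ω X] {p : X}
    (hirr : χ.IrreducibleMonodromy V p) {h : J → ℂ → Pairing d d'} (hh : χ.IsLocallyFlat V W h)
    (hn : ∀ a, ∀ z ∈ (S.chart a).target, (h a z).Nondegenerate) :
    χ.IrreducibleMonodromy W p := by
  obtain ⟨a, ha, hd, hE⟩ := hirr
  have hB := hn a _ ((S.chart a).map_source ha)
  set B := h a (S.chart a p)
  refine ⟨a, ha, (Pairing.dim_eq hB) ▸ hd, fun E' hE' => ?_⟩
  let E : Submodule ℂ (Fin d → ℂ) :=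
    { carrier := {u | ∀ w ∈ E', B u w = 0}
      add_mem' := fun {u v} hu hv w hw => by
        rw [map_add, LinearMap.add_apply, hu w hw, hv w hw, add_zero]
      zero_mem' := fun w _ => by simp
      smul_mem' := fun c u hu w hw => by
        rw [map_smul, LinearMap.smul_apply, hu w hw, smul_zero] }
  have hE₀ : E = ⊥ ∨ E = ⊤ := by
    refine hE E ?_
    rintro M ⟨γ, m, hm, rfl⟩ u hu w hw
    have h1 := hh.monodromy ha hm u ((W.rep m⁻¹ : Mat d') *ᵥ w)
    rw [Matrix.mulVec_mulVec, rep_mul_inv, Matrix.one_mulVec] at h1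
    exact h1.trans (hu _ (hE' _ ⟨_, _, hm.inv, rfl⟩ w hw))
  rcases hE₀ with h0 | h0
  · right
    by_contra hne
    obtain ⟨ℓ, hℓ0, hℓ⟩ := Submodule.exists_le_ker_of_lt_top _ (lt_top_iff_ne_top.2 hne)
    let ℓ' : Module.Dual ℂ (Fin d' → ℂ) :=
      { toFun := fun w => star (ℓ (star w))
        map_add' := fun x y => by simp
        map_smul' := fun c x => by simp [star_smul] }
    obtain ⟨u, hu⟩ := (Pairing.toDual_bijective hB).2 ℓ'
    have huw : ∀ w, B u w = star (ℓ w) := fun w => by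
      have := LinearMap.congr_fun hu (star w)
      simpa [ℓ'] using this
    have hu0 : u ∈ E := fun w hw => by
      have h1 : ℓ w = 0 := hℓ hw
      rw [huw, h1, star_zero]
    rw [h0, Submodule.mem_bot] at hu0
    refine hℓ0 (LinearMap.ext fun w => ?_)
    have := huw w
    rw [hu0, map_zero, LinearMap.zero_apply] at this
    simpa using this.symm
  · left
    refine (Submodule.eq_bot_iff _).2 fun w hw => hB.2 w fun u => ?_
    have : u ∈ E := by rw [h0]; trivial
    exact this w hw

/-- Schur's lemma for flat pairings. -/
theorem IsLocallyFlat.exists_eq_smul [IsManifold 𝓘(ℂ) ω X] [ConnectedSpace X] {p : X}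
    (hirr : χ.IrreducibleMonodromy V p) {h h' : J → ℂ → Pairing d d'} (hh : χ.IsLocallyFlat V W h)
    (hn : ∀ a, ∀ z ∈ (S.chart a).target, (h a z).Nondegenerate) (hh' : χ.IsLocallyFlat V W h') :
    ∃ c : ℂ, ∀ a, ∀ z ∈ (S.chart a).target, h' a z = c • h a z := by
  obtain ⟨a, ha, hd, hE⟩ := hirr
  obtain ⟨T, hT⟩ := Pairing.exists_endomorphism (hn a _ ((S.chart a).map_source ha))
    (h' a (S.chart a p))
  have : Nonempty (Fin d) := ⟨⟨0, hd⟩⟩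
  obtain ⟨c, hc⟩ := Module.End.exists_eigenvalue T
  obtain ⟨u₀, hu₀, hne⟩ := hc.exists_hasEigenvector
  have hu₀' := Module.End.mem_eigenspace_iff.1 hu₀
  let E : Submodule ℂ (Fin d → ℂ) :=
    LinearMap.ker (h' a (S.chart a p) - c • h a (S.chart a p))
  have hmem : ∀ u, u ∈ E ↔ ∀ w, h' a (S.chart a p) u w = c * h a (S.chart a p) u w := fun u => by
    simp only [E, LinearMap.mem_ker, LinearMap.ext_iff, LinearMap.sub_apply, LinearMap.smul_apply,
      sub_eq_zero, smul_eq_mul]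
  have htop : E = ⊤ := by
    refine (hE E ?_).resolve_left fun hbot => hne ?_
    · rintro M ⟨γ, m, hm, rfl⟩ u hu
      rw [hmem] at hu ⊢
      intro w
      have h1 := hh.monodromy ha hm u ((W.rep m⁻¹ : Mat d') *ᵥ w)
      have h2 := hh'.monodromy ha hm u ((W.rep m⁻¹ : Mat d') *ᵥ w)
      rw [Matrix.mulVec_mulVec, rep_mul_inv, Matrix.one_mulVec] at h1 h2
      rw [h1, h2, hu]
    · have : u₀ ∈ E := (hmem u₀).2 fun w => by
        rw [hT, hu₀', map_smul, LinearMap.smul_apply, smul_eq_mul]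
      rwa [hbot, Submodule.mem_bot] at this
  refine ⟨c, fun b z hz => hh'.eq_of_eq (hh.smul c) ha ?_ b hz⟩
  refine LinearMap.ext fun u => LinearMap.ext fun w => ?_
  exact (hmem u).1 (by rw [htop]; trivial) w

/-! ### Independence of the components of the canonical section -/

/-- The functional `ℓ` vanishes on the canonical section near `z`, in the flat frame with value `k`
at `z`. -/
def Kills (χ : Oper G S) (V : HighestWeightRep G d lam) (ℓ : (Fin d → ℂ) →ₗ[ℂ] ℂ) (a : J) (z : ℂ)
    (k : G.grp) : Prop :=
  ∃ U F, IsOpen U ∧ U ⊆ (S.chart a).target ∧ z ∈ U ∧ χ.IsFlatFrame a U F ∧ F z = k ∧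
    ∀ᶠ t in 𝓝 z, ℓ (flatSection V F t) = 0

theorem kills_iff {ℓ : (Fin d → ℂ) →ₗ[ℂ] ℂ} {a : J} {U : Set ℂ} {F : ℂ → G.grp} (hU : IsOpen U)
    (hUt : U ⊆ (S.chart a).target) (hF : χ.IsFlatFrame a U F) {z : ℂ} (hz : z ∈ U) :
    χ.Kills V ℓ a z (F z) ↔ ∀ᶠ t in 𝓝 z, ℓ (flatSection V F t) = 0 := by
  refine ⟨?_, fun h => ⟨U, F, hU, hUt, hz, hF, rfl, h⟩⟩
  rintro ⟨U', F', hU', -, hz', hF', heq, h⟩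
  filter_upwards [h, hF'.eventuallyEq hF hU' hU hz' hz heq] with t h1 h2
  rwa [flatSection, h2] at h1

theorem flatSection_mul_right (V : HighestWeightRep G d lam) (F : ℂ → G.grp) (m : G.grp) (z : ℂ) :
    flatSection V (fun t => F t * m) z = (V.rep m⁻¹ : Mat d) *ᵥ flatSection V F z := by
  rw [flatSection, flatSection, mul_inv_rev, rep_mul, Matrix.mulVec_mulVec]

theorem Kills.mul_right {ℓ : (Fin d → ℂ) →ₗ[ℂ] ℂ} {a : J} {z : ℂ} {k : G.grp}
    (h : χ.Kills V ℓ a z k) (m : G.grp) :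
    χ.Kills V (ℓ ∘ₗ (V.rep m : Mat d).mulVecLin) a z (k * m) := by
  obtain ⟨U, F, hU, hUt, hz, hF, rfl, h⟩ := h
  refine ⟨U, _, hU, hUt, hz, hF.mul_right m, rfl, ?_⟩
  filter_upwards [h] with t ht
  rw [flatSection_mul_right, LinearMap.comp_apply, Matrix.mulVecLin_apply, Matrix.mulVec_mulVec,
    rep_mul_inv, Matrix.one_mulVec, ht]

theorem flatSection_change (χ : Oper G S) (V : HighestWeightRep G d lam) (F : ℂ → G.grp) {a b : J}
    {z : ℂ} (hz : z ∈ S.overlap a b) :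
    flatSection V (fun t => χ.g a b ((S.chart a).symm t) * F (S.chart b ((S.chart a).symm t))) z =
      (G.weightFactor lam (S.k a b ((S.chart a).symm z)))⁻¹ •
        flatSection V F (S.chart b ((S.chart a).symm z)) := by
  rw [flatSection, flatSection, mul_inv_rev, rep_mul, ← Matrix.mulVec_mulVec,
    χ.rep_g_inv_vec V ⟨(S.chart a).map_target hz.1, hz.2⟩, Matrix.mulVec_smul]

theorem continuousAt_transition (S : SpinAtlas X J) {a b : J} {x : X}
    (hx : x ∈ (S.chart a).source ∩ (S.chart b).source) :
    Tendsto (fun z => S.chart b ((S.chart a).symm z)) (𝓝 (S.chart a x)) (𝓝 (S.chart b x)) := by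
  have h1 := (S.chart a).continuousAt_symm ((S.chart a).map_source hx.1)
  have h2 := (S.chart b).continuousAt hx.2
  have h3 : ContinuousAt (S.chart b) ((S.chart a).symm (S.chart a x)) := by
    rwa [(S.chart a).left_inv hx.1]
  have h4 := h3.comp h1
  rw [ContinuousAt, Function.comp_apply, (S.chart a).left_inv hx.1] at h4
  exact h4

theorem Kills.change [IsManifold 𝓘(ℂ) ω X] {ℓ : (Fin d → ℂ) →ₗ[ℂ] ℂ} {a b : J} {x : X}
    (hx : x ∈ (S.chart a).source ∩ (S.chart b).source) {k : G.grp}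
    (h : χ.Kills V ℓ b (S.chart b x) k) : χ.Kills V ℓ a (S.chart a x) (χ.g a b x * k) := by
  obtain ⟨U, F, hU, hUt, hz, hF, rfl, h⟩ := h
  have hmem := S.mem_overlap hx.1 hx.2
  refine ⟨_, _, isOpen_change hU a, fun z hz => hz.1.1, ⟨hmem, ?_⟩, hF.change a, ?_, ?_⟩
  · simpa [(S.chart a).left_inv hx.1] using hz
  · simp only [(S.chart a).left_inv hx.1]
  · filter_upwards [(continuousAt_transition S hx).eventually h,
      (S.isOpen_overlap a b).mem_nhds hmem] with t h1 h2
    rw [χ.flatSection_change V F h2, map_smul, h1, smul_zero]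

theorem kills_change_iff [IsManifold 𝓘(ℂ) ω X] {ℓ : (Fin d → ℂ) →ₗ[ℂ] ℂ} {a b : J} {x : X}
    (hx : x ∈ (S.chart a).source ∩ (S.chart b).source) (k : G.grp) :
    χ.Kills V ℓ a (S.chart a x) (χ.g a b x * k) ↔ χ.Kills V ℓ b (S.chart b x) k := by
  refine ⟨fun h => ?_, fun h => h.change hx⟩
  have := h.change (a := b) ⟨hx.2, hx.1⟩
  rwa [← mul_assoc, χ.g_inv hx.1 hx.2, one_mul] at this

theorem eventually_kills_iff {ℓ : (Fin d → ℂ) →ₗ[ℂ] ℂ} {a : J} {U : Set ℂ} {F : ℂ → G.grp}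
    (hU : IsOpen U) (hUt : U ⊆ (S.chart a).target) (hF : χ.IsFlatFrame a U F) {z : ℂ} (hz : z ∈ U) :
    ∀ᶠ w in 𝓝 z, (χ.Kills V ℓ a w (F w) ↔ χ.Kills V ℓ a z (F z)) := by
  obtain ⟨ε, hε, hball⟩ := Metric.isOpen_iff.1 hU z hz
  have han : AnalyticOnNhd ℂ (fun t => ℓ (flatSection V F t)) (Metric.ball z ε) :=
    (ℓ.toContinuousLinearMap.differentiable.comp_differentiableOn
      ((hF.differentiableOn_flatSection V).mono hball)).analyticOnNhd Metric.isOpen_ball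
  have hpre := (convex_ball z ε).isPreconnected
  have key : ∀ w ∈ Metric.ball z ε, ∀ t ∈ Metric.ball z ε,
      (∀ᶠ s in 𝓝 w, ℓ (flatSection V F s) = 0) → ∀ᶠ s in 𝓝 t, ℓ (flatSection V F s) = 0 := by
    intro w hw t ht h
    have := han.eqOn_zero_of_preconnected_of_eventuallyEq_zero hpre hw h
    filter_upwards [Metric.isOpen_ball.mem_nhds ht] with s hs using this hs
  filter_upwards [Metric.ball_mem_nhds z hε] with w hw
  have hzb := Metric.mem_ball_self (x := z) hε
  rw [kills_iff hU hUt hF (hball hw), kills_iff hU hUt hF hz]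
  exact ⟨key w hw z hzb, key z hzb w hw⟩

theorem IsParallel.kills_iff [IsManifold 𝓘(ℂ) ω X] {p q : X} {γ : Path p q}
    {y : unitInterval → J → G.grp} (hy : χ.IsParallel γ y) (ℓ : (Fin d → ℂ) →ₗ[ℂ] ℂ) {a b : J}
    (ha : p ∈ (S.chart a).source) (hb : q ∈ (S.chart b).source) :
    χ.Kills V ℓ a (S.chart a p) (y 0 a) ↔ χ.Kills V ℓ b (S.chart b q) (y 1 b) :=
  hy.transport (Q := χ.Kills V ℓ) (fun _ _ _ hx k => kills_change_iff hx k)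
    (fun _ _ _ hU hUt hF _ hz => eventually_kills_iff hU hUt hF hz) ha hb

/-- If the monodromy is irreducible, the components of the canonical section in a flat frame are
linearly independent near every point. -/
theorem IrreducibleMonodromy.isIndependentAt [IsManifold 𝓘(ℂ) ω X] [ConnectedSpace X] {p : X}
    (hirr : χ.IrreducibleMonodromy V p) {a : J} {U : Set ℂ} {F : ℂ → G.grp} (hU : IsOpen U)
    (hUt : U ⊆ (S.chart a).target) (hF : χ.IsFlatFrame a U F) {z : ℂ} (hz : z ∈ U) :
    IsIndependentAt (flatSection V F) z := by
  obtain ⟨a₀, hp, -, hE⟩ := hirr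
  have hbase : ∀ ℓ, χ.Kills V ℓ a₀ (S.chart a₀ p) 1 → ℓ = 0 := by
    let E : Submodule ℂ (Fin d → ℂ) :=
      ⨅ ℓ : {ℓ : (Fin d → ℂ) →ₗ[ℂ] ℂ // χ.Kills V ℓ a₀ (S.chart a₀ p) 1}, LinearMap.ker ℓ.1
    have hmem : ∀ u, u ∈ E ↔ ∀ ℓ, χ.Kills V ℓ a₀ (S.chart a₀ p) 1 → ℓ u = 0 := fun u => by
      simp [E]
    have htop : E = ⊤ := by
      refine (hE E ?_).resolve_left fun hbot => V.vec_ne_zero ?_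
      · rintro M ⟨γ, m, hm, rfl⟩ u hu
        rw [hmem] at hu ⊢
        intro ℓ hℓ
        refine hu (ℓ ∘ₗ (V.rep m : Mat d).mulVecLin) ?_
        obtain ⟨y, hy, h0, h1⟩ := hm.inv
        have h2 := hy.kills_iff (V := V) ℓ hp hp
        rw [h0, h1] at h2
        simpa using (h2.1 hℓ).mul_right m
      · have : V.vec ∈ E := (hmem _).2 fun ℓ hℓ => by
          obtain ⟨U, F, -, -, -, -, h1, h⟩ := hℓ
          simpa [flatSection, h1] using h.self_of_nhds
        rwa [hbot, Submodule.mem_bot] at this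
    intro ℓ hℓ
    refine LinearMap.ext fun u => ?_
    exact (hmem u).1 (by rw [htop]; trivial) ℓ hℓ
  intro ℓ hℓ
  obtain ⟨-, γ, y, hy, h0, -⟩ := χ.exists_reaches hp ((S.chart a).symm z)
  have h1 := (kills_iff hU hUt hF hz).2 hℓ
  have h2 := h1.mul_right ((F z)⁻¹ * y 1 a)
  rw [mul_inv_cancel_left] at h2
  have h3 := hy.kills_iff (V := V)
    (ℓ ∘ₗ (V.rep ((F z)⁻¹ * y 1 a) : Mat d).mulVecLin) hp ((S.chart a).map_target (hUt hz))
  rw [h0, (S.chart a).right_inv (hUt hz)] at h3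
  have h4 := hbase _ (h3.2 h2)
  refine LinearMap.ext fun u => ?_
  have h5 := LinearMap.congr_fun h4 ((V.rep ((F z)⁻¹ * y 1 a)⁻¹ : Mat d) *ᵥ u)
  rwa [LinearMap.comp_apply, Matrix.mulVecLin_apply, Matrix.mulVec_mulVec, rep_mul_inv,
    Matrix.one_mulVec] at h5

end Oper

end RealOper

end

noncomputable section

namespace RealOper

open Filter Topology

variable {N r : ℕ} {G : SimpleGroup N r} {X : Type*} [TopologicalSpace X] [ChartedSpace ℂ X]
  {J : Type*} {S : SpinAtlas X J} {d d' : ℕ} {lam mu : Fin r → ℕ}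

/-! ### Existence of a flat pairing -/

/-- The sesquilinear pairing `(v, w) ↦ w* Q v`. -/
def Pairing.ofDuality (Q : Matrix (Fin d') (Fin d) ℂ) : Pairing d d' :=
  LinearMap.mk₂'ₛₗ (RingHom.id ℂ) (starRingEnd ℂ) (fun v w => star w ⬝ᵥ (Q *ᵥ v))
    (fun v v' w => by rw [Matrix.mulVec_add, dotProduct_add])
    (fun c v w => by rw [Matrix.mulVec_smul, dotProduct_smul]; rfl)
    (fun v w w' => by rw [star_add, add_dotProduct])
    (fun c v w => by rw [star_smul, smul_dotProduct]; rfl)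

theorem Pairing.ofDuality_apply (Q : Matrix (Fin d') (Fin d) ℂ) (v : Fin d → ℂ) (w : Fin d' → ℂ) :
    Pairing.ofDuality Q v w = star w ⬝ᵥ (Q *ᵥ v) := rfl

namespace Oper

variable {χ : Oper G S} {V : HighestWeightRep G d lam} {W : HighestWeightRep G d' mu}

theorem IsReal.exists_isFlatPairing [IsManifold 𝓘(ℂ) ω X] [ConnectedSpace X] {p : X}
    (hreal : χ.IsReal p) {Q : Matrix (Fin d') (Fin d) ℂ} (hQ : IsDualityMatrix V W Q) :
    ∃ h : J → ℂ → Pairing d d', χ.IsFlatPairing V W h := by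
  obtain ⟨a, ha, c, hc⟩ := hreal
  suffices hB : (∀ γ m, χ.IsMonodromy (p := p) a γ m → ∀ v w,
      Pairing.ofDuality (Q * (V.rep c : Mat d)) ((V.rep m : Mat d) *ᵥ v) ((W.rep m : Mat d') *ᵥ w) =
        Pairing.ofDuality (Q * (V.rep c : Mat d)) v w) ∧
      (Pairing.ofDuality (Q * (V.rep c : Mat d))).Nondegenerate by
    obtain ⟨h, hh, hn⟩ := χ.exists_isLocallyFlat V W ha _ hB.1 hB.2
    exact ⟨h, hh.isFlatPairing hn⟩
  refine ⟨fun γ m hm v w => ?_, fun v hv => ?_, fun w hw => ?_⟩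
  · obtain ⟨g', hg', hQg⟩ := hQ.grp m
    have hg : g' = c * m * c⁻¹ := G.mat_injective (hg'.trans (hc γ m hm))
    simp only [Pairing.ofDuality_apply]
    rw [← HighestWeightRep.conj_mulVec]
    conv_rhs => rw [← hQg]
    rw [dotProduct_comm, Matrix.dotProduct_mulVec, ← Matrix.mulVec_transpose, dotProduct_comm]
    congr 1
    simp only [Matrix.mulVec_mulVec]
    congr 1
    have : (V.rep c : Mat d) * (V.rep m : Mat d) = (V.rep g' : Mat d) * (V.rep c : Mat d) := by
      rw [← rep_mul, ← rep_mul, hg, inv_mul_cancel_right]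
    simp only [Matrix.mul_assoc, this]
  · have h1 : Q *ᵥ ((V.rep c : Mat d) *ᵥ v) = 0 := by
      rw [Matrix.mulVec_mulVec]
      refine dotProduct_eq_zero _ fun w => ?_
      have := hv (star w)
      rwa [Pairing.ofDuality_apply, star_star, dotProduct_comm] at this
    exact Matrix.eq_zero_of_mulVec_eq_zero (det_rep_ne_zero V.rep c) (hQ.left _ h1)
  · have h1 : star w ᵥ* Q = 0 := by
      refine dotProduct_eq_zero _ fun v => ?_
      have := hw ((V.rep c⁻¹ : Mat d) *ᵥ v)
      rwa [Pairing.ofDuality_apply, Matrix.mulVec_mulVec, Matrix.mul_assoc, rep_mul_inv,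
        Matrix.mul_one, Matrix.dotProduct_mulVec] at this
    exact star_eq_zero.1 (hQ.right _ h1)

/-! ### Sections annihilated by both ideals -/

section Solutions

variable [IsManifold 𝓘(ℂ) ω X] [ConnectedSpace X] {p : X}

/-- A pairing is determined by its values on the canonical sections near a point. -/
theorem pairing_eq_of_flatSection (hV : χ.IrreducibleMonodromy V p)
    (hW : χ.IrreducibleMonodromy W p) {a : J} {U : Set ℂ} {F : ℂ → G.grp} (hU : IsOpen U)
    (hUt : U ⊆ (S.chart a).target) (hF : χ.IsFlatFrame a U F) {z : ℂ} (hz : z ∈ U)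
    {B B' : Pairing d d'} (h : ∀ᶠ t in 𝓝 z, B (flatSection V F t) (flatSection W F t) =
      B' (flatSection V F t) (flatSection W F t)) : B = B' := by
  rw [← sub_eq_zero]
  refine pairing_eq_zero hU (hF.differentiableOn_flatSection V) (hF.differentiableOn_flatSection W)
    hz (hV.isIndependentAt hU hUt hF hz) (hW.isIndependentAt hU hUt hF hz) ?_
  filter_upwards [h] with t ht
  rw [LinearMap.sub_apply, LinearMap.sub_apply, ht, sub_self]

theorem IsFlatPairing.exists_pairedSection_ne_zero (hV : χ.IrreducibleMonodromy V p)
    (hW : χ.IrreducibleMonodromy W p) {h : J → ℂ → Pairing d d'} (hh : χ.IsFlatPairing V W h) :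
    ∃ a, ∃ z ∈ (S.chart a).target, pairedSection V W h a z ≠ 0 := by
  by_contra! hzero
  obtain ⟨a, ha⟩ := S.cover p
  have hz := (S.chart a).map_source ha
  obtain ⟨ε, hε, hsub, F, -, hF, hΨ⟩ := hh.isLocallyFlat.exists_pairedSection_eq hz
  have h0 : h a (S.chart a p) = 0 := by
    refine pairing_eq_of_flatSection hV hW Metric.isOpen_ball hsub hF (Metric.mem_ball_self hε) ?_
    filter_upwards [Metric.ball_mem_nhds _ hε] with t ht
    rw [← hΨ t ht, hzero a t (hsub ht), LinearMap.zero_apply, LinearMap.zero_apply]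
  exact V.vec_ne_zero ((hh.nondegenerate a _ hz).1 V.vec fun w => by rw [h0]; rfl)

variable {Φ : J → ℂ → ℂ}

/-- A smooth solution of both systems is, locally, a sesquilinear expression in the canonical
sections. -/
theorem exists_pairing_flatSection (hV : χ.IrreducibleMonodromy V p)
    (hW : χ.IrreducibleMonodromy W p) {a : J} (hΦ : ContDiffOn ℝ ∞ (Φ a) (S.chart a).target)
    (hann : χ.AnnihilatedBy V Φ) (hann' : χ.AnnihilatedByConj W Φ) {U : Set ℂ} {F : ℂ → G.grp}
    (hU : IsOpen U) (hUt : U ⊆ (S.chart a).target) (hF : χ.IsFlatFrame a U F) {z : ℂ} (hz : z ∈ U) :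
    ∃ B : Pairing d d', ∀ᶠ t in 𝓝 z, Φ a t = B (flatSection V F t) (flatSection W F t) := by
  have hσ := hF.differentiableOn_flatSection V
  have hσ' := hF.differentiableOn_flatSection W
  obtain ⟨n, hn⟩ := exists_derivMatrix hU hσ hz (hV.isIndependentAt hU hUt hF hz)
  obtain ⟨n', hn'⟩ := exists_derivMatrix hU hσ' hz (hW.isIndependentAt hU hUt hF hz)
  have hdet : ∀ᶠ t in 𝓝 z, (derivMatrix (flatSection V F) n t).det ≠ 0 :=
    (HasMatDerivAt.differentiableAt_det
      (differentiableAt_derivMatrix hU hσ n hz)).continuousAt.eventually_ne hn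
  have hdet' : ∀ᶠ t in 𝓝 z, (derivMatrix (flatSection W F) n' t).det ≠ 0 :=
    (HasMatDerivAt.differentiableAt_det
      (differentiableAt_derivMatrix hU hσ' n' hz)).continuousAt.eventually_ne hn'
  obtain ⟨ε, hε, hball⟩ := Metric.eventually_nhds_iff_ball.1
    (hdet.and (hdet'.and (hU.mem_nhds hz)))
  have hsub : Metric.ball z ε ⊆ U := fun t ht => (hball t ht).2.2
  refine exists_pairing Metric.isOpen_ball (hσ.mono hsub) (hσ'.mono hsub)
    (fun t ht => (hball t ht).1) (fun t ht => (hball t ht).2.1) (hΦ.mono (hsub.trans hUt))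
    (fun P hP => hann a _ Metric.isOpen_ball (hsub.trans hUt) P fun t ht => ?_)
    (fun P hP => hann' a _ Metric.isOpen_ball (hsub.trans hUt) P fun t ht => ?_)
    (Metric.mem_ball_self hε)
  · exact (hF.act_nabla_eq_zero_iff hU V P (hsub ht)).2 (hP t ht)
  · exact (hF.act_nabla_eq_zero_iff hU W P (hsub ht)).2 (hP t ht)

theorem exists_family_pairing (hV : χ.IrreducibleMonodromy V p) (hW : χ.IrreducibleMonodromy W p)
    (hΦ : ∀ a, ContDiffOn ℝ ∞ (Φ a) (S.chart a).target)
    (hann : χ.AnnihilatedBy V Φ) (hann' : χ.AnnihilatedByConj W Φ) :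
    ∃ h : J → ℂ → Pairing d d', ∀ a U F, IsOpen U → U ⊆ (S.chart a).target →
      χ.IsFlatFrame a U F → ∀ z ∈ U, ∀ᶠ t in 𝓝 z, Φ a t =
        (h a z).pull (V.rep (F z) : Mat d) (W.rep (F z) : Mat d')
          (flatSection V F t) (flatSection W F t) := by
  have key : ∀ a z, ∃ B : Pairing d d', z ∈ (S.chart a).target → ∀ U F, IsOpen U →
      χ.IsFlatFrame a U F → z ∈ U → ∀ᶠ t in 𝓝 z, Φ a t =
        B.pull (V.rep (F z) : Mat d) (W.rep (F z) : Mat d')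
          (flatSection V F t) (flatSection W F t) := by
    intro a z
    by_cases hz : z ∈ (S.chart a).target
    · obtain ⟨ε, hε, hsub, F₀, hF₀1, hF₀⟩ := χ.exists_flatFrame hz 1
      have hzb := Metric.mem_ball_self (x := z) hε
      obtain ⟨B, hB⟩ := exists_pairing_flatSection hV hW (hΦ a) hann hann' Metric.isOpen_ball hsub
        hF₀ hzb
      refine ⟨B, fun _ U F hU hF hzU => ?_⟩
      filter_upwards [hB, (hF₀.mul_right (F z)).eventuallyEq hF Metric.isOpen_ball hU hzb hzU
        (by rw [hF₀1, one_mul])] with t h1 h2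
      have e : F₀ t = F t * (F z)⁻¹ := by rw [← h2, mul_inv_cancel_right]
      rw [h1, Pairing.pull_apply, flatSection, flatSection, flatSection, flatSection, e]
      simp only [mul_inv_rev, inv_inv, rep_mul, Matrix.mulVec_mulVec]
    · exact ⟨0, fun h => absurd h hz⟩
  choose h hh using key
  exact ⟨h, fun a U F hU hUt hF z hz => hh a z (hUt hz) U F hU hF hz⟩

/-- A section of `Ω^{-⟨λ,ρ⟩}` annihilated by both ideals is obtained by pairing the canonical
sections by a flat pairing. -/
theorem exists_isLocallyFlat_of_annihilated (hV : χ.IrreducibleMonodromy V p)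
    (hW : χ.IrreducibleMonodromy W p) (hρ : G.rhoPairing lam = G.rhoPairing mu)
    (hΦ : IsOmegaSection S (-G.rhoPairing lam) Φ)
    (hann : χ.AnnihilatedBy V Φ) (hann' : χ.AnnihilatedByConj W Φ) :
    ∃ h : J → ℂ → Pairing d d', χ.IsLocallyFlat V W h ∧
      ∀ a, ∀ z ∈ (S.chart a).target, Φ a z = pairedSection V W h a z := by
  obtain ⟨h, hh⟩ := exists_family_pairing hV hW hΦ.smooth hann hann'
  refine ⟨h, ⟨fun a b x hx v w => ?_, fun a U F hU hUt hF z hz => ?_⟩, fun a z hz => ?_⟩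
  · obtain ⟨ε, hε, hsub, F, hF1, hF⟩ := χ.exists_flatFrame ((S.chart b).map_source hx.2) 1
    have hmem := S.mem_overlap hx.1 hx.2
    have hz : S.chart a x ∈ S.overlap a b ∩
        {z | S.chart b ((S.chart a).symm z) ∈ Metric.ball (S.chart b x) ε} :=
      ⟨hmem, by simpa [(S.chart a).left_inv hx.1] using hε⟩
    have ha := hh a _ _ (isOpen_change Metric.isOpen_ball a) (fun z hz => hz.1.1) (hF.change a) _ hz
    have hb := hh b _ F Metric.isOpen_ball hsub hF _ (Metric.mem_ball_self hε)
    simp only [(S.chart a).left_inv hx.1, hF1, mul_one] at ha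
    have heq : (h a (S.chart a x)).pull (V.rep (χ.g a b x) : Mat d) (W.rep (χ.g a b x) : Mat d') =
        h b (S.chart b x) := by
      refine pairing_eq_of_flatSection hV hW (isOpen_change Metric.isOpen_ball a)
        (fun z hz => hz.1.1) (hF.change a) hz ?_
      filter_upwards [ha, (continuousAt_transition S hx).eventually hb,
        (S.isOpen_overlap a b).mem_nhds hmem] with t h1 h2 h3
      have hxt : (S.chart a).symm t ∈ (S.chart a).source ∩ (S.chart b).source :=
        ⟨(S.chart a).map_target h3.1, h3.2⟩
      have h4 := hΦ.compat a b _ hxt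
      rw [(S.chart a).right_inv h3.1, omega_factor S hρ hxt, h2] at h4
      rw [← h1, h4, χ.flatSection_change V F h3, χ.flatSection_change W F h3]
      simp only [hF1, map_one, Units.val_one, Pairing.pull_apply, Matrix.one_mulVec, map_smul,
        LinearMap.map_smulₛₗ, LinearMap.smul_apply, smul_eq_mul, map_inv₀]
      rw [mul_inv]
      ring
    rw [← heq, Pairing.pull_apply]
  · filter_upwards [(hh a U F hU hUt hF z hz).eventually_nhds, hU.mem_nhds hz] with t ht htU v w
    have heq := pairing_eq_of_flatSection hV hW hU hUt hF htU
      (B := (h a t).pull (V.rep (F t) : Mat d) (W.rep (F t) : Mat d'))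
      (B' := (h a z).pull (V.rep (F z) : Mat d) (W.rep (F z) : Mat d')) (by
        filter_upwards [ht, hh a U F hU hUt hF t htU] with s h1 h2
        rw [← h1, ← h2])
    exact LinearMap.congr_fun (LinearMap.congr_fun heq v) w
  · obtain ⟨ε, hε, hsub, F, hF1, hF⟩ := χ.exists_flatFrame hz 1
    have := (hh a _ F Metric.isOpen_ball hsub hF z (Metric.mem_ball_self hε)).self_of_nhds
    rw [this]
    simp [flatSection, hF1, pairedSection, canonicalSection]

end Solutions

end Oper

end RealOper

end

theorem corollary4p2 {X : Type*} [TopologicalSpace X] [T2Space X] [CompactSpace X]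
    [ConnectedSpace X] [ChartedSpace ℂ X] [IsManifold 𝓘(ℂ) ω X]
    {J : Type*} (S : RealOper.SpinAtlas X J)
    {N r : ℕ} (G : RealOper.SimpleGroup N r)
    (χ : RealOper.Oper G S) (p : X) (hreal : χ.IsReal p)
    (lam mu : Fin r → ℕ) (hmu : G.IsNegLongest lam mu) {d d' : ℕ}
    (V : RealOper.HighestWeightRep G d lam) (W : RealOper.HighestWeightRep G d' mu)
    (hirr : χ.IrreducibleMonodromy V p) :
    (∃ h : J → ℂ → ((Fin d → ℂ) →ₗ[ℂ] (Fin d' → ℂ) →ₗ⋆[ℂ] ℂ), χ.IsFlatPairing V W h) ∧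
    ∀ h : J → ℂ → ((Fin d → ℂ) →ₗ[ℂ] (Fin d' → ℂ) →ₗ⋆[ℂ] ℂ), χ.IsFlatPairing V W h →
      RealOper.IsOmegaSection S (-G.rhoPairing lam) (RealOper.Oper.pairedSection V W h) ∧
      (∃ a, ∃ z ∈ (S.chart a).target, RealOper.Oper.pairedSection V W h a z ≠ 0) ∧
      χ.AnnihilatedBy V (RealOper.Oper.pairedSection V W h) ∧
      χ.AnnihilatedByConj W (RealOper.Oper.pairedSection V W h) ∧
      ∀ Φ : J → ℂ → ℂ, RealOper.IsOmegaSection S (-G.rhoPairing lam) Φ →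
        χ.AnnihilatedBy V Φ → χ.AnnihilatedByConj W Φ →
        ∃ c : ℂ, ∀ a, ∀ z ∈ (S.chart a).target,
          Φ a z = c * RealOper.Oper.pairedSection V W h a z := by
  obtain ⟨Q, hQ⟩ := RealOper.exists_isDualityMatrix V W hmu
  have hρ := hQ.rhoPairing_eq
  refine ⟨hreal.exists_isFlatPairing hQ, fun h hh => ?_⟩
  have hW := hirr.of_pairing hh.isLocallyFlat hh.nondegenerate
  refine ⟨hh.isOmegaSection hρ, hh.exists_pairedSection_ne_zero hirr hW,
    hh.isLocallyFlat.annihilatedBy, hh.isLocallyFlat.annihilatedByConj, fun Φ hΦ hann hann' => ?_⟩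
  obtain ⟨h', hh', hΦ'⟩ :=
    RealOper.Oper.exists_isLocallyFlat_of_annihilated hirr hW hρ hΦ hann hann'
  obtain ⟨c, hc⟩ := hh.isLocallyFlat.exists_eq_smul hirr hh.nondegenerate hh'
  refine ⟨c, fun a z hz => ?_⟩
  rw [hΦ' a z hz, RealOper.Oper.pairedSection, hc a z hz]
  rfl
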